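/- Notation. For $n\ge 1$ let $\mathscr F f(\xi)=\int_{\mathbb R^n}e^{-ix\cdot\xi}f(x)\,dx$ be the Fourier transform, extended to $\mathscr S'(\mathbb R^n)$, and let $\varepsilon\in\{0,1\}$. Let $S(t)=e^{it(\Delta^2-\varepsilon\Delta)}=\mathscr F^{-1}e^{it(|\xi|^4+\varepsilon|\xi|^2)}\mathscr F$ and $$\mathscr A f(t)=\int_0^t S(t-\tau)f(\tau)\,d\tau ,\qquad t\in\mathbb R,$$ where $f:\mathbb R\to\mathscr S'(\mathbb R^n)$ is any function of time for which this integral exists weakly, that is, for every $t$ and every Schwartz function $\varphi$ the function $\tau\mapsto\langle S(t-\tau)f(\tau),\varphi\rangle$ is integrable between $0$ and $t$, and its integral over $[0,t]$ defines $\mathscr Af(t)\in\mathscr S'(\mathbb R^n)$. Let $\{\sigma_k\}_{k\in\mathbb Z^n}$ be a sequence of smooth real functions on $\mathbb R^n$ such that, for some $c>0$, $\sigma_k\ge c$ on the unit cube $Q_k=\{\xi:|\xi_j-k_j|\le\frac12,\ j=1,\dots,n\}$; $\operatorname{supp}\sigma_k\subset\{\xi:|\xi-k|\le\sqrt n\}$;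 $\sum_{k\in\mathbb Z^n}\sigma_k\equiv1$; and for each $m$ the derivatives of order at most $m$ of all the $\sigma_k$ are bounded by a constant $C_m$. Put $\Box_k=\mathscr F^{-1}\sigma_k\mathscr F$ and $k_{\max}=\max_{1\le l\le n}|k_l|$. For $1\le i\le n$ and $p\in[1,\infty]$ let $$\|g\|_{L^p_{x_i}L^2_{(x_j)_{j\ne i}}L^2_t}=\Big\|\ \|g\|_{L^2_{(x_j)_{j\ne i},\,t}(\mathbb R^{n-1}\times\mathbb R)}\ \Big\|_{L^p_{x_i}(\mathbb R)},$$ with value $\infty$ if $g$ is not a measurable function of $(t,x)$. **Proposition.** There is an absolute constant $C$ such that, for all $n\ge1$, $\varepsilon\in\{0,1\}$, all $\{\sigma_k\}$ as above, all $i\in\{1,\dots,n\}$, all $k\in\mathbb Z^n$ with $|k_i|=k_{\max}$, and all $f$ as above, $$\big\|\Box_k\,\partial_{x_i}^3\mathscr A f\big\|_{L^\infty_{x_i}L^2_{(x_j)_{j\ne i}}L^2_t(\mathbb R^{1+n})}\ \le\ C\,\big\|\Box_k f\big\|_{L^1_{x_i}L^2_{(x_j)_{j\ne i}}L^2_t(\mathbb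 R^{1+n})}.$$ -/

import Mathlib

open MeasureTheory
open scoped SchwartzMap ENNReal NNReal ContDiff LineDeriv

noncomputable section

/-- `k_max = max_l |k_l|` for a lattice point `k ∈ ℤⁿ`. -/
def kMax {n : ℕ} (k : Fin n → ℤ) : ℕ :=
  Finset.univ.sup fun l => (k l).natAbs

/-- The lattice point `k ∈ ℤⁿ` as a point of Euclidean space. -/
def latticePoint {n : ℕ} (k : Fin n → ℤ) : EuclideanSpace ℝ (Fin n) :=
  WithLp.toLp 2 fun i => (k i : ℝ)

/-- The families `{σ_k}` from which the frequency-uniform decomposition operators are built: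
smooth functions with `σ_k ≥ c > 0` on the unit cube `Q_k` centred at `k`, supported in the ball of
radius `√n` about `k`, summing to one, with derivatives of each order bounded uniformly in `k`. -/
structure IsUniformDecomposition {n : ℕ}
    (σ : (Fin n → ℤ) → EuclideanSpace ℝ (Fin n) → ℝ) : Prop where
  smooth : ∀ k, ContDiff ℝ ∞ (σ k)
  lower_bound : ∃ c : ℝ, 0 < c ∧ ∀ (k : Fin n → ℤ) (ξ : EuclideanSpace ℝ (Fin n)),
    (∀ i, |ξ i - k i| ≤ 1 / 2) → c ≤ σ k ξ
  support_subset : ∀ k, tsupport (σ k) ⊆ Metric.closedBall (latticePoint k) (√(n : ℝ))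
  sum_eq_one : ∀ ξ, HasSum (fun k => σ k ξ) 1
  deriv_bound : ∀ m : ℕ, ∃ C : ℝ, ∀ (k : Fin n → ℤ) (ξ : EuclideanSpace ℝ (Fin n)),
    ‖iteratedFDeriv ℝ m (σ k) ξ‖ ≤ C

/-- The Fourier multiplier `𝓕⁻¹ m 𝓕` on tempered distributions, for the Fourier transform
`𝓕 f(ξ) = ∫ e^{-i x·ξ} f(x) dx`. Mathlib's transform uses `e^{-2πi x·ξ}`, hence the dilation.
It is used only for symbols `m` of temperate growth. -/
def freqMultiplier {n : ℕ} (m : EuclideanSpace ℝ (Fin n) → ℂ) :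
    𝓢'(EuclideanSpace ℝ (Fin n), ℂ) →L[ℂ] 𝓢'(EuclideanSpace ℝ (Fin n), ℂ) :=
  TemperedDistribution.fourierMultiplierCLM ℂ fun ξ => m ((2 * Real.pi) • ξ)

/-- The frequency-uniform decomposition operator `□_k = 𝓕⁻¹ σ_k 𝓕`. -/
def boxOp {n : ℕ} (σ : (Fin n → ℤ) → EuclideanSpace ℝ (Fin n) → ℝ) (k : Fin n → ℤ) :
    𝓢'(EuclideanSpace ℝ (Fin n), ℂ) →L[ℂ] 𝓢'(EuclideanSpace ℝ (Fin n), ℂ) :=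
  freqMultiplier fun ξ => (σ k ξ : ℂ)

/-- The group `S(t) = e^{it(Δ² - εΔ)} = 𝓕⁻¹ e^{it(|ξ|⁴ + ε|ξ|²)} 𝓕`. -/
def propagator (n : ℕ) (ε t : ℝ) :
    𝓢'(EuclideanSpace ℝ (Fin n), ℂ) →L[ℂ] 𝓢'(EuclideanSpace ℝ (Fin n), ℂ) :=
  freqMultiplier fun ξ => Complex.exp (Complex.I * ((t * (‖ξ‖ ^ 4 + ε * ‖ξ‖ ^ 2) : ℝ) : ℂ))

/-- `u = 𝒜 f`, that is, `u(t) = ∫₀ᵗ S(t - τ) f(τ) dτ` for every `t`. The integral of distributions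
is taken in the weak sense: for each test function the integrand is integrable on the interval
between `0` and `t`, and its integral is the value of `u(t)`. -/
def IsDuhamel {n : ℕ} (ε : ℝ) (f u : ℝ → 𝓢'(EuclideanSpace ℝ (Fin n), ℂ)) : Prop :=
  ∀ (t : ℝ) (φ : 𝓢(EuclideanSpace ℝ (Fin n), ℂ)),
    IntervalIntegrable (fun τ => propagator n ε (t - τ) (f τ) φ) volume 0 t ∧
      u t φ = ∫ τ in (0 : ℝ)..t, propagator n ε (t - τ) (f τ) φ

/-- The third partial derivative `∂³/∂x_i³` of a tempered distribution. -/
def partialCubed {n : ℕ} (i : Fin n) (v : 𝓢'(EuclideanSpace ℝ (Fin n), ℂ)) :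
    𝓢'(EuclideanSpace ℝ (Fin n), ℂ) :=
  ∂_{EuclideanSpace.single i (1 : ℝ)} (∂_{EuclideanSpace.single i (1 : ℝ)}
    (∂_{EuclideanSpace.single i (1 : ℝ)} v))

/-- The point of `ℝⁿ` whose `i`-th coordinate is `s` and whose other coordinates are given by `y`. -/
def assemble {n : ℕ} (i : Fin n) (s : ℝ) (y : {j : Fin n // j ≠ i} → ℝ) :
    EuclideanSpace ℝ (Fin n) :=
  WithLp.toLp 2 fun j => if h : j = i then s else y ⟨j, h⟩

/-- The norm of `L^p_{x_i} L^q_{(x_j)_{j ≠ i}} L^q_t` of a function `G(t, x)` on `ℝ × ℝⁿ`. -/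
def mixedNorm {n : ℕ} (i : Fin n) (p q : ℝ≥0∞) (G : ℝ → EuclideanSpace ℝ (Fin n) → ℂ) : ℝ≥0∞ :=
  eLpNorm (fun s : ℝ =>
    eLpNorm (fun z : ({j : Fin n // j ≠ i} → ℝ) × ℝ => G z.2 (assemble i s z.1)) q volume) p volume

/-- The jointly measurable function `G(t, x)` is, for almost every `t`, the distribution `v(t)`. -/
def Represents {n : ℕ} (G : ℝ → EuclideanSpace ℝ (Fin n) → ℂ)
    (v : ℝ → 𝓢'(EuclideanSpace ℝ (Fin n), ℂ)) : Prop :=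
  AEStronglyMeasurable (fun z : ℝ × EuclideanSpace ℝ (Fin n) => G z.1 z.2) volume ∧
    ∀ᵐ t : ℝ, ∀ φ : 𝓢(EuclideanSpace ℝ (Fin n), ℂ),
      Integrable (fun x => φ x * G t x) volume ∧ v t φ = ∫ x, φ x * G t x

/-- The norm of `L^p_{x_i} L^q_{(x_j)_{j ≠ i}} L^q_t` of a distribution-valued function of time: the
norm of the function that represents it (any two agree almost everywhere), and `∞` if it is not a
function. -/
def anisoNorm {n : ℕ} (i : Fin n) (p q : ℝ≥0∞) (v : ℝ → 𝓢'(EuclideanSpace ℝ (Fin n), ℂ)) :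
    ℝ≥0∞ :=
  ⨅ (G : ℝ → EuclideanSpace ℝ (Fin n) → ℂ) (_ : Represents G v), mixedNorm i p q G

end

set_option linter.unusedSectionVars false

/-! ### One-dimensional resolvent kernel -/

noncomputable section

/-! The estimate is proved by duality, with the box operator carried as a passive factor. All the
operators are Fourier multipliers, so the box commutes with the rest. With `g = □_k f` and a
space-time test function `H`, the pairing of `□_k ∂_i³ 𝒜 f` with `H` equals the pairing of `g` with
a transposed Duhamel integral of `H`. It suffices to bound that integral from `L¹L²` to `L^∞L²` in
the `i`-th variable.

At fixed `τ`, the kernel of `∫₀ᵗ` is a one-sided function of `t - τ`: the indicator of `t ≥ τ` if `τ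
> 0`, minus that of `t < τ` if `τ ≤ 0`. Each indicator is the limit of weights damped by
`e^{-δ|t-τ|}`. For a damped weight, the Fourier transform in `τ` turns the superposition of the
waves into the multiplier `X³ / (P - μ)`, up to a factor of modulus at most one. Here `P` is the
dispersion symbol, `X` the frequency dual to `x_i`, and `μ` is not real.

The heart of the matter is `exists_resolvent_kernel`. In the single variable `X`, the symbol `X³ /
(P - μ)` is the Fourier transform of an integrable kernel bounded by 13, uniformly in the transverse
frequency, `ε` and `μ`. Completing the square splits `P - μ` into `(X² - p²)(X² - q²)`; partial
fractions give an explicit kernel, and the only danger, `p²` close to `q²`, is controlled by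
`norm_sq_mul_cexp_sub_le`. A bounded kernel maps `L¹` to `L^∞` in `x_i`. Plancherel in the other
variables and in time, together with Minkowski's inequality, gives
`sliceNorm_duhamelWave_le_of_weight`. Nothing depends on `δ`, so Fatou's lemma removes the damping,
and the two one-sided bounds combine in `enorm_integral_duhamelPairing_le`.

It remains to pass from this dual bound to the norm of an actual function. Since `L²` with a weight
in `x_i` embeds into `L¹L²`, the functional given by the pairing has a Riesz density in a weighted
`L²` space (`exists_riesz_of_bound`). By `ae_forall_eq_integral` this density represents the
distribution at almost every time, and testing it against itself on slabs bounds its `L^∞L²` norm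
(`mixedNorm_top_le_of_inner_le`). -/

open Real in
theorem mul_exp_neg_le_one (y : ℝ) : y * Real.exp (-y) ≤ 1 := by
  have h := Real.add_one_le_exp y
  rw [Real.exp_neg, ← div_eq_mul_inv, div_le_one (Real.exp_pos y)]
  linarith

theorem norm_cexp_sub_cexp_le {z w : ℂ} {m : ℝ} (hz : z.re ≤ m) (hw : w.re ≤ m) :
    ‖Complex.exp z - Complex.exp w‖ ≤ Real.exp m * ‖z - w‖ := by
  have hs : Convex ℝ {u : ℂ | u.re ≤ m} := convex_halfSpace_re_le m
  refine hs.norm_image_sub_le_of_norm_hasDerivWithin_le (f := Complex.exp) (f' := Complex.exp)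
    (fun x _ => (Complex.hasDerivAt_exp x).hasDerivWithinAt) (fun x hx => ?_) hw hz
  rw [Complex.norm_exp]
  exact Real.exp_le_exp.2 hx

/-- A number `p` whose square is close to the nonpositive real `-b` lies in a sector about the
imaginary axis. In real terms, `Re (p²) + b ≤ |p|²/2` while `Re (p²) = |p|² - 2 (Im p)²`. -/
theorem sq_norm_le_of_norm_sq_add_le {p : ℂ} {b : ℝ} (hb : 0 ≤ b)
    (h : ‖p ^ 2 + b‖ ≤ ‖p ^ 2‖ / 2) : ‖p‖ ^ 2 ≤ 4 * p.im ^ 2 := by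
  have h1 : (p ^ 2 + b).re ≤ ‖p‖ ^ 2 / 2 := by
    have := (Complex.re_le_norm (p ^ 2 + b)).trans h
    rwa [norm_pow] at this
  have h2 : (p ^ 2 + b).re = p.re ^ 2 - p.im ^ 2 + b := by simp [pow_two]
  have h3 : ‖p‖ ^ 2 = p.re ^ 2 + p.im ^ 2 := by
    rw [← Complex.normSq_eq_norm_sq, Complex.normSq_apply]; ring
  nlinarith

/-- This is the cancellation that keeps the resolvent kernel bounded when its denominator `p² - q²`
degenerates. If `p²` and `q²` are close relative to their size, the constraint on their sum puts
both near `-b`. Both exponentials then decay at a rate comparable to `|q|`, which absorbs the factor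
`x` produced by the mean value inequality. -/
theorem norm_sq_mul_cexp_sub_le {p q : ℂ} {b : ℝ} (hb : 0 ≤ b) (hp : 0 < p.im) (hq : 0 < q.im)
    (h : p ^ 2 + q ^ 2 = -(2 * b : ℝ)) {x : ℝ} (hx : 0 ≤ x) :
    ‖p ^ 2 * Complex.exp (Complex.I * p * x) - q ^ 2 * Complex.exp (Complex.I * q * x)‖ ≤
      13 * ‖p ^ 2 - q ^ 2‖ := by
  have re_eq : ∀ r : ℂ, (Complex.I * r * x).re = -(r.im * x) := fun r => by simp
  have e1 : ∀ r : ℂ, 0 < r.im → ‖Complex.exp (Complex.I * r * x)‖ ≤ 1 := fun r hr => by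
    rw [Complex.norm_exp, re_eq, Real.exp_le_one_iff]
    have := mul_nonneg hr.le hx
    linarith
  set e := Complex.exp (Complex.I * p * x) with he
  set e' := Complex.exp (Complex.I * q * x) with he'
  have key : ‖p ^ 2 * e - q ^ 2 * e'‖ ≤ ‖p ^ 2 - q ^ 2‖ + ‖q ^ 2‖ * ‖e - e'‖ := by
    calc ‖p ^ 2 * e - q ^ 2 * e'‖ = ‖(p ^ 2 - q ^ 2) * e + q ^ 2 * (e - e')‖ := by ring_nf
      _ ≤ ‖p ^ 2 - q ^ 2‖ * ‖e‖ + ‖q ^ 2‖ * ‖e - e'‖ := by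
        refine (norm_add_le _ _).trans ?_
        rw [norm_mul, norm_mul]
      _ ≤ _ := by
        have := mul_le_mul_of_nonneg_left (e1 p hp) (norm_nonneg (p ^ 2 - q ^ 2))
        linarith
  suffices hs : ‖q ^ 2‖ * ‖e - e'‖ ≤ 12 * ‖p ^ 2 - q ^ 2‖ by linarith
  -- If `p²` and `q²` are well separated, the trivial bound 2 on the difference of the exponentials
  -- suffices.
  by_cases hc : ‖q ^ 2‖ / 2 ≤ ‖p ^ 2 - q ^ 2‖
  · have h2 : ‖e - e'‖ ≤ 2 := by
      refine (norm_sub_le _ _).trans ?_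
      have := e1 p hp
      have := e1 q hq
      linarith
    have := mul_le_mul_of_nonneg_left h2 (norm_nonneg (q ^ 2))
    have := norm_nonneg (q ^ 2)
    linarith
  push Not at hc
  have hq2 : ‖q ^ 2 + b‖ = ‖p ^ 2 - q ^ 2‖ / 2 := by
    have : q ^ 2 + b = -((p ^ 2 - q ^ 2) / 2) := by
      push_cast at h
      linear_combination h / 2
    rw [this, norm_neg, norm_div]; simp
  have hp2 : ‖p ^ 2 + b‖ = ‖p ^ 2 - q ^ 2‖ / 2 := by
    have : p ^ 2 + b = (p ^ 2 - q ^ 2) / 2 := by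
      push_cast at h
      linear_combination h / 2
    rw [this, norm_div]; simp
  have hpq : ‖q ^ 2‖ ≤ 2 * ‖p ^ 2‖ := by
    have : ‖q ^ 2‖ ≤ ‖p ^ 2‖ + ‖p ^ 2 - q ^ 2‖ := by
      have := norm_sub_le (p ^ 2) (p ^ 2 - q ^ 2)
      rwa [sub_sub_cancel] at this
    linarith
  have hq0 := norm_nonneg (q ^ 2)
  have hqi := sq_norm_le_of_norm_sq_add_le hb (p := q) (by linarith)
  have hpi := sq_norm_le_of_norm_sq_add_le hb (p := p) (by linarith)
  rw [norm_pow, norm_pow] at hpq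
  set Q := ‖q‖ with hQ
  have hQ0 : 0 ≤ Q := norm_nonneg q
  -- The sector bound gives `Im q ≥ Q/2`; for `p` one has `Q² ≤ 2|p|² ≤ 8 (Im p)²`, and `1/3 <
  -- 1/√8`.
  have hqm : Q / 3 ≤ q.im := by nlinarith
  have hpm : Q / 3 ≤ p.im := by nlinarith
  have hd : ‖e - e'‖ ≤ Real.exp (-(Q / 3 * x)) * (‖p - q‖ * x) := by
    refine (norm_cexp_sub_cexp_le (m := -(Q / 3 * x)) ?_ ?_).trans_eq ?_
    · rw [re_eq]; nlinarith
    · rw [re_eq]; nlinarith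
    · rw [show Complex.I * p * x - Complex.I * q * x = Complex.I * (p - q) * x by ring]
      simp [abs_of_nonneg hx]
  have hsum : Q / 2 ≤ ‖p + q‖ := by
    have h1 : (p + q).im ≤ ‖p + q‖ := Complex.im_le_norm _
    rw [Complex.add_im] at h1
    linarith
  have hfac : ‖p ^ 2 - q ^ 2‖ = ‖p - q‖ * ‖p + q‖ := by
    rw [← norm_mul]; congr 1; ring
  have hexp := mul_exp_neg_le_one (Q / 3 * x)
  rw [norm_pow, hfac]
  have hE : 0 < Real.exp (-(Q / 3 * x)) := Real.exp_pos _
  have hD := norm_nonneg (p - q)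
  calc Q ^ 2 * ‖e - e'‖ ≤ Q ^ 2 * (Real.exp (-(Q / 3 * x)) * (‖p - q‖ * x)) := by gcongr
    _ = 3 * Q * ‖p - q‖ * (Q / 3 * x * Real.exp (-(Q / 3 * x))) := by ring
    _ ≤ 3 * Q * ‖p - q‖ * 1 := by gcongr
    _ ≤ 12 * (‖p - q‖ * (Q / 2)) := by nlinarith [mul_nonneg hQ0 hD]
    _ ≤ _ := by gcongr

theorem exists_sq_eq_im_pos {r : ℂ} (hr : r.im ≠ 0) : ∃ p : ℂ, p ^ 2 = r ∧ 0 < p.im := by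
  obtain ⟨p, hp⟩ := IsAlgClosed.exists_pow_nat_eq r two_pos
  have him : p.im ≠ 0 := by
    rintro h
    apply hr
    rw [← hp]
    simp [pow_two, h]
  rcases him.lt_or_gt with h | h
  · exact ⟨-p, by rw [neg_sq, hp], by simpa using h⟩
  · exact ⟨p, hp, h⟩

/-- The odd extension of the exponential `e^{ipx}`, `x > 0`. -/
def oddExp (p : ℂ) (x : ℝ) : ℂ :=
  if 0 < x then Complex.exp (Complex.I * p * x) else -Complex.exp (-(Complex.I * p) * x)

theorem integrable_oddExp {p : ℂ} (hp : 0 < p.im) : Integrable (oddExp p) := by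
  rw [← integrableOn_univ, ← Set.Iic_union_Ioi (a := (0 : ℝ))]
  refine IntegrableOn.union ?_ ?_
  · refine IntegrableOn.congr_fun (f := fun x : ℝ => -Complex.exp (-(Complex.I * p) * x)) ?_
      (fun x hx => ?_) measurableSet_Iic
    · exact (integrableOn_exp_mul_complex_Iic (by simpa using hp) 0).neg
    · simp [oddExp, not_lt.2 (Set.mem_Iic.1 hx)]
  · refine IntegrableOn.congr_fun (f := fun x : ℝ => Complex.exp (Complex.I * p * x)) ?_
      (fun x hx => ?_) measurableSet_Ioi
    · exact integrableOn_exp_mul_complex_Ioi (by simpa using hp) 0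
    · simp [oddExp, Set.mem_Ioi.1 hx]

open FourierTransform in
theorem fourier_oddExp {p : ℂ} (hp : 0 < p.im) (ξ : ℝ) :
    𝓕 (oddExp p) ξ =
      -2 * Complex.I * (2 * Real.pi * ξ) / ((2 * Real.pi * ξ) ^ 2 - p ^ 2) := by
  set X : ℂ := 2 * Real.pi * ξ with hX
  have hXi : X.im = 0 := by simp [hX]
  rw [Real.fourier_real_eq_integral_exp_smul]
  set f : ℝ → ℂ := fun v => Complex.exp (↑(-2 * Real.pi * v * ξ) * Complex.I) • oddExp p v with hf
  have hint : Integrable f := by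
    refine (integrable_oddExp hp).bdd_mul (c := 1) (by fun_prop) (ae_of_all _ fun v => ?_)
    rw [Complex.norm_exp]; simp
  rw [← intervalIntegral.integral_Iic_add_Ioi (b := 0) hint.integrableOn hint.integrableOn]
  have h1 : ∫ v in Set.Iic (0 : ℝ), f v = -(1 / (-Complex.I * (p + X))) := by
    have : ∫ v in Set.Iic (0 : ℝ), f v =
        ∫ v in Set.Iic (0 : ℝ), -Complex.exp ((-Complex.I * (p + X)) * v) := by
      refine setIntegral_congr_fun measurableSet_Iic fun v hv => ?_
      simp only [hf, oddExp, not_lt.2 (Set.mem_Iic.1 hv), if_false, smul_eq_mul, mul_neg,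
        ← Complex.exp_add]
      congr 2
      push_cast [hX]; ring
    rw [this, integral_neg, integral_exp_mul_complex_Iic]
    · simp
    · simp [hXi, hp]
  have h2 : ∫ v in Set.Ioi (0 : ℝ), f v = -(1 / (Complex.I * (p - X))) := by
    have : ∫ v in Set.Ioi (0 : ℝ), f v =
        ∫ v in Set.Ioi (0 : ℝ), Complex.exp ((Complex.I * (p - X)) * v) := by
      refine setIntegral_congr_fun measurableSet_Ioi fun v hv => ?_
      simp only [hf, oddExp, Set.mem_Ioi.1 hv, if_true, smul_eq_mul, ← Complex.exp_add]
      congr 1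
      push_cast [hX]; ring
    rw [this, integral_exp_mul_complex_Ioi]
    · simp [neg_div]
    · simp [hXi, hp]
  have n1 : p + X ≠ 0 := fun h => by
    have := congrArg Complex.im h; simp [hXi] at this; exact hp.ne' this
  have n2 : p - X ≠ 0 := fun h => by
    have := congrArg Complex.im h; simp [hXi] at this; exact hp.ne' this
  have n3 : X ^ 2 - p ^ 2 ≠ 0 := by
    rw [show X ^ 2 - p ^ 2 = -((p + X) * (p - X)) by ring]
    exact neg_ne_zero.2 (mul_ne_zero n1 n2)
  have nI := Complex.I_ne_zero
  rw [h1, h2]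
  field_simp
  ring_nf
  simp only [Complex.I_sq]
  ring

open FourierTransform in
/-- The fundamental solution, along one coordinate, of the resolvent of the symbol
`(X² + a)² + ε (X² + a)` composed with three derivatives is bounded uniformly in all parameters. -/
theorem exists_resolvent_kernel {a ε : ℝ} (ha : 0 ≤ a) (hε : 0 ≤ ε) {μ : ℂ} (hμ : μ.im ≠ 0) :
    ∃ K : ℝ → ℂ, Integrable K ∧ (∀ x, ‖K x‖ ≤ 13) ∧ ∀ ξ : ℝ,
      𝓕 K ξ = (2 * Real.pi * ξ) ^ 3 /
        ((((2 * Real.pi * ξ) ^ 2 + a) ^ 2 + ε * ((2 * Real.pi * ξ) ^ 2 + a) : ℝ) - μ) := by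
  -- Completing the square: with `w² = ε²/4 + μ` the denominator is `(X² + b)² - w² = (X² - p²)(X² -
  -- q²)`, where `p² = -b + w` and `q² = -b - w`. As `μ` is not real, neither is `w`, so the roots
  -- can be taken in the upper half plane and they satisfy `p² ≠ q²`.
  set b : ℝ := a + ε / 2 with hb
  have hb0 : 0 ≤ b := by positivity
  obtain ⟨w, hw⟩ := IsAlgClosed.exists_pow_nat_eq ((ε / 2 : ℝ) ^ 2 + μ : ℂ) two_pos
  have hwim : w.im ≠ 0 := fun h => hμ <| by
    have := congrArg Complex.im hw
    rw [Complex.add_im, ← Complex.ofReal_pow, Complex.ofReal_im, zero_add] at this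
    rw [← this]; simp [pow_two, h]
  obtain ⟨p, hp2, hp⟩ := exists_sq_eq_im_pos (r := -b + w) (by simpa using hwim)
  obtain ⟨q, hq2, hq⟩ := exists_sq_eq_im_pos (r := -b - w) (by simpa using hwim)
  have hsum : p ^ 2 + q ^ 2 = -(2 * b : ℝ) := by rw [hp2, hq2]; push_cast; ring
  have hdiff : p ^ 2 - q ^ 2 ≠ 0 := by
    rw [hp2, hq2]
    intro h
    apply hwim
    have : w = 0 := by linear_combination h / 2
    simp [this]
  have ip := (integrable_oddExp hp).const_mul (p ^ 2)
  have iq := (integrable_oddExp hq).const_mul (q ^ 2)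
  -- Partial fractions: `X³ / ((X² - p²)(X² - q²))` is the difference of `p² X / (X² - p²)` and `q²
  -- X / (X² - q²)`, divided by `p² - q²`. The factor `i/2` normalizes the transform of `oddExp`.
  refine ⟨fun x => Complex.I / 2 / (p ^ 2 - q ^ 2) * (p ^ 2 * oddExp p x - q ^ 2 * oddExp q x),
    (ip.sub iq).const_mul _, fun x => ?_, fun ξ => ?_⟩
  · have : ‖p ^ 2 * oddExp p x - q ^ 2 * oddExp q x‖ ≤ 13 * ‖p ^ 2 - q ^ 2‖ := by
      by_cases hx : 0 < x
      · simpa [oddExp, hx] using norm_sq_mul_cexp_sub_le hb0 hp hq hsum hx.le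
      · have h := norm_sq_mul_cexp_sub_le hb0 hp hq hsum (neg_nonneg.2 (not_lt.1 hx))
        rw [← norm_neg] at h
        refine le_trans (le_of_eq ?_) h
        congr 1
        simp only [oddExp, hx, if_false]
        push_cast
        ring_nf
    rw [norm_mul, norm_div, norm_div]
    have h0 : 0 < ‖p ^ 2 - q ^ 2‖ := norm_pos_iff.2 hdiff
    rw [div_mul_eq_mul_div, div_le_iff₀ h0]
    simp only [Complex.norm_I, Complex.norm_ofNat]
    linarith
  · rw [show (fun x => Complex.I / 2 / (p ^ 2 - q ^ 2) *
        (p ^ 2 * oddExp p x - q ^ 2 * oddExp q x)) =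
        (fun x => (Complex.I / 2 / (p ^ 2 - q ^ 2) * p ^ 2) • oddExp p x +
          (-(Complex.I / 2 / (p ^ 2 - q ^ 2) * q ^ 2)) • oddExp q x) by
        ext x; simp only [smul_eq_mul]; ring]
    have ha : 𝓕 (fun x => (Complex.I / 2 / (p ^ 2 - q ^ 2) * p ^ 2) • oddExp p x +
          (-(Complex.I / 2 / (p ^ 2 - q ^ 2) * q ^ 2)) • oddExp q x) ξ =
        (Complex.I / 2 / (p ^ 2 - q ^ 2) * p ^ 2) * 𝓕 (oddExp p) ξ +
          (-(Complex.I / 2 / (p ^ 2 - q ^ 2) * q ^ 2)) * 𝓕 (oddExp q) ξ := by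
      have hconv : ∀ r : ℂ, 0 < r.im →
          Integrable fun v : ℝ => Real.fourierChar (-(v * ξ)) • oddExp r v := fun r hr => by
        have := (Real.fourierIntegral_convergent_iff ξ).2 (integrable_oddExp hr)
        simp_rw [mul_comm _ ξ]
        exact this
      simp only [Real.fourier_real_eq]
      rw [← integral_const_mul, ← integral_const_mul, ← integral_add]
      · congr 1; ext v
        simp only [Circle.smul_def, smul_eq_mul]; ring
      · exact (hconv p hp).const_mul _
      · exact (hconv q hq).const_mul _
    rw [ha, fourier_oddExp hp, fourier_oddExp hq]
    set X : ℂ := 2 * Real.pi * ξ with hX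
    have hXi : X.im = 0 := by simp [hX]
    have hXp : ∀ r : ℂ, 0 < r.im → X ^ 2 - r ^ 2 ≠ 0 := fun r hr h => by
      have h' : (X - r) * (X + r) = 0 := by linear_combination h
      rcases mul_eq_zero.1 h' with h | h <;>
      · have := congrArg Complex.im h; simp [hXi] at this; exact hr.ne' this
    have hden : ((((2 * Real.pi * ξ) ^ 2 + a) ^ 2 + ε * ((2 * Real.pi * ξ) ^ 2 + a) : ℝ) - μ) =
        (X ^ 2 - p ^ 2) * (X ^ 2 - q ^ 2) := by
      rw [hp2, hq2]
      push_cast [hX, hb] at hw ⊢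
      linear_combination hw
    rw [hden]
    have n1 := hXp p hp
    have n2 := hXp q hq
    field_simp
    ring_nf
    simp only [Complex.I_sq]
    ring

end

/-! ### Minkowski's inequality and Plancherel's theorem -/

noncomputable section

theorem lintegral_mul_le_sqrt_mul_sqrt {α : Type*} [MeasurableSpace α] (μ : Measure α)
    {f g : α → ℝ≥0∞} (hf : AEMeasurable f μ) (hg : AEMeasurable g μ) :
    ∫⁻ x, f x * g x ∂μ ≤
      (∫⁻ x, f x ^ 2 ∂μ) ^ (1 / 2 : ℝ) * (∫⁻ x, g x ^ 2 ∂μ) ^ (1 / 2 : ℝ) := by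
  have := ENNReal.lintegral_mul_le_Lp_mul_Lq μ Real.HolderConjugate.two_two hf hg
  simpa using this

theorem ENNReal.rpow_half_sq (a : ℝ≥0∞) : (a ^ (1 / 2 : ℝ)) ^ 2 = a := by
  rw [← ENNReal.rpow_natCast, ← ENNReal.rpow_mul]; norm_num

theorem ENNReal.sq_rpow_half (a : ℝ≥0∞) : (a ^ 2) ^ (1 / 2 : ℝ) = a := by
  rw [← ENNReal.rpow_natCast, ← ENNReal.rpow_mul]; norm_num

/-- Minkowski's integral inequality in `L²`. -/
theorem lintegral_lintegral_sq_le {α β : Type*} [MeasurableSpace α] [MeasurableSpace β]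
    {μ : Measure α} {ν : Measure β} [SFinite μ] [SFinite ν] {F : α → β → ℝ≥0∞}
    (hF : Measurable (Function.uncurry F)) :
    ∫⁻ z, (∫⁻ r, F r z ∂μ) ^ 2 ∂ν ≤ (∫⁻ r, (∫⁻ z, F r z ^ 2 ∂ν) ^ (1 / 2 : ℝ) ∂μ) ^ 2 := by
  have hr : ∀ r, Measurable (F r) := fun r => hF.comp measurable_prodMk_left
  have hz : ∀ z, Measurable fun r => F r z := fun z => hF.comp measurable_prodMk_right
  have hN : Measurable fun r => (∫⁻ z, F r z ^ 2 ∂ν) ^ (1 / 2 : ℝ) :=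
    ((hF.pow_const 2).lintegral_prod_right').pow_const _
  -- The square is written as a double integral over `r` and `r'`, and Cauchy–Schwarz is applied in
  -- `z` for each pair.
  calc ∫⁻ z, (∫⁻ r, F r z ∂μ) ^ 2 ∂ν = ∫⁻ z, ∫⁻ r, ∫⁻ r', F r z * F r' z ∂μ ∂μ ∂ν := by
        refine lintegral_congr fun z => ?_
        rw [pow_two, ← lintegral_mul_const _ (hz z)]
        exact lintegral_congr fun r => (lintegral_const_mul _ (hz z)).symm
    _ = ∫⁻ r, ∫⁻ z, ∫⁻ r', F r z * F r' z ∂μ ∂ν ∂μ := by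
        refine lintegral_lintegral_swap (Measurable.aemeasurable ?_)
        refine Measurable.lintegral_prod_right' (f := fun p : (β × α) × α =>
          F p.1.2 p.1.1 * F p.2 p.1.1) ?_
        exact (hF.comp (by fun_prop : Measurable fun p : (β × α) × α => (p.1.2, p.1.1))).mul
          (hF.comp (by fun_prop : Measurable fun p : (β × α) × α => (p.2, p.1.1)))
    _ = ∫⁻ r, ∫⁻ r', ∫⁻ z, F r z * F r' z ∂ν ∂μ ∂μ := by
        refine lintegral_congr fun r => lintegral_lintegral_swap (Measurable.aemeasurable ?_)
        exact ((hr r).comp measurable_fst).mul (hF.comp measurable_swap)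
    _ ≤ ∫⁻ r, ∫⁻ r', (∫⁻ z, F r z ^ 2 ∂ν) ^ (1 / 2 : ℝ) *
          (∫⁻ z, F r' z ^ 2 ∂ν) ^ (1 / 2 : ℝ) ∂μ ∂μ := by
        gcongr with r r'
        exact lintegral_mul_le_sqrt_mul_sqrt ν (hr r).aemeasurable (hr r').aemeasurable
    _ = _ := by
        rw [pow_two, ← lintegral_mul_const _ hN]
        exact lintegral_congr fun r => lintegral_const_mul _ hN

section Plancherel

variable {V : Type*} [NormedAddCommGroup V] [InnerProductSpace ℝ V] [FiniteDimensional ℝ V]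
  [MeasurableSpace V] [BorelSpace V]

open FourierTransform

theorem continuous_fourier_of_integrable {f : V → ℂ} (hf : Integrable f) : Continuous (𝓕 f) :=
  VectorFourier.fourierIntegral_continuous Real.continuous_fourierChar
    (innerSL ℝ).continuous₂ hf

theorem norm_fourier_le_integral (f : V → ℂ) (w : V) : ‖𝓕 f w‖ ≤ ∫ v, ‖f v‖ := by
  rw [Real.fourier_eq]
  refine (norm_integral_le_integral_norm _).trans_eq ?_
  simp [Circle.norm_smul]

/-- The `L²` Fourier transform of a function that is also integrable is given by the integral. -/
theorem Lp_fourier_toLp_ae_eq {f : V → ℂ} (h1 : Integrable f) (h2 : MemLp f 2) :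
    (𝓕 (h2.toLp f) : Lp (α := V) ℂ 2 volume) =ᵐ[volume] 𝓕 f := by
  refine ae_eq_of_integral_contDiff_smul_eq
    ((Lp.memLp _).locallyIntegrable (by norm_num))
    (continuous_fourier_of_integrable h1).locallyIntegrable fun g gs gc => ?_
  have hg₁ : HasCompactSupport (Complex.ofRealCLM ∘ g) := gc.comp_left rfl
  have hg₂ : ContDiff ℝ ∞ (Complex.ofRealCLM ∘ g) := by fun_prop
  set u : 𝓢(V, ℂ) := hg₁.toSchwartzMap hg₂ with hu
  have hug : ∀ x, u x = (g x : ℂ) := fun x => by simp [hu]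
  -- Both transforms obey the same transposition rule against a test function: the `L²` one by its
  -- definition on tempered distributions, the integral one by Fubini.
  have key := congrArg (fun T : 𝓢'(V, ℂ) => T u)
    (Lp.fourier_toTemperedDistribution_eq (h2.toLp f))
  simp only [TemperedDistribution.fourier_apply, Lp.toTemperedDistribution_apply] at key
  calc ∫ x, g x • (𝓕 (h2.toLp f) : Lp (α := V) ℂ 2 volume) x
      = ∫ x, u x • (𝓕 (h2.toLp f) : Lp (α := V) ℂ 2 volume) x := by simp [hug]
    _ = ∫ x, (𝓕 u) x • (h2.toLp f) x := key.symm
    _ = ∫ x, (𝓕 u) x • f x := by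
        refine integral_congr_ae ?_
        filter_upwards [h2.coeFn_toLp] with x hx
        rw [hx]
    _ = ∫ x, u x • 𝓕 f x := by
        rw [SchwartzMap.fourier_coe]
        have := VectorFourier.integral_fourierIntegral_smul_eq_flip (L := innerₗ V)
          Real.continuous_fourierChar continuous_inner (u.integrable (μ := volume)) h1
        rw [flip_innerₗ] at this
        exact this
    _ = ∫ x, g x • 𝓕 f x := by simp [hug]

/-- Plancherel's theorem for functions in `L¹ ∩ L²`. -/
theorem lintegral_enorm_fourier_sq {f : V → ℂ} (h1 : Integrable f) (h2 : MemLp f 2) :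
    ∫⁻ w, ‖𝓕 f w‖ₑ ^ 2 = ∫⁻ v, ‖f v‖ₑ ^ 2 := by
  have hn : ‖(𝓕 (h2.toLp f) : Lp (α := V) ℂ 2 volume)‖ₑ = ‖h2.toLp f‖ₑ := by
    rw [← ofReal_norm, ← ofReal_norm, Lp.norm_fourier_eq]
  rw [Lp.enorm_def, Lp.enorm_def, eLpNorm_congr_ae (Lp_fourier_toLp_ae_eq h1 h2),
    eLpNorm_congr_ae h2.coeFn_toLp, eLpNorm_eq_lintegral_rpow_enorm_toReal (by simp) (by simp),
    eLpNorm_eq_lintegral_rpow_enorm_toReal (by simp) (by simp)] at hn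
  have := congrArg (· ^ 2) hn
  simpa [ENNReal.rpow_half_sq, ← one_div] using this

/-- The Fourier transform commutes with superposition. -/
theorem integral_fourier_swap {α : Type*} [MeasurableSpace α] {μ : Measure α} [SFinite μ]
    {Θ : α → V → ℂ} (h : Integrable (Function.uncurry Θ) (μ.prod volume)) (w : V) :
    ∫ t, 𝓕 (Θ t) w ∂μ = 𝓕 (fun v => ∫ t, Θ t v ∂μ) w := by
  simp only [Real.fourier_eq]
  rw [integral_integral_swap]
  · refine integral_congr_ae (ae_of_all _ fun v => ?_)
    simp only [Circle.smul_def]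
    rw [integral_smul]
  · refine (integrable_norm_iff ?_).1 ?_
    · refine AEStronglyMeasurable.smul ?_ h.1
      have hc : Continuous fun v : V => (Real.fourierChar (-inner ℝ v w) : ℂ) :=
        continuous_subtype_val.comp (Real.continuous_fourierChar.comp (by fun_prop))
      exact (hc.stronglyMeasurable.comp_measurable measurable_snd).aestronglyMeasurable
    · simpa [Function.uncurry_def, Circle.norm_smul] using h.norm

end Plancherel
end

/-! ### Rapidly decaying frequency profiles and their evolution -/

noncomputable section

section Decay

/-- The weight `(1 + ‖v‖)^{-k}`. -/
def decay {V : Type*} [NormedAddCommGroup V] (k : ℕ) (v : V) : ℝ := ((1 + ‖v‖) ^ k)⁻¹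

variable {V : Type*} [NormedAddCommGroup V]

theorem decay_nonneg (k : ℕ) (v : V) : 0 ≤ decay k v := by unfold decay; positivity

theorem decay_le_one (k : ℕ) (v : V) : decay k v ≤ 1 :=
  inv_le_one_of_one_le₀ (one_le_pow₀ (by linarith [norm_nonneg v]))

theorem continuous_decay (k : ℕ) : Continuous (decay k : V → ℝ) := by
  unfold decay
  exact Continuous.inv₀ (by fun_prop) fun v => by positivity

theorem integrable_decay [NormedSpace ℝ V] [FiniteDimensional ℝ V] [MeasurableSpace V]
    [BorelSpace V] (μ : Measure V) [μ.IsAddHaarMeasure] {k : ℕ} (hk : Module.finrank ℝ V < k) :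
    Integrable (decay k : V → ℝ) μ := by
  have := integrable_one_add_norm (E := V) (μ := μ) (r := k) (by exact_mod_cast hk)
  refine this.congr (ae_of_all _ fun v => ?_)
  simp only [decay]
  rw [Real.rpow_neg (by positivity), Real.rpow_natCast]

theorem abs_pow_mul_decay_add_le (j k : ℕ) (v : V) : ‖v‖ ^ j * decay (j + k) v ≤ decay k v := by
  unfold decay
  rw [pow_add, mul_inv, ← mul_assoc]
  refine mul_le_of_le_one_left (by positivity) ?_
  rw [← div_eq_mul_inv, div_le_one (by positivity)]
  gcongr
  linarith

end Decay

open FourierTransform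

theorem measurable_fourier {α V : Type*} [MeasurableSpace α] [NormedAddCommGroup V]
    [InnerProductSpace ℝ V] [FiniteDimensional ℝ V] [MeasurableSpace V] [BorelSpace V]
    {F : α → V → ℂ} (hF : Measurable (Function.uncurry F)) :
    Measurable fun p : α × V => 𝓕 (F p.1) p.2 := by
  simp only [Real.fourier_eq]
  refine StronglyMeasurable.measurable ?_
  refine StronglyMeasurable.integral_prod_right' (ν := volume)
    (f := fun z : (α × V) × V => Real.fourierChar (-inner ℝ z.2 z.1.2) • F z.1.1 z.2) ?_
  refine Measurable.stronglyMeasurable ?_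
  have hc : Continuous fun z : V × V => (Real.fourierChar (-inner ℝ z.2 z.1) : ℂ) :=
    continuous_subtype_val.comp (Real.continuous_fourierChar.comp (by fun_prop))
  simp only [Circle.smul_def, smul_eq_mul]
  exact (hc.measurable.comp (by fun_prop : Measurable fun z : (α × V) × V => (z.1.2, z.2))).mul
    (hF.comp (by fun_prop : Measurable fun z : (α × V) × V => (z.1.1, z.2)))

theorem fourier_const_mul {V : Type*} [NormedAddCommGroup V]
    [InnerProductSpace ℝ V] [FiniteDimensional ℝ V] [MeasurableSpace V] [BorelSpace V] (c : ℂ)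
    (f : V → ℂ) (w : V) : 𝓕 (fun v => c * f v) w = c * 𝓕 f w := by
  simp only [Real.fourier_eq, Circle.smul_def, smul_eq_mul]
  rw [← integral_const_mul]
  congr 1; ext v; ring

section Symbol

variable {E : Type*} [NormedAddCommGroup E]

/-- The symbol `|ξ|⁴ + ε |ξ|²` at the frequency `ξ = 2π(ρ, η)`. -/
def phase (ε ρ : ℝ) (η : E) : ℝ :=
  ((2 * Real.pi * ρ) ^ 2 + (2 * Real.pi * ‖η‖) ^ 2) ^ 2 +
    ε * ((2 * Real.pi * ρ) ^ 2 + (2 * Real.pi * ‖η‖) ^ 2)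

/-- The multiplier `(2πρ)³ e^{iqP(ρ, η)}` applied to the frequency profile `ψ`. -/
def evolved (ε q : ℝ) (ψ : ℝ → E → ℂ) (ρ : ℝ) (η : E) : ℂ :=
  (2 * Real.pi * ρ) ^ 3 * Complex.exp (Complex.I * (q * phase ε ρ η : ℝ)) * ψ ρ η

theorem norm_evolved (ε q : ℝ) (ψ : ℝ → E → ℂ) (ρ : ℝ) (η : E) :
    ‖evolved ε q ψ ρ η‖ = (2 * Real.pi * |ρ|) ^ 3 * ‖ψ ρ η‖ := by
  rw [evolved, norm_mul, norm_mul, mul_comm Complex.I, Complex.norm_exp_ofReal_mul_I, mul_one]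
  simp [abs_of_pos Real.pi_pos]

end Symbol

variable {E : Type*} [NormedAddCommGroup E] [InnerProductSpace ℝ E] [FiniteDimensional ℝ E]
  [MeasurableSpace E] [BorelSpace E]

/-- Space-time frequency profiles with enough decay for all the integrals below to converge. -/
structure RapidDecay (Ψ : ℝ → ℝ → E → ℂ) : Prop where
  measurable : Measurable fun p : ℝ × ℝ × E => Ψ p.1 p.2.1 p.2.2
  bound : ∃ C : ℝ, 0 ≤ C ∧ ∀ t ρ η, ‖Ψ t ρ η‖ ≤
    C * (decay 3 t * decay 5 ρ * decay (Module.finrank ℝ E + 1) η)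

namespace RapidDecay

variable {Ψ : ℝ → ℝ → E → ℂ}

/-- The factor `ρ³` uses up three of the five powers of decay, and the remaining two are integrable
on the line. The oscillating factor has modulus one, hence the uniformity in `ε` and `q`. -/
theorem bound_evolved (h : RapidDecay Ψ) : ∃ C : ℝ, 0 ≤ C ∧ ∀ ε q t ρ η,
    ‖evolved ε q (Ψ t) ρ η‖ ≤
      C * (decay 3 t * decay 2 ρ * decay (Module.finrank ℝ E + 1) η) := by
  obtain ⟨C, hC, hb⟩ := h.bound
  refine ⟨(2 * Real.pi) ^ 3 * C, by positivity, fun ε q t ρ η => ?_⟩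
  rw [norm_evolved]
  have h1 := abs_pow_mul_decay_add_le 3 2 ρ
  rw [Real.norm_eq_abs] at h1
  have := decay_nonneg 3 t
  have := decay_nonneg (Module.finrank ℝ E + 1) η
  calc (2 * Real.pi * |ρ|) ^ 3 * ‖Ψ t ρ η‖
      ≤ (2 * Real.pi * |ρ|) ^ 3 *
        (C * (decay 3 t * decay 5 ρ * decay (Module.finrank ℝ E + 1) η)) := by
        gcongr; exact hb t ρ η
    _ = (2 * Real.pi) ^ 3 * C * (decay 3 t * (|ρ| ^ 3 * decay 5 ρ) *
          decay (Module.finrank ℝ E + 1) η) := by ring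
    _ ≤ _ := by gcongr

theorem measurable_comp (h : RapidDecay Ψ) {α : Type*} [MeasurableSpace α]
    {t ρ : α → ℝ} {η : α → E} (ht : Measurable t) (hρ : Measurable ρ) (hη : Measurable η) :
    Measurable fun a => Ψ (t a) (ρ a) (η a) :=
  h.measurable.comp (ht.prodMk (hρ.prodMk hη))

theorem measurable_evolved (h : RapidDecay Ψ) (ε : ℝ) {α : Type*} [MeasurableSpace α]
    {q t ρ : α → ℝ} {η : α → E} (hq : Measurable q) (ht : Measurable t) (hρ : Measurable ρ)
    (hη : Measurable η) : Measurable fun a => evolved ε (q a) (Ψ (t a)) (ρ a) (η a) := by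
  unfold evolved
  have hp : Measurable fun a => phase ε (ρ a) (η a) := by
    have := hη.norm
    unfold phase
    fun_prop
  have h1 : Measurable fun a => ((2 * Real.pi * ρ a : ℂ)) ^ 3 := by fun_prop
  have h2 : Measurable fun a => Complex.exp (Complex.I * (q a * phase ε (ρ a) (η a) : ℝ)) := by
    have : Measurable fun a => q a * phase ε (ρ a) (η a) := hq.mul hp
    fun_prop
  exact (h1.mul h2).mul (h.measurable_comp ht hρ hη)

end RapidDecay

/-- The partial inverse transform, in the distinguished variable, of the evolved profile. -/
def slice (ε q s : ℝ) (ψ : ℝ → E → ℂ) (η : E) : ℂ := 𝓕 (fun ρ => evolved ε q ψ ρ η) s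

namespace RapidDecay

variable {Ψ : ℝ → ℝ → E → ℂ}

theorem measurable_slice (h : RapidDecay Ψ) (ε : ℝ) {α : Type*} [MeasurableSpace α]
    {q s t : α → ℝ} {η : α → E} (hq : Measurable q) (hs : Measurable s) (ht : Measurable t)
    (hη : Measurable η) : Measurable fun a => slice ε (q a) (s a) (Ψ (t a)) (η a) := by
  have h1 : Measurable (Function.uncurry fun (a : α) (ρ : ℝ) =>
      evolved ε (q a) (Ψ (t a)) ρ (η a)) :=
    h.measurable_evolved ε (hq.comp measurable_fst) (ht.comp measurable_fst) measurable_snd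
      (hη.comp measurable_fst)
  have h2 := (measurable_fourier h1).comp (measurable_id.prodMk hs)
  exact h2

theorem bound_slice (h : RapidDecay Ψ) : ∃ C : ℝ, 0 ≤ C ∧ ∀ ε q s t η,
    ‖slice ε q s (Ψ t) η‖ ≤ C * (decay 3 t * decay (Module.finrank ℝ E + 1) η) := by
  obtain ⟨C, hC, hb⟩ := h.bound_evolved
  refine ⟨C * ∫ ρ : ℝ, decay 2 ρ, mul_nonneg hC (integral_nonneg fun ρ => decay_nonneg _ _),
    fun ε q s t η => (norm_fourier_le_integral _ _).trans ?_⟩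
  have hi : Integrable (decay 2 : ℝ → ℝ) := integrable_decay volume (by simp)
  calc ∫ ρ, ‖evolved ε q (Ψ t) ρ η‖
      ≤ ∫ ρ, (C * (decay 3 t * decay (Module.finrank ℝ E + 1) η)) * decay 2 ρ := by
        refine integral_mono_of_nonneg (ae_of_all _ fun _ => norm_nonneg _) (hi.const_mul _)
          (ae_of_all _ fun ρ => (hb ε q t ρ η).trans_eq ?_)
        ring
    _ = _ := by rw [integral_const_mul]; ring

theorem _root_.memLp_two_of_integrable_of_bound {α : Type*} [MeasurableSpace α] {μ : Measure α}
    {f : α → ℂ} (hf : Integrable f μ) {C : ℝ} (hb : ∀ x, ‖f x‖ ≤ C) : MemLp f 2 μ := by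
  rw [memLp_two_iff_integrable_sq_norm hf.1]
  refine (hf.norm.const_mul C).mono' (hf.1.norm.pow 2) (ae_of_all _ fun x => ?_)
  rw [Real.norm_eq_abs, abs_of_nonneg (by positivity), pow_two]
  exact mul_le_mul_of_nonneg_right (hb x) (norm_nonneg _)

/-- Plancherel in the transversal variables for a frequency profile `f` of that decay. -/
theorem plancherel_of_bound {f : E → ℂ} (hf : Measurable f) {C : ℝ}
    (hb : ∀ η, ‖f η‖ ≤ C * decay (Module.finrank ℝ E + 1) η) :
    Integrable f ∧ ∫⁻ y, ‖𝓕 f y‖ₑ ^ 2 = ∫⁻ η, ‖f η‖ₑ ^ 2 := by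
  have hi : Integrable f :=
    ((integrable_decay volume (Nat.lt_succ_self _)).const_mul C).mono' hf.aestronglyMeasurable
      (ae_of_all _ hb)
  refine ⟨hi, lintegral_enorm_fourier_sq hi (memLp_two_of_integrable_of_bound hi
    (C := |C|) fun η => (hb η).trans ?_)⟩
  exact (mul_le_mul_of_nonneg_right (le_abs_self C) (decay_nonneg _ _)).trans
    (mul_le_of_le_one_right (abs_nonneg C) (decay_le_one _ _))

end RapidDecay
end

/-! ### Superposition of waves in time -/

noncomputable section
open FourierTransform

variable {E : Type*} [NormedAddCommGroup E] [InnerProductSpace ℝ E] [FiniteDimensional ℝ E]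
  [MeasurableSpace E] [BorelSpace E]

/-- The superposition in time, with weight `θ(t - τ)`, of the evolved partial profiles. -/
def duhamelSlice (θ : ℝ → ℝ) (ε : ℝ) (Ψ : ℝ → ℝ → E → ℂ) (τ s : ℝ) (η : E) : ℂ :=
  ∫ t, (θ (t - τ) : ℂ) * slice ε (t - τ) s (Ψ t) η

/-- The superposition in time, with weight `θ(t - τ)`, of the evolved waves. -/
def duhamelWave (θ : ℝ → ℝ) (ε : ℝ) (Ψ : ℝ → ℝ → E → ℂ) (τ s : ℝ) (y : E) : ℂ :=
  ∫ t, (θ (t - τ) : ℂ) * 𝓕 (slice ε (t - τ) s (Ψ t)) y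

/-- The wave with frequency profile `Ψ`. -/
def wave (Ψ : ℝ → ℝ → E → ℂ) (t r : ℝ) (y : E) : ℂ := 𝓕 (fun η => 𝓕 (fun ρ => Ψ t ρ η) r) y

namespace RapidDecay

variable {Ψ : ℝ → ℝ → E → ℂ} {θ : ℝ → ℝ}

theorem integrable_weight_slice (h : RapidDecay Ψ) (hθ : Measurable θ) (h1 : ∀ q, |θ q| ≤ 1)
    (ε τ s : ℝ) : Integrable (Function.uncurry fun (t : ℝ) (η : E) =>
      (θ (t - τ) : ℂ) * slice ε (t - τ) s (Ψ t) η) (volume.prod volume) := by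
  obtain ⟨C, hC, hb⟩ := h.bound_slice
  have hi : Integrable (fun p : ℝ × E =>
      decay 3 p.1 * decay (Module.finrank ℝ E + 1) p.2) (volume.prod volume) :=
    (integrable_decay volume (by simp)).mul_prod (integrable_decay volume (Nat.lt_succ_self _))
  refine (hi.const_mul C).mono' (Measurable.aestronglyMeasurable ?_) (ae_of_all _ fun p => ?_)
  · exact (Complex.measurable_ofReal.comp (hθ.comp (measurable_fst.sub_const τ))).mul
      (h.measurable_slice ε (measurable_fst.sub_const τ) measurable_const measurable_fst
        measurable_snd)
  · simp only [Function.uncurry]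
    rw [norm_mul, Complex.norm_real, Real.norm_eq_abs]
    exact (mul_le_of_le_one_left (norm_nonneg _) (h1 _)).trans (hb _ _ _ _ _)

/-- The time integral and the transverse Fourier transform commute. Plancherel therefore lets the
estimate be made at each fixed transverse frequency, where the problem has one space dimension. -/
theorem duhamelWave_eq (h : RapidDecay Ψ) (hθ : Measurable θ) (h1 : ∀ q, |θ q| ≤ 1)
    (ε τ s : ℝ) : duhamelWave θ ε Ψ τ s = 𝓕 (duhamelSlice θ ε Ψ τ s) := by
  ext y
  unfold duhamelWave duhamelSlice
  rw [← integral_fourier_swap (h.integrable_weight_slice hθ h1 ε τ s)]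
  simp_rw [fourier_const_mul]

theorem measurable_duhamelSlice (h : RapidDecay Ψ) (hθ : Measurable θ) (ε : ℝ) {α : Type*}
    [MeasurableSpace α] {τ s : α → ℝ} {η : α → E} (hτ : Measurable τ) (hs : Measurable s)
    (hη : Measurable η) : Measurable fun a => duhamelSlice θ ε Ψ (τ a) (s a) (η a) := by
  unfold duhamelSlice
  refine StronglyMeasurable.measurable (StronglyMeasurable.integral_prod_right' (ν := volume)
    (f := fun z : α × ℝ => (θ (z.2 - τ z.1) : ℂ) * slice ε (z.2 - τ z.1) (s z.1) (Ψ z.2) (η z.1))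
    (Measurable.stronglyMeasurable ?_))
  have hτ' : Measurable fun z : α × ℝ => z.2 - τ z.1 := measurable_snd.sub (hτ.comp measurable_fst)
  exact (Complex.measurable_ofReal.comp (hθ.comp hτ')).mul
    (h.measurable_slice ε hτ' (hs.comp measurable_fst) measurable_snd (hη.comp measurable_fst))

theorem bound_duhamelSlice (h : RapidDecay Ψ) (h1 : ∀ q, |θ q| ≤ 1) :
    ∃ C : ℝ, 0 ≤ C ∧ ∀ ε τ s η,
      ‖duhamelSlice θ ε Ψ τ s η‖ ≤ C * decay (Module.finrank ℝ E + 1) η := by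
  obtain ⟨C, hC, hb⟩ := h.bound_slice
  refine ⟨C * ∫ t : ℝ, decay 3 t, mul_nonneg hC (integral_nonneg fun _ => decay_nonneg _ _),
    fun ε τ s η => (norm_integral_le_integral_norm _).trans ?_⟩
  have hi : Integrable (decay 3 : ℝ → ℝ) := integrable_decay volume (by simp)
  calc ∫ t, ‖(θ (t - τ) : ℂ) * slice ε (t - τ) s (Ψ t) η‖
      ≤ ∫ t, (C * decay (Module.finrank ℝ E + 1) η) * decay 3 t := by
        refine integral_mono_of_nonneg (ae_of_all _ fun _ => norm_nonneg _) (hi.const_mul _)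
          (ae_of_all _ fun t => ?_)
        simp only [norm_mul, Complex.norm_real, Real.norm_eq_abs]
        refine ((mul_le_of_le_one_left (norm_nonneg _) (h1 _)).trans (hb _ _ _ _ _)).trans_eq ?_
        ring
    _ = _ := by rw [integral_const_mul]; ring

theorem lintegral_duhamelWave_sq (h : RapidDecay Ψ) (hθ : Measurable θ) (h1 : ∀ q, |θ q| ≤ 1)
    (ε τ s : ℝ) :
    ∫⁻ y, ‖duhamelWave θ ε Ψ τ s y‖ₑ ^ 2 = ∫⁻ η, ‖duhamelSlice θ ε Ψ τ s η‖ₑ ^ 2 := by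
  obtain ⟨C, hC, hb⟩ := h.bound_duhamelSlice h1
  rw [h.duhamelWave_eq hθ h1]
  exact (plancherel_of_bound (h.measurable_duhamelSlice hθ ε measurable_const measurable_const
    measurable_id) (hb ε τ s)).2

/-- The integrand of `duhamelSlice` before the frequency and time integrations. -/
def integrand (θ : ℝ → ℝ) (ε s : ℝ) (Ψ : ℝ → ℝ → E → ℂ) (η : E) (z : ℝ × ℝ) (τ : ℝ) : ℂ :=
  (θ (z.1 - τ) : ℂ) * (Real.fourierChar (-(z.2 * s)) * evolved ε (z.1 - τ) (Ψ z.1) z.2 η)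

theorem measurable_integrand (h : RapidDecay Ψ) (hθ : Measurable θ) (ε s : ℝ) (η : E) :
    Measurable (Function.uncurry (integrand θ ε s Ψ η)) := by
  unfold integrand
  have hq : Measurable fun a : (ℝ × ℝ) × ℝ => a.1.1 - a.2 := by fun_prop
  have hc : Continuous fun ρ : ℝ => (Real.fourierChar (-(ρ * s)) : ℂ) :=
    continuous_subtype_val.comp (Real.continuous_fourierChar.comp (by fun_prop))
  have hc' : Measurable fun a : (ℝ × ℝ) × ℝ => (Real.fourierChar (-(a.1.2 * s)) : ℂ) :=
    hc.measurable.comp (measurable_snd.comp measurable_fst)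
  exact (Complex.measurable_ofReal.comp (hθ.comp hq)).mul
    (hc'.mul (h.measurable_evolved ε hq (measurable_fst.comp measurable_fst)
      (measurable_snd.comp measurable_fst) measurable_const))

theorem integrable_integrand (h : RapidDecay Ψ) (hθ : Measurable θ) (h1 : ∀ q, |θ q| ≤ 1)
    (ε s : ℝ) (η : E) (τ : ℝ) : Integrable fun z => integrand θ ε s Ψ η z τ := by
  obtain ⟨C, hC, hb⟩ := h.bound_evolved
  have hi : Integrable (fun p : ℝ × ℝ => decay 3 p.1 * decay 2 p.2) (volume.prod volume) :=
    (integrable_decay volume (by simp)).mul_prod (integrable_decay volume (by simp))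
  refine (hi.const_mul (C * decay (Module.finrank ℝ E + 1) η)).mono'
    ((h.measurable_integrand hθ ε s η).comp measurable_prodMk_right).aestronglyMeasurable
    (ae_of_all _ fun z => ?_)
  simp only [integrand, norm_mul, Complex.norm_real, Real.norm_eq_abs, Circle.norm_coe, one_mul]
  refine ((mul_le_of_le_one_left (norm_nonneg _) (h1 _)).trans (hb _ _ _ _ _)).trans_eq ?_
  ring

/-- Joint integrability with `τ` included rests on the integrability of the weight, whereas at fixed
`τ` boundedness is enough. This is why the indicators are damped before the Fourier transform in `τ`
is taken. -/
theorem integrable_integrand_prod (h : RapidDecay Ψ) (hθ : Measurable θ) (hi : Integrable θ)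
    (ε s : ℝ) (η : E) :
    Integrable (Function.uncurry (integrand θ ε s Ψ η)) (volume.prod volume) := by
  obtain ⟨C, hC, hb⟩ := h.bound_evolved
  have hi' : Integrable (fun p : ℝ × ℝ => decay 3 p.1 * decay 2 p.2) (volume.prod volume) :=
    (integrable_decay volume (by simp)).mul_prod (integrable_decay volume (by simp))
  have hshift : Integrable (fun p : (ℝ × ℝ) × ℝ =>
      (decay 3 p.1.1 * decay 2 p.1.2) * |θ (p.1.1 - p.2)|) (volume.prod volume) := by
    rw [integrable_prod_iff]
    · refine ⟨ae_of_all _ fun z =>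
        ((hi.comp_sub_left z.1).abs).const_mul (decay 3 z.1 * decay 2 z.2), ?_⟩
      · have : ∀ z : ℝ × ℝ, ∫ τ, ‖decay 3 z.1 * decay 2 z.2 * |θ (z.1 - τ)|‖ =
            (decay 3 z.1 * decay 2 z.2) * ∫ q, |θ q| := fun z => by
          have hn : 0 ≤ decay 3 z.1 * decay 2 z.2 :=
            mul_nonneg (decay_nonneg _ _) (decay_nonneg _ _)
          simp_rw [norm_mul, Real.norm_eq_abs, abs_abs]
          rw [integral_const_mul, ← abs_mul, abs_of_nonneg hn,
            integral_sub_left_eq_self (fun q => |θ q|)]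
        simp_rw [this]
        exact hi'.mul_const _
    · refine Measurable.aestronglyMeasurable ?_
      have := (continuous_decay (V := ℝ) 3).measurable
      have := (continuous_decay (V := ℝ) 2).measurable
      have h4 : Measurable fun p : (ℝ × ℝ) × ℝ => θ (p.1.1 - p.2) :=
        hθ.comp (by fun_prop)
      have h5 := h4.norm
      simp only [Real.norm_eq_abs] at h5
      fun_prop
  refine (hshift.const_mul (C * decay (Module.finrank ℝ E + 1) η)).mono'
    (h.measurable_integrand hθ ε s η).aestronglyMeasurable (ae_of_all _ fun p => ?_)
  simp only [Function.uncurry, integrand, norm_mul, Complex.norm_real, Real.norm_eq_abs,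
    Circle.norm_coe, one_mul]
  refine (mul_le_mul_of_nonneg_left (hb _ _ _ _ _) (abs_nonneg _)).trans_eq ?_
  ring

theorem duhamelSlice_eq_integral (h : RapidDecay Ψ) (hθ : Measurable θ) (h1 : ∀ q, |θ q| ≤ 1)
    (ε s : ℝ) (η : E) (τ : ℝ) :
    duhamelSlice θ ε Ψ τ s η = ∫ z, integrand θ ε s Ψ η z τ := by
  rw [Measure.volume_eq_prod, integral_prod _ (h.integrable_integrand hθ h1 ε s η τ)]
  simp only [duhamelSlice, integrand, slice, Real.fourier_real_eq, Circle.smul_def, smul_eq_mul]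
  simp_rw [integral_const_mul]

end RapidDecay
end

/-! ### Fourier transform in time: from the Duhamel integral to the resolvent -/

noncomputable section
open FourierTransform

variable {E : Type*} [NormedAddCommGroup E] [InnerProductSpace ℝ E] [FiniteDimensional ℝ E]
  [MeasurableSpace E] [BorelSpace E]

theorem fourierChar_coe_add (x y : ℝ) :
    (Real.fourierChar (x + y) : ℂ) = Real.fourierChar x * Real.fourierChar y := by
  rw [AddChar.map_add_eq_mul, Circle.coe_mul]

theorem continuous_fourierChar_coe : Continuous fun x : ℝ => (Real.fourierChar x : ℂ) :=
  continuous_subtype_val.comp Real.continuous_fourierChar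

theorem fourierChar_mul_norm (x y : ℝ) :
    ‖(Real.fourierChar x : ℂ) * Real.fourierChar y‖ = 1 := by
  rw [norm_mul, Circle.norm_coe, Circle.norm_coe, one_mul]

/-- A time weight whose transform is, at each frequency, a multiple of a resolvent. -/
structure IsResolventWeight (θ : ℝ → ℝ) : Prop where
  measurable : Measurable θ
  abs_le : ∀ q, |θ q| ≤ 1
  integrable : Integrable θ
  transform : ∀ l : ℝ, ∃ μ : ℂ, μ.im ≠ 0 ∧ ∃ c : ℂ, ‖c‖ ≤ 1 ∧ ∀ P : ℝ,
    ∫ q, (θ q : ℂ) * Complex.exp (Complex.I * ((P + 2 * Real.pi * l) * q : ℝ)) = c / (P - μ)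

/-- The transform of the frequency profile in time and in the distinguished variable. -/
def timeSlice (Ψ : ℝ → ℝ → E → ℂ) (l r : ℝ) (η : E) : ℂ :=
  𝓕 (fun t => 𝓕 (fun ρ => Ψ t ρ η) r) l

namespace RapidDecay

variable {Ψ : ℝ → ℝ → E → ℂ} {θ : ℝ → ℝ}

theorem bound_coarse (h : RapidDecay Ψ) : ∃ C : ℝ, 0 ≤ C ∧ ∀ t ρ η, ‖Ψ t ρ η‖ ≤
    C * (decay 3 t * decay 2 ρ * decay (Module.finrank ℝ E + 1) η) := by
  obtain ⟨C, hC, hb⟩ := h.bound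
  refine ⟨C, hC, fun t ρ η => (hb t ρ η).trans ?_⟩
  have h1 : decay 5 ρ ≤ decay 2 ρ := by
    unfold decay
    gcongr
    · linarith [norm_nonneg ρ]
    · norm_num
  have := decay_nonneg 3 t
  have := decay_nonneg (Module.finrank ℝ E + 1) η
  gcongr

/-- Substituting `q = t - τ` separates the character `e^{-2πi t l}` from the integral of the weight
against `e^{i(P + 2πl)q}`, which is a multiple of the resolvent by hypothesis. -/
theorem fourier_integrand (ε s : ℝ) (η : E) (z : ℝ × ℝ) {l : ℝ}
    {μ c : ℂ}
    (hμ : ∀ P : ℝ, ∫ q, (θ q : ℂ) * Complex.exp (Complex.I * ((P + 2 * Real.pi * l) * q : ℝ)) =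
      c / (P - μ)) :
    𝓕 (integrand θ ε s Ψ η z) l = c * ((2 * Real.pi * z.2) ^ 3 / (phase ε z.2 η - μ) *
      (Real.fourierChar (-(z.1 * l)) * Real.fourierChar (-(z.2 * s)) * Ψ z.1 z.2 η)) := by
  rw [Real.fourier_real_eq, ← integral_sub_left_eq_self _ _ z.1]
  have : ∀ q : ℝ, Real.fourierChar (-((z.1 - q) * l)) • integrand θ ε s Ψ η z (z.1 - q) =
      ((2 * Real.pi * z.2) ^ 3 *
        (Real.fourierChar (-(z.1 * l)) * Real.fourierChar (-(z.2 * s)) * Ψ z.1 z.2 η)) *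
      ((θ q : ℂ) *
        Complex.exp (Complex.I * ((phase ε z.2 η + 2 * Real.pi * l) * q : ℝ))) := fun q => by
    rw [show -((z.1 - q) * l) = -(z.1 * l) + q * l by ring, Circle.smul_def, fourierChar_coe_add,
      Real.fourierChar_apply (q * l)]
    simp only [integrand, evolved, sub_sub_cancel, smul_eq_mul]
    have e : Complex.exp (Complex.I * ((phase ε z.2 η + 2 * Real.pi * l) * q : ℝ)) =
        Complex.exp (Complex.I * (q * phase ε z.2 η : ℝ)) *
          Complex.exp ((2 * Real.pi * (q * l) : ℝ) * Complex.I) := by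
      rw [← Complex.exp_add]; congr 1; push_cast; ring
    rw [e]; ring
  simp_rw [this]
  rw [integral_const_mul, hμ]
  ring

/-- Multiplication by the resolvent symbol in `ρ` becomes integration against the kernel of
`exists_resolvent_kernel` in the distinguished variable. The kernel depends on `l` and `η`, but its
bound does not. -/
theorem fourier_duhamelSlice (h : RapidDecay Ψ) (hθ : IsResolventWeight θ) {ε : ℝ} (hε : 0 ≤ ε)
    (l : ℝ) : ∃ c : ℂ, ‖c‖ ≤ 1 ∧ ∀ η : E, ∃ K : ℝ → ℂ, (∀ x, ‖K x‖ ≤ 13) ∧ ∀ s : ℝ,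
      𝓕 (fun τ => duhamelSlice θ ε Ψ τ s η) l = c * ∫ x, K x * timeSlice Ψ l (s + x) η := by
  obtain ⟨μ, hμ, c, hc, hF⟩ := hθ.transform l
  refine ⟨c, hc, fun η => ?_⟩
  obtain ⟨K, hKi, hKb, hKf⟩ := exists_resolvent_kernel (a := (2 * Real.pi * ‖η‖) ^ 2)
    (sq_nonneg _) hε hμ
  refine ⟨K, hKb, fun s => ?_⟩
  obtain ⟨C, hC, hb⟩ := h.bound_coarse
  have hdom : Integrable (fun p : ℝ × ℝ => decay 3 p.1 * decay 2 p.2) (volume.prod volume) :=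
    (integrable_decay volume (by simp)).mul_prod (integrable_decay volume (by simp))
  have hΨm : Measurable fun z : ℝ × ℝ => Ψ z.1 z.2 η :=
    h.measurable_comp measurable_fst measurable_snd measurable_const
  have hΨi : Integrable (fun z : ℝ × ℝ => Ψ z.1 z.2 η) (volume.prod volume) := by
    refine (hdom.const_mul (C * decay (Module.finrank ℝ E + 1) η)).mono'
      hΨm.aestronglyMeasurable (ae_of_all _ fun z => (hb _ _ _).trans_eq ?_)
    ring
  have hec := continuous_fourierChar_coe
  have hΨi' : ∀ r : ℝ, Integrable (fun z : ℝ × ℝ => (Real.fourierChar (-(z.1 * l)) : ℂ) *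
      Real.fourierChar (-(z.2 * r)) * Ψ z.1 z.2 η) (volume.prod volume) := fun r => by
    refine hΨi.bdd_mul (c := 1) (Continuous.aestronglyMeasurable ?_) (ae_of_all _ fun z => ?_)
    · exact (hec.comp (by fun_prop)).mul (hec.comp (by fun_prop))
    · exact (fourierChar_mul_norm _ _).le
  have hA : ∀ r : ℝ, timeSlice Ψ l r η = ∫ z : ℝ × ℝ, (Real.fourierChar (-(z.1 * l)) : ℂ) *
      Real.fourierChar (-(z.2 * r)) * Ψ z.1 z.2 η := fun r => by
    rw [Measure.volume_eq_prod, integral_prod _ (hΨi' r)]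
    simp only [timeSlice, Real.fourier_real_eq, Circle.smul_def, smul_eq_mul, mul_assoc]
    simp_rw [integral_const_mul]
  calc 𝓕 (fun τ => duhamelSlice θ ε Ψ τ s η) l
      = 𝓕 (fun τ => ∫ z, integrand θ ε s Ψ η z τ) l := by
        simp_rw [h.duhamelSlice_eq_integral hθ.measurable hθ.abs_le ε s η]
    _ = ∫ z, 𝓕 (integrand θ ε s Ψ η z) l :=
        (integral_fourier_swap (h.integrable_integrand_prod hθ.measurable hθ.integrable ε s η)
          l).symm
    _ = ∫ z : ℝ × ℝ, c * (𝓕 K z.2 * (Real.fourierChar (-(z.1 * l)) *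
          Real.fourierChar (-(z.2 * s)) * Ψ z.1 z.2 η)) := by
        refine integral_congr_ae (ae_of_all _ fun z => ?_)
        simp only
        rw [fourier_integrand ε s η z hF, hKf]
        rfl
    _ = c * ∫ z : ℝ × ℝ, ∫ x, K x * (Real.fourierChar (-(z.1 * l)) *
          Real.fourierChar (-(z.2 * (s + x))) * Ψ z.1 z.2 η) := by
        rw [integral_const_mul]
        congr 1
        refine integral_congr_ae (ae_of_all _ fun z => ?_)
        simp only [Real.fourier_real_eq]
        rw [← integral_mul_const]
        refine integral_congr_ae (ae_of_all _ fun x => ?_)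
        simp only [Circle.smul_def, smul_eq_mul]
        rw [show -(z.2 * (s + x)) = -(x * z.2) + -(z.2 * s) by ring, fourierChar_coe_add]
        ring
    -- Only here is the integrability of `K` used, and only qualitatively, to justify Fubini; its
    -- `L¹` norm enters no estimate.
    _ = c * ∫ x, ∫ z : ℝ × ℝ, K x * (Real.fourierChar (-(z.1 * l)) *
          Real.fourierChar (-(z.2 * (s + x))) * Ψ z.1 z.2 η) := by
        congr 1
        refine integral_integral_swap ?_
        have hKΨ : Integrable (fun p : (ℝ × ℝ) × ℝ => Ψ p.1.1 p.1.2 η * K p.2)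
          ((volume.prod volume).prod volume) := hΨi.mul_prod hKi
        have : Function.uncurry (fun (z : ℝ × ℝ) (x : ℝ) =>
            K x * (Real.fourierChar (-(z.1 * l)) * Real.fourierChar (-(z.2 * (s + x))) *
              Ψ z.1 z.2 η)) = fun p : (ℝ × ℝ) × ℝ => ((Real.fourierChar (-(p.1.1 * l)) : ℂ) *
              Real.fourierChar (-(p.1.2 * (s + p.2)))) * (Ψ p.1.1 p.1.2 η * K p.2) := by
          ext p; simp only [Function.uncurry]; ring
        rw [this]
        refine hKΨ.bdd_mul (c := 1) (Continuous.aestronglyMeasurable ?_) (ae_of_all _ fun z => ?_)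
        · exact (hec.comp (by fun_prop)).mul (hec.comp (by fun_prop))
        · exact (fourierChar_mul_norm _ _).le
    _ = c * ∫ x, K x * timeSlice Ψ l (s + x) η := by
        congr 1
        refine integral_congr_ae (ae_of_all _ fun x => ?_)
        simp only
        rw [integral_const_mul, hA]

end RapidDecay
end

/-! ### The one-sided estimate for damped weights -/

noncomputable section
open FourierTransform

variable {E : Type*} [NormedAddCommGroup E] [InnerProductSpace ℝ E] [FiniteDimensional ℝ E]
  [MeasurableSpace E] [BorelSpace E]

/-- The `L²` norm of a function of two variables. -/
def sliceNorm {α β : Type*} [MeasureSpace α] [MeasureSpace β] (F : α → β → ℂ) : ℝ≥0∞ :=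
  (∫⁻ t, ∫⁻ y, ‖F t y‖ₑ ^ 2) ^ (1 / 2 : ℝ)

theorem sliceNorm_sq {α β : Type*} [MeasureSpace α] [MeasureSpace β] (F : α → β → ℂ) :
    sliceNorm F ^ 2 = ∫⁻ t, ∫⁻ y, ‖F t y‖ₑ ^ 2 := ENNReal.rpow_half_sq _

theorem integrable_bounded_of_decay {V : Type*} [NormedAddCommGroup V] [NormedSpace ℝ V]
    [FiniteDimensional ℝ V] [MeasurableSpace V] [BorelSpace V] {μ : Measure V}
    [μ.IsAddHaarMeasure] {k : ℕ} (hk : Module.finrank ℝ V < k)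
    {f : V → ℂ} (hf : Measurable f) {C : ℝ} (hb : ∀ v, ‖f v‖ ≤ C * decay k v) :
    Integrable f μ ∧ MemLp f 2 μ := by
  have hi : Integrable f μ := ((integrable_decay μ hk).const_mul C).mono'
    hf.aestronglyMeasurable (ae_of_all _ hb)
  refine ⟨hi, memLp_two_of_integrable_of_bound hi (C := |C|) fun v => (hb v).trans ?_⟩
  exact (mul_le_mul_of_nonneg_right (le_abs_self C) (decay_nonneg _ _)).trans
    (mul_le_of_le_one_right (abs_nonneg C) (decay_le_one _ _))

namespace RapidDecay

variable {Ψ : ℝ → ℝ → E → ℂ} {θ : ℝ → ℝ}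

theorem measurable_partial (h : RapidDecay Ψ) {α : Type*} [MeasurableSpace α]
    {r t : α → ℝ} {η : α → E} (hr : Measurable r) (ht : Measurable t)
    (hη : Measurable η) : Measurable fun a => 𝓕 (fun ρ => Ψ (t a) ρ (η a)) (r a) := by
  have h1 : Measurable (Function.uncurry fun (a : α) (ρ : ℝ) => Ψ (t a) ρ (η a)) :=
    h.measurable_comp (ht.comp measurable_fst) measurable_snd (hη.comp measurable_fst)
  have h2 := (measurable_fourier h1).comp (measurable_id.prodMk hr)
  exact h2

theorem bound_partial (h : RapidDecay Ψ) : ∃ C : ℝ, 0 ≤ C ∧ ∀ r t η,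
    ‖𝓕 (fun ρ => Ψ t ρ η) r‖ ≤ C * (decay 3 t * decay (Module.finrank ℝ E + 1) η) := by
  obtain ⟨C, hC, hb⟩ := h.bound_coarse
  refine ⟨C * ∫ ρ : ℝ, decay 2 ρ, mul_nonneg hC (integral_nonneg fun ρ => decay_nonneg _ _),
    fun r t η => (norm_fourier_le_integral _ _).trans ?_⟩
  have hi : Integrable (decay 2 : ℝ → ℝ) := integrable_decay volume (by simp)
  calc ∫ ρ, ‖Ψ t ρ η‖
      ≤ ∫ ρ, (C * (decay 3 t * decay (Module.finrank ℝ E + 1) η)) * decay 2 ρ := by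
        refine integral_mono_of_nonneg (ae_of_all _ fun _ => norm_nonneg _) (hi.const_mul _)
          (ae_of_all _ fun ρ => (hb t ρ η).trans_eq ?_)
        ring
    _ = _ := by rw [integral_const_mul]; ring

theorem measurable_timeSlice (h : RapidDecay Ψ) {α : Type*} [MeasurableSpace α]
    {l r : α → ℝ} {η : α → E} (hl : Measurable l) (hr : Measurable r)
    (hη : Measurable η) : Measurable fun a => timeSlice Ψ (l a) (r a) (η a) := by
  have h1 : Measurable (Function.uncurry fun (a : α) (t : ℝ) =>
      𝓕 (fun ρ => Ψ t ρ (η a)) (r a)) :=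
    h.measurable_partial (hr.comp measurable_fst) measurable_snd (hη.comp measurable_fst)
  have h2 := (measurable_fourier h1).comp (measurable_id.prodMk hl)
  exact h2

/-- Plancherel in time at fixed `η` and Plancherel in the transverse variables at fixed `t` reach
the same partial transform, taken in `ρ` alone. -/
theorem lintegral_timeSlice_sq (h : RapidDecay Ψ) (r : ℝ) :
    ∫⁻ η, ∫⁻ l, ‖timeSlice Ψ l r η‖ₑ ^ 2 = sliceNorm (fun t => wave Ψ t r) ^ 2 := by
  obtain ⟨C, hC, hb⟩ := h.bound_partial
  have h1 : ∀ η : E, ∫⁻ l, ‖timeSlice Ψ l r η‖ₑ ^ 2 =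
      ∫⁻ t, ‖𝓕 (fun ρ => Ψ t ρ η) r‖ₑ ^ 2 := fun η => by
    have := integrable_bounded_of_decay (μ := volume) (k := 3) (by simp)
      (h.measurable_partial (measurable_const (a := r)) measurable_id
        (measurable_const (a := η))) (C := C * decay (Module.finrank ℝ E + 1) η)
      (fun t => (hb r t η).trans_eq (by ring))
    exact lintegral_enorm_fourier_sq this.1 this.2
  have h2 : ∀ t : ℝ, ∫⁻ y, ‖wave Ψ t r y‖ₑ ^ 2 =
      ∫⁻ η, ‖𝓕 (fun ρ => Ψ t ρ η) r‖ₑ ^ 2 := fun t => by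
    have := integrable_bounded_of_decay (μ := (volume : Measure E))
      (k := Module.finrank ℝ E + 1) (Nat.lt_succ_self _)
      (h.measurable_partial (measurable_const (a := r)) (measurable_const (a := t))
        measurable_id) (C := C * decay 3 t)
      (fun η => (hb r t η).trans_eq (by ring))
    exact lintegral_enorm_fourier_sq this.1 this.2
  rw [sliceNorm_sq]
  simp_rw [h1, h2]
  refine lintegral_lintegral_swap (Measurable.aemeasurable ?_)
  exact (h.measurable_partial measurable_const measurable_snd measurable_fst).enorm.pow_const 2

theorem lintegral_duhamelSlice_sq (h : RapidDecay Ψ) (hθ : IsResolventWeight θ) (ε s : ℝ)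
    (η : E) : ∫⁻ τ, ‖duhamelSlice θ ε Ψ τ s η‖ₑ ^ 2 =
      ∫⁻ l, ‖𝓕 (fun τ => duhamelSlice θ ε Ψ τ s η) l‖ₑ ^ 2 := by
  obtain ⟨C, hC, hb⟩ := h.bound_duhamelSlice hθ.abs_le
  refine (lintegral_enorm_fourier_sq ?_ ?_).symm
  · have := (h.integrable_integrand_prod hθ.measurable hθ.integrable ε s η).integral_prod_right
    refine this.congr (ae_of_all _ fun τ => ?_)
    exact (h.duhamelSlice_eq_integral hθ.measurable hθ.abs_le ε s η τ).symm
  · refine memLp_two_of_integrable_of_bound ?_ (C := C * decay (Module.finrank ℝ E + 1) η)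
      fun τ => hb ε τ s η
    have := (h.integrable_integrand_prod hθ.measurable hθ.integrable ε s η).integral_prod_right
    refine this.congr (ae_of_all _ fun τ => ?_)
    exact (h.duhamelSlice_eq_integral hθ.measurable hθ.abs_le ε s η τ).symm

/-- After Plancherel in `y` and `τ`, the bounded kernel gives at each `(l, η)` a pointwise bound by
the `L¹` norm in the distinguished variable, independent of `s`. Minkowski's inequality takes the
`L²` norm in `(l, η)` inside that integral, and Plancherel returns to physical variables. -/
theorem sliceNorm_duhamelWave_le_of_weight (h : RapidDecay Ψ) (hθ : IsResolventWeight θ) {ε : ℝ}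
    (hε : 0 ≤ ε) (s : ℝ) : sliceNorm (fun τ => duhamelWave θ ε Ψ τ s) ≤
      13 * ∫⁻ r, sliceNorm fun t => wave Ψ t r := by
  have hpt : ∀ (η : E) (l : ℝ), ‖𝓕 (fun τ => duhamelSlice θ ε Ψ τ s η) l‖ₑ ≤
      13 * ∫⁻ r, ‖timeSlice Ψ l r η‖ₑ := fun η l => by
    obtain ⟨c, hc, hK⟩ := h.fourier_duhamelSlice hθ hε l
    obtain ⟨K, hKb, hF⟩ := hK η
    rw [hF s, enorm_mul]
    have h1 : ‖c‖ₑ ≤ 1 := by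
      rw [← ofReal_norm]; exact ENNReal.ofReal_le_one.2 hc
    have hm : Measurable fun r => ‖timeSlice Ψ l r η‖ₑ :=
      (h.measurable_timeSlice measurable_const measurable_id measurable_const).enorm
    calc ‖c‖ₑ * ‖∫ x, K x * timeSlice Ψ l (s + x) η‖ₑ
        ≤ 1 * ∫⁻ x, ‖K x * timeSlice Ψ l (s + x) η‖ₑ := by
          gcongr; exact enorm_integral_le_lintegral_enorm _
      _ ≤ ∫⁻ x, 13 * ‖timeSlice Ψ l (s + x) η‖ₑ := by
          rw [one_mul]
          gcongr with x
          rw [enorm_mul]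
          gcongr
          rw [← ofReal_norm]
          exact (ENNReal.ofReal_le_ofReal (hKb x)).trans (by simp)
      _ = 13 * ∫⁻ x, ‖timeSlice Ψ l (s + x) η‖ₑ := lintegral_const_mul _
          (hm.comp (measurable_const_add s))
      _ = _ := by rw [lintegral_add_left_eq_self (fun r => ‖timeSlice Ψ l r η‖ₑ)]
  have hsq : sliceNorm (fun τ => duhamelWave θ ε Ψ τ s) ^ 2 ≤
      (13 * ∫⁻ r, sliceNorm fun t => wave Ψ t r) ^ 2 := by
    have hA : Measurable (Function.uncurry fun (r : ℝ) (p : E × ℝ) =>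
        ‖timeSlice Ψ p.2 r p.1‖ₑ) :=
      (h.measurable_timeSlice (measurable_snd.comp measurable_snd) measurable_fst
        (measurable_fst.comp measurable_snd)).enorm
    calc sliceNorm (fun τ => duhamelWave θ ε Ψ τ s) ^ 2
        = ∫⁻ τ, ∫⁻ η, ‖duhamelSlice θ ε Ψ τ s η‖ₑ ^ 2 := by
          rw [sliceNorm_sq]
          simp_rw [h.lintegral_duhamelWave_sq hθ.measurable hθ.abs_le]
      _ = ∫⁻ η, ∫⁻ τ, ‖duhamelSlice θ ε Ψ τ s η‖ₑ ^ 2 := by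
          refine lintegral_lintegral_swap (Measurable.aemeasurable ?_)
          exact (h.measurable_duhamelSlice hθ.measurable ε measurable_fst measurable_const
            measurable_snd).enorm.pow_const 2
      _ ≤ ∫⁻ η, ∫⁻ l, (13 * ∫⁻ r, ‖timeSlice Ψ l r η‖ₑ) ^ 2 := by
          simp_rw [h.lintegral_duhamelSlice_sq hθ]
          gcongr with η l
          exact hpt η l
      _ = ∫⁻ p : E × ℝ, (13 * ∫⁻ r, ‖timeSlice Ψ p.2 r p.1‖ₑ) ^ 2 := by
          rw [Measure.volume_eq_prod, lintegral_prod]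
          exact (((hA.comp measurable_swap).lintegral_prod_right'.const_mul _).pow_const
            2).aemeasurable
      _ = 13 ^ 2 * ∫⁻ p : E × ℝ, (∫⁻ r, ‖timeSlice Ψ p.2 r p.1‖ₑ) ^ 2 := by
          simp_rw [mul_pow]
          exact lintegral_const_mul _
            (((hA.comp measurable_swap).lintegral_prod_right').pow_const 2)
      _ ≤ 13 ^ 2 * (∫⁻ r, (∫⁻ p : E × ℝ, ‖timeSlice Ψ p.2 r p.1‖ₑ ^ 2) ^ (1 / 2 : ℝ)) ^ 2 := by
          gcongr
          exact lintegral_lintegral_sq_le hA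
      _ = _ := by
          rw [mul_pow]
          congr 2
          refine lintegral_congr fun r => ?_
          rw [Measure.volume_eq_prod, lintegral_prod, h.lintegral_timeSlice_sq,
            ENNReal.sq_rpow_half]
          exact ((h.measurable_timeSlice measurable_snd measurable_const
            measurable_fst).enorm.pow_const 2).aemeasurable
  have := ENNReal.rpow_le_rpow hsq (show (0 : ℝ) ≤ 1 / 2 by norm_num)
  rwa [ENNReal.sq_rpow_half, ENNReal.sq_rpow_half] at this

end RapidDecay
end

/-! ### Damped one-sided weights and removal of the damping -/

noncomputable section
open FourierTransform Filter Topology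

/-- The indicator of the past, exponentially damped at rate `δ`. -/
def forwardWeight (δ q : ℝ) : ℝ := if 0 ≤ q then Real.exp (-δ * q) else 0

/-- The indicator of the future, exponentially damped at rate `δ`. -/
def backwardWeight (δ q : ℝ) : ℝ := if q < 0 then Real.exp (δ * q) else 0

theorem measurable_forwardWeight (δ : ℝ) : Measurable (forwardWeight δ) :=
  Measurable.ite measurableSet_Ici (by fun_prop) measurable_const

theorem measurable_backwardWeight (δ : ℝ) : Measurable (backwardWeight δ) :=
  Measurable.ite measurableSet_Iio (by fun_prop) measurable_const

theorem abs_forwardWeight_le {δ : ℝ} (hδ : 0 ≤ δ) (q : ℝ) : |forwardWeight δ q| ≤ 1 := by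
  unfold forwardWeight
  split_ifs with h
  · rw [abs_of_pos (Real.exp_pos _), Real.exp_le_one_iff]
    nlinarith
  · simp

theorem abs_backwardWeight_le {δ : ℝ} (hδ : 0 ≤ δ) (q : ℝ) : |backwardWeight δ q| ≤ 1 := by
  unfold backwardWeight
  split_ifs with h
  · rw [abs_of_pos (Real.exp_pos _), Real.exp_le_one_iff]
    nlinarith
  · simp

theorem isResolventWeight_forwardWeight {δ : ℝ} (hδ : 0 < δ) :
    IsResolventWeight (forwardWeight δ) where
  measurable := measurable_forwardWeight δ
  abs_le := abs_forwardWeight_le hδ.le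
  integrable := by
    have : forwardWeight δ = (Set.Ici (0 : ℝ)).indicator fun q => Real.exp (-δ * q) := by
      ext q; simp [forwardWeight, Set.indicator_apply]
    rw [this, integrable_indicator_iff measurableSet_Ici, integrableOn_Ici_iff_integrableOn_Ioi]
    exact integrableOn_exp_mul_Ioi (by linarith) 0
  transform l := by
    -- With `α = P + 2πl` the integral over `q ≥ 0` is `1 / (δ - iα) = i / (α + iδ)`, so `μ` lies
    -- below the real axis. For the backward weight it lies above.
    refine ⟨-(2 * Real.pi * l : ℝ) - δ * Complex.I, by simpa using hδ.ne', Complex.I, by simp,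
      fun P => ?_⟩
    have h1 : (fun q : ℝ => (forwardWeight δ q : ℂ) *
        Complex.exp (Complex.I * ((P + 2 * Real.pi * l) * q : ℝ))) =
        (Set.Ici (0 : ℝ)).indicator fun q : ℝ =>
          Complex.exp ((-δ + Complex.I * (P + 2 * Real.pi * l : ℝ)) * q) := by
      ext q
      by_cases hq : 0 ≤ q
      · simp only [forwardWeight, hq, if_true, Set.indicator_of_mem (Set.mem_Ici.2 hq),
          Complex.ofReal_exp, ← Complex.exp_add]
        congr 1
        push_cast; ring
      · simp [forwardWeight, hq]
    rw [h1, integral_indicator measurableSet_Ici, integral_Ici_eq_integral_Ioi,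
      integral_exp_mul_complex_Ioi (by simpa using hδ)]
    have n1 : (-δ + Complex.I * (P + 2 * Real.pi * l : ℝ) : ℂ) ≠ 0 := fun h => by
      have := congrArg Complex.re h; simp at this; exact hδ.ne' this
    have n2 : (P - (-(2 * Real.pi * l : ℝ) - δ * Complex.I) : ℂ) ≠ 0 := fun h => by
      have := congrArg Complex.im h; simp at this; exact hδ.ne' this
    simp only [Complex.ofReal_zero, mul_zero, Complex.exp_zero]
    rw [div_eq_div_iff n1 n2]
    push_cast
    linear_combination (-(P + 2 * Real.pi * l) : ℂ) * Complex.I_sq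

theorem isResolventWeight_backwardWeight {δ : ℝ} (hδ : 0 < δ) :
    IsResolventWeight (backwardWeight δ) where
  measurable := measurable_backwardWeight δ
  abs_le := abs_backwardWeight_le hδ.le
  integrable := by
    have : backwardWeight δ = (Set.Iio (0 : ℝ)).indicator fun q => Real.exp (δ * q) := by
      ext q; simp [backwardWeight, Set.indicator_apply]
    rw [this, integrable_indicator_iff measurableSet_Iio]
    exact (integrableOn_exp_mul_Iic hδ 0).mono_set Set.Iio_subset_Iic_self
  transform l := by
    refine ⟨-(2 * Real.pi * l : ℝ) + δ * Complex.I, by simpa using hδ.ne', -Complex.I, by simp,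
      fun P => ?_⟩
    have h1 : (fun q : ℝ => (backwardWeight δ q : ℂ) *
        Complex.exp (Complex.I * ((P + 2 * Real.pi * l) * q : ℝ))) =
        (Set.Iio (0 : ℝ)).indicator fun q : ℝ =>
          Complex.exp ((δ + Complex.I * (P + 2 * Real.pi * l : ℝ)) * q) := by
      ext q
      by_cases hq : q < 0
      · simp only [backwardWeight, hq, if_true, Set.indicator_of_mem (Set.mem_Iio.2 hq),
          Complex.ofReal_exp, ← Complex.exp_add]
        congr 1
        push_cast; ring
      · simp [backwardWeight, hq]
    rw [h1, integral_indicator measurableSet_Iio, ← integral_Iic_eq_integral_Iio,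
      integral_exp_mul_complex_Iic (by simpa using hδ)]
    have n1 : (δ + Complex.I * (P + 2 * Real.pi * l : ℝ) : ℂ) ≠ 0 := fun h => by
      have := congrArg Complex.re h; simp at this; exact hδ.ne' this
    have n2 : (P - (-(2 * Real.pi * l : ℝ) + δ * Complex.I) : ℂ) ≠ 0 := fun h => by
      have := congrArg Complex.im h; simp at this; exact hδ.ne' this
    simp only [Complex.ofReal_zero, mul_zero, Complex.exp_zero]
    rw [div_eq_div_iff n1 n2]
    push_cast
    linear_combination ((P + 2 * Real.pi * l) : ℂ) * Complex.I_sq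

theorem tendsto_forwardWeight (q : ℝ) {δ : ℕ → ℝ} (hδ : Tendsto δ atTop (𝓝 0)) :
    Tendsto (fun m => forwardWeight (δ m) q) atTop (𝓝 (forwardWeight 0 q)) := by
  unfold forwardWeight
  split_ifs
  · exact ((by fun_prop : Continuous fun d : ℝ => Real.exp (-d * q)).tendsto 0).comp hδ
  · exact tendsto_const_nhds

theorem tendsto_backwardWeight (q : ℝ) {δ : ℕ → ℝ} (hδ : Tendsto δ atTop (𝓝 0)) :
    Tendsto (fun m => backwardWeight (δ m) q) atTop (𝓝 (backwardWeight 0 q)) := by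
  unfold backwardWeight
  split_ifs
  · exact ((by fun_prop : Continuous fun d : ℝ => Real.exp (d * q)).tendsto 0).comp hδ
  · exact tendsto_const_nhds

variable {E : Type*} [NormedAddCommGroup E] [InnerProductSpace ℝ E] [FiniteDimensional ℝ E]
  [MeasurableSpace E] [BorelSpace E]

namespace RapidDecay

variable {Ψ : ℝ → ℝ → E → ℂ}

theorem bound_fourier_slice (h : RapidDecay Ψ) : ∃ C : ℝ, 0 ≤ C ∧ ∀ ε q s t y,
    ‖𝓕 (slice ε q s (Ψ t)) y‖ ≤ C * decay 3 t := by
  obtain ⟨C, hC, hb⟩ := h.bound_slice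
  refine ⟨C * ∫ η : E, decay (Module.finrank ℝ E + 1) η,
    mul_nonneg hC (integral_nonneg fun _ => decay_nonneg _ _),
    fun ε q s t y => (norm_fourier_le_integral _ _).trans ?_⟩
  have hi : Integrable (decay (Module.finrank ℝ E + 1) : E → ℝ) :=
    integrable_decay volume (Nat.lt_succ_self _)
  calc ∫ η, ‖slice ε q s (Ψ t) η‖
      ≤ ∫ η : E, (C * decay 3 t) * decay (Module.finrank ℝ E + 1) η := by
        refine integral_mono_of_nonneg (ae_of_all _ fun _ => norm_nonneg _) (hi.const_mul _)
          (ae_of_all _ fun η => (hb ε q s t η).trans_eq ?_)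
        ring
    _ = _ := by rw [integral_const_mul]; ring

theorem measurable_fourier_slice (h : RapidDecay Ψ) (ε : ℝ) {α : Type*} [MeasurableSpace α]
    {q s t : α → ℝ} {y : α → E} (hq : Measurable q) (hs : Measurable s) (ht : Measurable t)
    (hy : Measurable y) : Measurable fun a => 𝓕 (slice ε (q a) (s a) (Ψ (t a))) (y a) := by
  have h1 : Measurable (Function.uncurry fun (a : α) (η : E) =>
      slice ε (q a) (s a) (Ψ (t a)) η) :=
    h.measurable_slice ε (hq.comp measurable_fst) (hs.comp measurable_fst)
      (ht.comp measurable_fst) measurable_snd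
  have h2 := (measurable_fourier h1).comp (measurable_id.prodMk hy)
  exact h2

theorem measurable_duhamelWave (h : RapidDecay Ψ) {θ : ℝ → ℝ} (hθ : Measurable θ) (ε : ℝ)
    {α : Type*} [MeasurableSpace α] {τ s : α → ℝ} {y : α → E} (hτ : Measurable τ)
    (hs : Measurable s) (hy : Measurable y) :
    Measurable fun a => duhamelWave θ ε Ψ (τ a) (s a) (y a) := by
  unfold duhamelWave
  refine StronglyMeasurable.measurable (StronglyMeasurable.integral_prod_right' (ν := volume)
    (f := fun z : α × ℝ => (θ (z.2 - τ z.1) : ℂ) *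
      𝓕 (slice ε (z.2 - τ z.1) (s z.1) (Ψ z.2)) (y z.1)) (Measurable.stronglyMeasurable ?_))
  have hτ' : Measurable fun z : α × ℝ => z.2 - τ z.1 := measurable_snd.sub (hτ.comp measurable_fst)
  exact (Complex.measurable_ofReal.comp (hθ.comp hτ')).mul
    (h.measurable_fourier_slice ε hτ' (hs.comp measurable_fst) measurable_snd
      (hy.comp measurable_fst))

/-- The waves converge pointwise by dominated convergence, and Fatou's lemma passes the uniform
bound to the limit. The limit weight need not be integrable, as the undamped indicators are not. -/
theorem sliceNorm_duhamelWave_le_of_tendsto (h : RapidDecay Ψ) {ε : ℝ} (hε : 0 ≤ ε)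
    {θ : ℕ → ℝ → ℝ} {θ' : ℝ → ℝ} (hθ : ∀ m, IsResolventWeight (θ m))
    (hlim : ∀ q, Tendsto (fun m => θ m q) atTop (𝓝 (θ' q))) (s : ℝ) :
    sliceNorm (fun τ => duhamelWave θ' ε Ψ τ s) ≤
      13 * ∫⁻ r, sliceNorm fun t => wave Ψ t r := by
  obtain ⟨C, hC, hb⟩ := h.bound_fourier_slice
  have hpt : ∀ τ y, Tendsto (fun m => duhamelWave (θ m) ε Ψ τ s y) atTop
      (𝓝 (duhamelWave θ' ε Ψ τ s y)) := fun τ y => by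
    refine tendsto_integral_of_dominated_convergence (fun t => C * decay 3 t) (fun m => ?_)
      ((integrable_decay volume (by simp)).const_mul C) (fun m => ae_of_all _ fun t => ?_)
      (ae_of_all _ fun t => ?_)
    · exact ((Complex.measurable_ofReal.comp ((hθ m).measurable.comp
        (measurable_id.sub_const τ))).mul (h.measurable_fourier_slice ε
        (measurable_id.sub_const τ) measurable_const measurable_id
        measurable_const)).aestronglyMeasurable
    · rw [norm_mul, Complex.norm_real, Real.norm_eq_abs]
      exact (mul_le_of_le_one_left (norm_nonneg _) ((hθ m).abs_le _)).trans (hb _ _ _ _ _)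
    · exact ((Complex.continuous_ofReal.tendsto _).comp (hlim (t - τ))).mul_const _
  set B := 13 * ∫⁻ r, sliceNorm fun t => wave Ψ t r with hB
  have hm : ∀ m, ∫⁻ z : ℝ × E, ‖duhamelWave (θ m) ε Ψ z.1 s z.2‖ₑ ^ 2 ≤ B ^ 2 := fun m => by
    rw [Measure.volume_eq_prod, lintegral_prod _ ((h.measurable_duhamelWave (hθ m).measurable ε
      measurable_fst measurable_const measurable_snd).enorm.pow_const 2).aemeasurable]
    have := h.sliceNorm_duhamelWave_le_of_weight (hθ m) hε s
    rw [← sliceNorm_sq]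
    gcongr
  have hmeas : Measurable θ' :=
    measurable_of_tendsto_metrizable (fun m => (hθ m).measurable) (tendsto_pi_nhds.2 hlim)
  have hsq : sliceNorm (fun τ => duhamelWave θ' ε Ψ τ s) ^ 2 ≤ B ^ 2 := by
    rw [sliceNorm_sq, ← lintegral_prod (fun z : ℝ × E => ‖duhamelWave θ' ε Ψ z.1 s z.2‖ₑ ^ 2)
      ((h.measurable_duhamelWave hmeas ε
      measurable_fst measurable_const measurable_snd).enorm.pow_const 2).aemeasurable]
    calc ∫⁻ z : ℝ × E, ‖duhamelWave θ' ε Ψ z.1 s z.2‖ₑ ^ 2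
        = ∫⁻ z : ℝ × E, liminf (fun m => ‖duhamelWave (θ m) ε Ψ z.1 s z.2‖ₑ ^ 2) atTop := by
          refine lintegral_congr fun z => (Tendsto.liminf_eq ?_).symm
          exact ((ENNReal.continuous_pow 2).tendsto _).comp
            ((continuous_enorm.tendsto _).comp (hpt z.1 z.2))
      _ ≤ liminf (fun m => ∫⁻ z : ℝ × E, ‖duhamelWave (θ m) ε Ψ z.1 s z.2‖ₑ ^ 2) atTop :=
          lintegral_liminf_le fun m => (h.measurable_duhamelWave (hθ m).measurable ε
            measurable_fst measurable_const measurable_snd).enorm.pow_const 2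
      _ ≤ B ^ 2 := by
          refine (liminf_le_liminf (Eventually.of_forall hm)).trans ?_
          simp
  have := ENNReal.rpow_le_rpow hsq (show (0 : ℝ) ≤ 1 / 2 by norm_num)
  rwa [ENNReal.sq_rpow_half, ENNReal.sq_rpow_half] at this

theorem sliceNorm_forward_le (h : RapidDecay Ψ) {ε : ℝ} (hε : 0 ≤ ε) (s : ℝ) :
    sliceNorm (fun τ => duhamelWave (forwardWeight 0) ε Ψ τ s) ≤
      13 * ∫⁻ r, sliceNorm fun t => wave Ψ t r :=
  h.sliceNorm_duhamelWave_le_of_tendsto hε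
    (fun m => isResolventWeight_forwardWeight (δ := 1 / ((m : ℝ) + 1)) (by positivity))
    (fun q => tendsto_forwardWeight q tendsto_one_div_add_atTop_nhds_zero_nat) s

theorem sliceNorm_backward_le (h : RapidDecay Ψ) {ε : ℝ} (hε : 0 ≤ ε) (s : ℝ) :
    sliceNorm (fun τ => duhamelWave (backwardWeight 0) ε Ψ τ s) ≤
      13 * ∫⁻ r, sliceNorm fun t => wave Ψ t r :=
  h.sliceNorm_duhamelWave_le_of_tendsto hε
    (fun m => isResolventWeight_backwardWeight (δ := 1 / ((m : ℝ) + 1)) (by positivity))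
    (fun q => tendsto_backwardWeight q tendsto_one_div_add_atTop_nhds_zero_nat) s

end RapidDecay
end

/-! ### The kernel of the time integral and absolute convergence of the pairing -/

noncomputable section
open FourierTransform Filter Topology

section Norms

variable {α β γ : Type*} [MeasureSpace α] [MeasureSpace β] [MeasureSpace γ]
  [SFinite (volume : Measure α)] [SFinite (volume : Measure β)] [SFinite (volume : Measure γ)]

theorem lintegral_triple {F : α → β → γ → ℝ≥0∞}
    (hF : Measurable fun z : α × β × γ => F z.1 z.2.1 z.2.2) :
    ∫⁻ z : α × β × γ, F z.1 z.2.1 z.2.2 = ∫⁻ s, ∫⁻ t, ∫⁻ e, F t s e := by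
  rw [Measure.volume_eq_prod, lintegral_prod _ hF.aemeasurable]
  have : ∀ t, ∫⁻ p : β × γ, F t p.1 p.2 = ∫⁻ s, ∫⁻ e, F t s e := fun t => by
    have hm : Measurable fun p : β × γ => F t p.1 p.2 := hF.comp measurable_prodMk_left
    rw [Measure.volume_eq_prod, lintegral_prod _ hm.aemeasurable]
  simp_rw [this]
  refine lintegral_lintegral_swap (Measurable.aemeasurable ?_)
  refine Measurable.lintegral_prod_right' (f := fun p : (α × β) × γ => F p.1.1 p.1.2 p.2) ?_
  exact hF.comp (by fun_prop : Measurable fun p : (α × β) × γ => (p.1.1, p.1.2, p.2))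

theorem lintegral_mul_le_sliceNorm {f g : α → γ → ℂ}
    (hf : Measurable (Function.uncurry f)) (hg : Measurable (Function.uncurry g)) :
    ∫⁻ t, ∫⁻ e, ‖f t e‖ₑ * ‖g t e‖ₑ ≤ sliceNorm f * sliceNorm g := by
  have h := lintegral_mul_le_sqrt_mul_sqrt (volume.prod volume) hf.enorm.aemeasurable
    hg.enorm.aemeasurable
  have hm : Measurable fun x => ‖Function.uncurry f x‖ₑ * ‖Function.uncurry g x‖ₑ :=
    hf.enorm.mul hg.enorm
  rw [lintegral_prod _ hm.aemeasurable,
    lintegral_prod _ (hf.enorm.pow_const 2).aemeasurable,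
    lintegral_prod _ (hg.enorm.pow_const 2).aemeasurable] at h
  exact h

theorem measurable_sliceNorm {g : α → β → γ → ℂ}
    (hg : Measurable fun z : α × β × γ => g z.1 z.2.1 z.2.2) :
    Measurable fun s => sliceNorm fun t => g t s := by
  unfold sliceNorm
  refine Measurable.pow_const ?_ _
  refine Measurable.lintegral_prod_right' (f := fun p : β × α => ∫⁻ e, ‖g p.2 p.1 e‖ₑ ^ 2) ?_
  refine Measurable.lintegral_prod_right'
    (f := fun p : (β × α) × γ => ‖g p.1.2 p.1.1 p.2‖ₑ ^ 2) ?_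
  have := hg.comp (by fun_prop : Measurable fun p : (β × α) × γ => (p.1.2, p.1.1, p.2))
  exact this.enorm.pow_const 2

end Norms

/-- The kernel of the integration `∫₀ᵗ`. -/
def timeKernel (t τ : ℝ) : ℝ :=
  if 0 < τ then forwardWeight 0 (t - τ) else -backwardWeight 0 (t - τ)

theorem measurable_timeKernel : Measurable fun p : ℝ × ℝ => timeKernel p.1 p.2 := by
  unfold timeKernel
  refine Measurable.ite (measurableSet_lt measurable_const measurable_snd) ?_ ?_
  · exact (measurable_forwardWeight 0).comp (by fun_prop)
  · exact ((measurable_backwardWeight 0).comp (by fun_prop)).neg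

/-- Splitting by the sign of `τ` rather than of `t` makes the kernel a single one-sided weight of `t
- τ` for each fixed `τ`, so the adjoint can be estimated by the one-sided bounds. The endpoint `τ =
t` belongs to the forward weight only, which yields half-open intervals on both sides of zero. -/
theorem timeKernel_of_nonneg {t : ℝ} (ht : 0 ≤ t) :
    timeKernel t = (Set.Ioc 0 t).indicator 1 := by
  ext τ
  simp only [timeKernel, forwardWeight, backwardWeight, Set.indicator_apply, Set.mem_Ioc,
    neg_zero, zero_mul, Real.exp_zero, Pi.one_apply]
  split_ifs <;> first | rfl | (exfalso; grind) | simp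

theorem timeKernel_of_neg {t : ℝ} (ht : t < 0) :
    timeKernel t = -(Set.Ioc t 0).indicator 1 := by
  ext τ
  simp only [timeKernel, forwardWeight, backwardWeight, Set.indicator_apply, Set.mem_Ioc,
    neg_zero, zero_mul, Real.exp_zero, Pi.one_apply, Pi.neg_apply]
  split_ifs <;> first | rfl | (exfalso; grind) | simp

theorem integral_timeKernel_mul (t : ℝ) (f : ℝ → ℂ) :
    ∫ τ, (timeKernel t τ : ℂ) * f τ = ∫ τ in (0 : ℝ)..t, f τ := by
  rcases le_or_gt 0 t with ht | ht
  · rw [intervalIntegral.integral_of_le ht, timeKernel_of_nonneg ht,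
      ← integral_indicator measurableSet_Ioc]
    congr 1; ext τ
    by_cases h : τ ∈ Set.Ioc 0 t <;> simp [h]
  · rw [intervalIntegral.integral_of_ge ht.le, timeKernel_of_neg ht,
      ← integral_indicator measurableSet_Ioc, ← integral_neg]
    congr 1; ext τ
    by_cases h : τ ∈ Set.Ioc t 0 <;> simp [h]

theorem lintegral_timeKernel_sq (t : ℝ) :
    ∫⁻ τ, ‖(timeKernel t τ : ℂ)‖ₑ ^ 2 = ENNReal.ofReal |t| := by
  rcases le_or_gt 0 t with ht | ht
  · have : ∀ τ, ‖(timeKernel t τ : ℂ)‖ₑ ^ 2 = (Set.Ioc 0 t).indicator 1 τ := fun τ => by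
      rw [timeKernel_of_nonneg ht]
      by_cases h : τ ∈ Set.Ioc 0 t <;> simp [h]
    simp_rw [this]
    rw [lintegral_indicator_one measurableSet_Ioc]
    simp [abs_of_nonneg ht]
  · have : ∀ τ, ‖(timeKernel t τ : ℂ)‖ₑ ^ 2 = (Set.Ioc t 0).indicator 1 τ := fun τ => by
      rw [timeKernel_of_neg ht]
      by_cases h : τ ∈ Set.Ioc t 0 <;> simp [h]
    simp_rw [this]
    rw [lintegral_indicator_one measurableSet_Ioc]
    simp [abs_of_neg ht]

variable {E : Type*} [NormedAddCommGroup E] [InnerProductSpace ℝ E] [FiniteDimensional ℝ E]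
  [MeasurableSpace E] [BorelSpace E]

/-- The norm `‖∫ |2πρ|³ |ψ(ρ, ·)| dρ‖` in `L²`. -/
def profileNorm (ψ : ℝ → E → ℂ) : ℝ≥0∞ :=
  (∫⁻ η, (∫⁻ ρ, ‖evolved 0 0 ψ ρ η‖ₑ) ^ 2) ^ (1 / 2 : ℝ)

/-- The modulus of the evolved profile depends on neither `ε` nor `q`, so both may be set to zero in
the majorant. -/
theorem enorm_slice_le (ε q s : ℝ) (ψ : ℝ → E → ℂ) (η : E) :
    ‖slice ε q s ψ η‖ₑ ≤ ∫⁻ ρ, ‖evolved 0 0 ψ ρ η‖ₑ := by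
  have he : ∀ ρ, ‖evolved 0 0 ψ ρ η‖ₑ = ‖evolved ε q ψ ρ η‖ₑ := fun ρ => by
    rw [← ofReal_norm, ← ofReal_norm, norm_evolved, norm_evolved]
  simp_rw [he]
  rw [slice, Real.fourier_real_eq]
  refine (enorm_integral_le_lintegral_enorm _).trans_eq ?_
  refine lintegral_congr fun ρ => ?_
  rw [← ofReal_norm, ← ofReal_norm, Circle.norm_smul]

/-- The value at `t` of the Duhamel integral of `g`, tested against the wave with profile `ψ`. -/
def duhamelPairing (ε : ℝ) (g : ℝ → ℝ → E → ℂ) (t : ℝ) (ψ : ℝ → E → ℂ) : ℂ :=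
  ∫ z : ℝ × ℝ × E, (timeKernel t z.1 : ℂ) *
    (g z.1 z.2.1 z.2.2 * 𝓕 (slice ε (t - z.1) z.2.1 ψ) z.2.2)

namespace RapidDecay

variable {Ψ : ℝ → ℝ → E → ℂ} {g : ℝ → ℝ → E → ℂ}

theorem lintegral_fourier_slice_sq_le (h : RapidDecay Ψ) (ε q s t : ℝ) :
    ∫⁻ y, ‖𝓕 (slice ε q s (Ψ t)) y‖ₑ ^ 2 ≤ profileNorm (Ψ t) ^ 2 := by
  obtain ⟨C, hC, hb⟩ := h.bound_slice
  have hm : Measurable (slice ε q s (Ψ t)) :=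
    h.measurable_slice ε measurable_const measurable_const measurable_const measurable_id
  have hi := integrable_bounded_of_decay (μ := (volume : Measure E))
    (k := Module.finrank ℝ E + 1) (Nat.lt_succ_self _) hm (C := C * decay 3 t)
    (fun η => (hb ε q s t η).trans_eq (by ring))
  rw [lintegral_enorm_fourier_sq hi.1 hi.2, profileNorm, ENNReal.rpow_half_sq]
  gcongr with η
  exact enorm_slice_le ε q s (Ψ t) η

theorem measurable_pairing_integrand (h : RapidDecay Ψ)
    (hg : Measurable fun z : ℝ × ℝ × E => g z.1 z.2.1 z.2.2) (ε : ℝ) :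
    Measurable fun p : ℝ × ℝ × ℝ × E => (timeKernel p.1 p.2.1 : ℂ) *
      (g p.2.1 p.2.2.1 p.2.2.2 * 𝓕 (slice ε (p.1 - p.2.1) p.2.2.1 (Ψ p.1)) p.2.2.2) := by
  have h1 : Measurable fun p : ℝ × ℝ × ℝ × E => timeKernel p.1 p.2.1 :=
    measurable_timeKernel.comp (by fun_prop : Measurable fun p : ℝ × ℝ × ℝ × E => (p.1, p.2.1))
  have h2 : Measurable fun p : ℝ × ℝ × ℝ × E => g p.2.1 p.2.2.1 p.2.2.2 :=
    hg.comp measurable_snd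
  refine (Complex.measurable_ofReal.comp h1).mul (h2.mul ?_)
  exact h.measurable_fourier_slice ε (by fun_prop) (by fun_prop) (by fun_prop) (by fun_prop)

/-- A crude bound that serves absolute convergence and continuity in the test function, not the
final estimate. It is Cauchy–Schwarz in `(τ, y)` at each fixed `s`; the square norm of the time
kernel is responsible for the growth `|t|^{1/2}`. -/
theorem lintegral_pairing_integrand_le (h : RapidDecay Ψ)
    (hg : Measurable fun z : ℝ × ℝ × E => g z.1 z.2.1 z.2.2) (ε t : ℝ) :
    ∫⁻ z : ℝ × ℝ × E, ‖(timeKernel t z.1 : ℂ) *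
        (g z.1 z.2.1 z.2.2 * 𝓕 (slice ε (t - z.1) z.2.1 (Ψ t)) z.2.2)‖ₑ ≤
      (∫⁻ s, sliceNorm fun τ => g τ s) *
        (ENNReal.ofReal |t| ^ (1 / 2 : ℝ) * profileNorm (Ψ t)) := by
  have hm := (h.measurable_pairing_integrand hg ε).comp
    (measurable_prodMk_left (x := t) (β := ℝ × ℝ × E))
  rw [lintegral_triple (F := fun τ s e => ‖(timeKernel t τ : ℂ) *
        (g τ s e * 𝓕 (slice ε (t - τ) s (Ψ t)) e)‖ₑ) hm.enorm,
    ← lintegral_mul_const _ (measurable_sliceNorm hg)]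
  refine lintegral_mono fun s => ?_
  have hk : Measurable fun p : ℝ × E => (timeKernel t p.1 : ℂ) :=
    Complex.measurable_ofReal.comp (measurable_timeKernel.comp
      (by fun_prop : Measurable fun p : ℝ × E => (t, p.1)))
  have hF : Measurable (Function.uncurry fun (τ : ℝ) (e : E) =>
      (timeKernel t τ : ℂ) * 𝓕 (slice ε (t - τ) s (Ψ t)) e) := by
    refine hk.mul ?_
    exact h.measurable_fourier_slice ε (by fun_prop) measurable_const measurable_const
      measurable_snd
  have hgs : Measurable (Function.uncurry fun (τ : ℝ) (e : E) => g τ s e) :=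
    hg.comp (by fun_prop : Measurable fun p : ℝ × E => (p.1, s, p.2))
  calc ∫⁻ τ, ∫⁻ e, ‖(timeKernel t τ : ℂ) * (g τ s e * 𝓕 (slice ε (t - τ) s (Ψ t)) e)‖ₑ
      = ∫⁻ τ, ∫⁻ e, ‖g τ s e‖ₑ * ‖(timeKernel t τ : ℂ) * 𝓕 (slice ε (t - τ) s (Ψ t)) e‖ₑ := by
        refine lintegral_congr fun τ => lintegral_congr fun e => ?_
        rw [← enorm_mul]; congr 1; ring
    _ ≤ _ := lintegral_mul_le_sliceNorm hgs hF
    _ ≤ _ := by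
        gcongr
        rw [sliceNorm, profileNorm, ← ENNReal.mul_rpow_of_nonneg _ _ (by norm_num)]
        gcongr
        calc ∫⁻ τ, ∫⁻ e, ‖(timeKernel t τ : ℂ) * 𝓕 (slice ε (t - τ) s (Ψ t)) e‖ₑ ^ 2
            = ∫⁻ τ, ‖(timeKernel t τ : ℂ)‖ₑ ^ 2 *
                ∫⁻ e, ‖𝓕 (slice ε (t - τ) s (Ψ t)) e‖ₑ ^ 2 := by
              refine lintegral_congr fun τ => ?_
              simp_rw [enorm_mul, mul_pow]
              exact lintegral_const_mul _ ((h.measurable_fourier_slice ε measurable_const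
                measurable_const measurable_const measurable_id).enorm.pow_const 2)
          _ ≤ ∫⁻ τ, ‖(timeKernel t τ : ℂ)‖ₑ ^ 2 * profileNorm (Ψ t) ^ 2 := by
              gcongr with τ
              exact h.lintegral_fourier_slice_sq_le ε (t - τ) s t
          _ = _ := by
              rw [lintegral_mul_const, lintegral_timeKernel_sq, profileNorm,
                ENNReal.rpow_half_sq]
              exact (Complex.measurable_ofReal.comp (measurable_timeKernel.comp
                measurable_prodMk_left)).enorm.pow_const 2

theorem bound_profileNorm (h : RapidDecay Ψ) : ∃ C : ℝ, 0 ≤ C ∧ ∀ t,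
    profileNorm (Ψ t) ≤ ENNReal.ofReal (C * decay 3 t) := by
  obtain ⟨C, hC, hb⟩ := h.bound_evolved
  have hi : Integrable (decay 2 : ℝ → ℝ) := integrable_decay volume (by simp)
  have hi' : Integrable (decay (Module.finrank ℝ E + 1) : E → ℝ) :=
    integrable_decay volume (Nat.lt_succ_self _)
  set A := ∫ ρ : ℝ, decay 2 ρ
  set B := ∫ η : E, decay (Module.finrank ℝ E + 1) η
  have hA : 0 ≤ A := integral_nonneg fun _ => decay_nonneg _ _
  have hB : 0 ≤ B := integral_nonneg fun _ => decay_nonneg _ _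
  -- `A` comes from the `L¹` norm in `ρ` and `√B` from the `L²` norm in `η`, the square of the
  -- transverse decay being bounded by the decay itself.
  refine ⟨C * A * √B, by positivity, fun t => ?_⟩
  have h3 := decay_nonneg 3 t
  have h1 : ∀ η : E, ∫⁻ ρ, ‖evolved 0 0 (Ψ t) ρ η‖ₑ ≤
      ENNReal.ofReal (C * A * decay 3 t * decay (Module.finrank ℝ E + 1) η) := fun η => by
    have hη := decay_nonneg (Module.finrank ℝ E + 1) η
    calc ∫⁻ ρ, ‖evolved 0 0 (Ψ t) ρ η‖ₑ
        ≤ ∫⁻ ρ : ℝ, ENNReal.ofReal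
          ((C * decay 3 t * decay (Module.finrank ℝ E + 1) η) * decay 2 ρ) := by
          gcongr with ρ
          rw [← ofReal_norm]
          refine ENNReal.ofReal_le_ofReal ((hb 0 0 t ρ η).trans_eq ?_)
          ring
      _ = _ := by
          rw [← ofReal_integral_eq_lintegral_ofReal (hi.const_mul _)
            (ae_of_all _ fun ρ => mul_nonneg (by positivity) (decay_nonneg _ _)),
            integral_const_mul]
          congr 1; ring
  rw [profileNorm, ← ENNReal.sq_rpow_half (ENNReal.ofReal _)]
  gcongr
  calc ∫⁻ η, (∫⁻ ρ, ‖evolved 0 0 (Ψ t) ρ η‖ₑ) ^ 2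
      ≤ ∫⁻ η : E, ENNReal.ofReal
          ((C * A * decay 3 t) ^ 2 * decay (Module.finrank ℝ E + 1) η) := by
        gcongr with η
        have hη := decay_nonneg (Module.finrank ℝ E + 1) η
        refine (pow_le_pow_left' (h1 η) 2).trans ?_
        rw [← ENNReal.ofReal_pow (by positivity)]
        refine ENNReal.ofReal_le_ofReal ?_
        rw [mul_pow]
        gcongr
        rw [pow_two]
        exact mul_le_of_le_one_left hη (decay_le_one _ _)
    _ = _ := by
        rw [← ofReal_integral_eq_lintegral_ofReal (hi'.const_mul _)
          (ae_of_all _ fun η => mul_nonneg (by positivity) (decay_nonneg _ _)),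
          integral_const_mul, ← ENNReal.ofReal_pow (by positivity)]
        congr 1
        change _ * B = _
        linear_combination -(C * A * decay 3 t) ^ 2 * Real.sq_sqrt hB

end RapidDecay
end

/-! ### The adjoint wave and the estimate in dual form -/

noncomputable section
open FourierTransform Filter Topology

variable {E : Type*} [NormedAddCommGroup E] [InnerProductSpace ℝ E] [FiniteDimensional ℝ E]
  [MeasurableSpace E] [BorelSpace E]

/-- Of the three powers of decay in time, one absorbs the growth `|t|^{1/2}` of the crude bound, and
two remain for integrability. -/
theorem sqrt_abs_mul_decay_le (t : ℝ) :
    ENNReal.ofReal |t| ^ (1 / 2 : ℝ) * ENNReal.ofReal (decay 3 t) ≤ ENNReal.ofReal (decay 2 t) := by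
  have h : ENNReal.ofReal |t| ^ (1 / 2 : ℝ) ≤ ENNReal.ofReal (1 + |t|) := by
    rw [ENNReal.ofReal_rpow_of_nonneg (abs_nonneg t) (by norm_num)]
    refine ENNReal.ofReal_le_ofReal ?_
    rw [← Real.sqrt_eq_rpow]
    have h0 := abs_nonneg t
    exact Real.sqrt_le_iff.2 ⟨by positivity, by nlinarith⟩
  calc _ ≤ ENNReal.ofReal (1 + |t|) * ENNReal.ofReal (decay 3 t) := by gcongr
    _ = ENNReal.ofReal (decay 2 t) := by
      rw [← ENNReal.ofReal_mul (by positivity)]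
      congr 1
      have : (1 + |t|) ≠ 0 := by positivity
      simp only [decay, Real.norm_eq_abs]
      field_simp

namespace RapidDecay

variable {Ψ : ℝ → ℝ → E → ℂ} {g : ℝ → ℝ → E → ℂ}

theorem integrable_pairing_integrand (h : RapidDecay Ψ)
    (hg : Measurable fun z : ℝ × ℝ × E => g z.1 z.2.1 z.2.2)
    (hN : ∫⁻ s, sliceNorm (fun τ => g τ s) ≠ ⊤) (ε t : ℝ) :
    Integrable fun z : ℝ × ℝ × E => (timeKernel t z.1 : ℂ) *
      (g z.1 z.2.1 z.2.2 * 𝓕 (slice ε (t - z.1) z.2.1 (Ψ t)) z.2.2) := by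
  refine ⟨((h.measurable_pairing_integrand hg ε).comp
    (measurable_prodMk_left (x := t) (β := ℝ × ℝ × E))).aestronglyMeasurable, ?_⟩
  refine (h.lintegral_pairing_integrand_le hg ε t).trans_lt ?_
  obtain ⟨C, hC, hb⟩ := h.bound_profileNorm
  refine ENNReal.mul_lt_top hN.lt_top (ENNReal.mul_lt_top ?_
    ((hb t).trans_lt ENNReal.ofReal_lt_top))
  exact ENNReal.rpow_lt_top_of_nonneg (by norm_num) ENNReal.ofReal_ne_top

theorem integrable_pairing_integrand_prod (h : RapidDecay Ψ)
    (hg : Measurable fun z : ℝ × ℝ × E => g z.1 z.2.1 z.2.2)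
    (hN : ∫⁻ s, sliceNorm (fun τ => g τ s) ≠ ⊤) (ε : ℝ) :
    Integrable (fun p : ℝ × ℝ × ℝ × E => (timeKernel p.1 p.2.1 : ℂ) *
      (g p.2.1 p.2.2.1 p.2.2.2 * 𝓕 (slice ε (p.1 - p.2.1) p.2.2.1 (Ψ p.1)) p.2.2.2))
      (volume.prod volume) := by
  have hm := h.measurable_pairing_integrand hg ε
  refine ⟨hm.aestronglyMeasurable, ?_⟩
  obtain ⟨C, hC, hb⟩ := h.bound_profileNorm
  rw [hasFiniteIntegral_iff_enorm, lintegral_prod _ hm.enorm.aemeasurable]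
  calc _ ≤ ∫⁻ t : ℝ, (∫⁻ s, sliceNorm fun τ => g τ s) *
        (ENNReal.ofReal C * ENNReal.ofReal (decay 2 t)) := by
        refine lintegral_mono fun t => (h.lintegral_pairing_integrand_le hg ε t).trans ?_
        refine mul_le_mul_right ?_ _
        calc ENNReal.ofReal |t| ^ (1 / 2 : ℝ) * profileNorm (Ψ t)
            ≤ ENNReal.ofReal |t| ^ (1 / 2 : ℝ) * ENNReal.ofReal (C * decay 3 t) := by
              gcongr; exact hb t
          _ = ENNReal.ofReal C *
              (ENNReal.ofReal |t| ^ (1 / 2 : ℝ) * ENNReal.ofReal (decay 3 t)) := by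
              rw [ENNReal.ofReal_mul hC]; ring
          _ ≤ _ := by gcongr; exact sqrt_abs_mul_decay_le t
    _ < ⊤ := by
        rw [lintegral_const_mul' _ _ hN, lintegral_const_mul' _ _ ENNReal.ofReal_ne_top]
        refine ENNReal.mul_lt_top hN.lt_top (ENNReal.mul_lt_top ENNReal.ofReal_lt_top ?_)
        have hi : Integrable (decay 2 : ℝ → ℝ) := integrable_decay volume (by simp)
        exact hi.lintegral_lt_top

theorem enorm_duhamelPairing_le (h : RapidDecay Ψ)
    (hg : Measurable fun z : ℝ × ℝ × E => g z.1 z.2.1 z.2.2) (ε t : ℝ) :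
    ‖duhamelPairing ε g t (Ψ t)‖ₑ ≤ (∫⁻ s, sliceNorm fun τ => g τ s) *
      (ENNReal.ofReal |t| ^ (1 / 2 : ℝ) * profileNorm (Ψ t)) :=
  (enorm_integral_le_lintegral_enorm _).trans (h.lintegral_pairing_integrand_le hg ε t)

theorem duhamelPairing_eq (h : RapidDecay Ψ)
    (hg : Measurable fun z : ℝ × ℝ × E => g z.1 z.2.1 z.2.2)
    (hN : ∫⁻ s, sliceNorm (fun τ => g τ s) ≠ ⊤) (ε t : ℝ) :
    duhamelPairing ε g t (Ψ t) = ∫ τ in (0 : ℝ)..t, ∫ p : ℝ × E,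
      g τ p.1 p.2 * 𝓕 (slice ε (t - τ) p.1 (Ψ t)) p.2 := by
  rw [duhamelPairing, Measure.volume_eq_prod,
    integral_prod _ (h.integrable_pairing_integrand hg hN ε t), ← integral_timeKernel_mul]
  simp_rw [integral_const_mul]

theorem integrable_duhamelPairing (h : RapidDecay Ψ)
    (hg : Measurable fun z : ℝ × ℝ × E => g z.1 z.2.1 z.2.2)
    (hN : ∫⁻ s, sliceNorm (fun τ => g τ s) ≠ ⊤) (ε : ℝ) :
    Integrable fun t => duhamelPairing ε g t (Ψ t) :=
  (h.integrable_pairing_integrand_prod hg hN ε).integral_prod_left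

/-- The adjoint of the Duhamel operator. -/
def adjointWave (ε : ℝ) (Ψ : ℝ → ℝ → E → ℂ) (τ s : ℝ) (y : E) : ℂ :=
  if 0 < τ then duhamelWave (forwardWeight 0) ε Ψ τ s y
  else -duhamelWave (backwardWeight 0) ε Ψ τ s y

theorem integral_timeKernel_mul_fourier_slice (ε : ℝ) (τ s : ℝ) (y : E) :
    ∫ t, (timeKernel t τ : ℂ) * 𝓕 (slice ε (t - τ) s (Ψ t)) y = adjointWave ε Ψ τ s y := by
  unfold adjointWave duhamelWave timeKernel
  split_ifs
  · rfl
  · rw [← integral_neg]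
    refine integral_congr_ae (ae_of_all _ fun t => ?_)
    simp only
    push_cast
    ring

theorem measurable_adjointWave (h : RapidDecay Ψ) (ε : ℝ) :
    Measurable fun z : ℝ × ℝ × E => adjointWave ε Ψ z.1 z.2.1 z.2.2 := by
  unfold adjointWave
  refine Measurable.ite (measurableSet_lt measurable_const measurable_fst) ?_ ?_
  · exact h.measurable_duhamelWave (measurable_forwardWeight 0) ε measurable_fst
      (measurable_fst.comp measurable_snd) (measurable_snd.comp measurable_snd)
  · exact (h.measurable_duhamelWave (measurable_backwardWeight 0) ε measurable_fst
      (measurable_fst.comp measurable_snd) (measurable_snd.comp measurable_snd)).neg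

theorem sliceNorm_adjointWave_le (h : RapidDecay Ψ) {ε : ℝ} (hε : 0 ≤ ε) (s : ℝ) :
    sliceNorm (fun τ => adjointWave ε Ψ τ s) ≤ 26 * ∫⁻ r, sliceNorm fun t => wave Ψ t r := by
  set B := ∫⁻ r, sliceNorm fun t => wave Ψ t r
  have h1 := h.sliceNorm_forward_le hε s
  have h2 := h.sliceNorm_backward_le hε s
  have hsq : sliceNorm (fun τ => adjointWave ε Ψ τ s) ^ 2 ≤ (26 * B) ^ 2 := by
    have hm : Measurable fun z : ℝ × E => duhamelWave (forwardWeight 0) ε Ψ z.1 s z.2 :=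
      h.measurable_duhamelWave (measurable_forwardWeight 0) ε measurable_fst measurable_const
        measurable_snd
    -- At each `τ` the adjoint is one of the two one-sided waves up to sign, so the squares add; `2
    -- · 13² = 338` is rounded up to `26²`.
    calc sliceNorm (fun τ => adjointWave ε Ψ τ s) ^ 2
        ≤ ∫⁻ τ, ((∫⁻ y, ‖duhamelWave (forwardWeight 0) ε Ψ τ s y‖ₑ ^ 2) +
            ∫⁻ y, ‖duhamelWave (backwardWeight 0) ε Ψ τ s y‖ₑ ^ 2) := by
          rw [sliceNorm_sq]
          refine lintegral_mono fun τ => ?_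
          by_cases hτ : 0 < τ
          · simp only [adjointWave, hτ, if_true]
            exact le_self_add
          · simp only [adjointWave, hτ, if_false, enorm_neg]
            exact le_add_self
      _ = sliceNorm (fun τ => duhamelWave (forwardWeight 0) ε Ψ τ s) ^ 2 +
            sliceNorm (fun τ => duhamelWave (backwardWeight 0) ε Ψ τ s) ^ 2 := by
          rw [sliceNorm_sq, sliceNorm_sq, lintegral_add_left]
          exact (hm.enorm.pow_const 2).lintegral_prod_right'
      _ ≤ (13 * B) ^ 2 + (13 * B) ^ 2 := by gcongr
      _ = 338 * B ^ 2 := by ring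
      _ ≤ 676 * B ^ 2 := by gcongr; norm_num
      _ = (26 * B) ^ 2 := by ring
  have := ENNReal.rpow_le_rpow hsq (show (0 : ℝ) ≤ 1 / 2 by norm_num)
  rwa [ENNReal.sq_rpow_half, ENNReal.sq_rpow_half] at this

/-- The inhomogeneous local smoothing estimate in dual form. -/
theorem enorm_integral_duhamelPairing_le (h : RapidDecay Ψ)
    (hg : Measurable fun z : ℝ × ℝ × E => g z.1 z.2.1 z.2.2)
    (hN : ∫⁻ s, sliceNorm (fun τ => g τ s) ≠ ⊤) {ε : ℝ} (hε : 0 ≤ ε) :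
    ‖∫ t, duhamelPairing ε g t (Ψ t)‖ₑ ≤ 26 * (∫⁻ s, sliceNorm fun τ => g τ s) *
      ∫⁻ r, sliceNorm fun t => wave Ψ t r := by
  -- Fubini moves the time kernel and the evolution from `g` onto the test profile.
  have hswap : ∫ t, duhamelPairing ε g t (Ψ t) =
      ∫ z : ℝ × ℝ × E, g z.1 z.2.1 z.2.2 * adjointWave ε Ψ z.1 z.2.1 z.2.2 := by
    unfold duhamelPairing
    rw [integral_integral_swap (h.integrable_pairing_integrand_prod hg hN ε)]
    refine integral_congr_ae (ae_of_all _ fun z => ?_)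
    simp only
    rw [← integral_timeKernel_mul_fourier_slice, ← integral_const_mul]
    refine integral_congr_ae (ae_of_all _ fun t => ?_)
    simp only
    ring
  have hW := h.measurable_adjointWave ε
  rw [hswap]
  refine (enorm_integral_le_lintegral_enorm _).trans ?_
  simp_rw [enorm_mul]
  rw [lintegral_triple (F := fun τ s e => ‖g τ s e‖ₑ * ‖adjointWave ε Ψ τ s e‖ₑ)
    (hg.enorm.mul hW.enorm)]
  -- Cauchy–Schwarz in `(τ, y)` at fixed `s`, then the bound on the adjoint, which is uniform in
  -- `s`.
  calc _ ≤ ∫⁻ s, sliceNorm (fun τ => g τ s) * (26 * ∫⁻ r, sliceNorm fun t => wave Ψ t r) := by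
        refine lintegral_mono fun s => ?_
        have hp : Measurable fun p : ℝ × E => (p.1, s, p.2) := by fun_prop
        refine (lintegral_mul_le_sliceNorm (f := fun τ e => g τ s e)
          (g := fun τ e => adjointWave ε Ψ τ s e) (hg.comp hp) (hW.comp hp)).trans ?_
        gcongr
        exact h.sliceNorm_adjointWave_le hε s
    _ = _ := by
        rw [lintegral_mul_const _ (measurable_sliceNorm hg)]
        ring

end RapidDecay
end

/-! ### Fourier multipliers on tempered distributions -/

noncomputable section
open FourierTransform Filter Topology TemperedDistribution

variable {n : ℕ}

theorem hasTemperateGrowth_cexp_I_mul :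
    Function.HasTemperateGrowth fun x : ℝ => Complex.exp (Complex.I * x) := by
  refine ⟨(contDiff_const.mul Complex.ofRealCLM.contDiff).cexp, fun m => ⟨0, 1, fun x => ?_⟩⟩
  have h : iteratedDeriv m (fun x : ℝ => Complex.exp (Complex.I * x)) =
      fun x : ℝ => Complex.I ^ m * Complex.exp (Complex.I * x) := by
    induction m with
    | zero => simp
    | succ m ih =>
      rw [iteratedDeriv_succ, ih]
      ext x
      have h1 : HasDerivAt (fun y : ℝ => Complex.I * (y : ℂ)) (Complex.I * 1) x :=
        (Complex.ofRealCLM.hasDerivAt (x := x)).const_mul Complex.I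
      have h2 := (h1.cexp.const_mul (Complex.I ^ m)).deriv
      rw [h2]
      ring
  rw [norm_iteratedFDeriv_eq_norm_iteratedDeriv, h]
  simp [Complex.norm_exp]

/-- The symbol of `∂_i`. -/
def partialSymbol (i : Fin n) (ξ : EuclideanSpace ℝ (Fin n)) : ℂ :=
  2 * Real.pi * Complex.I * (ξ i : ℂ)

/-- The symbol of the propagator, for Mathlib's normalization of the Fourier transform. -/
def propagatorSymbol (ε q : ℝ) (ξ : EuclideanSpace ℝ (Fin n)) : ℂ :=
  Complex.exp (Complex.I * ((q * (‖(2 * Real.pi) • ξ‖ ^ 4 + ε * ‖(2 * Real.pi) • ξ‖ ^ 2) : ℝ) : ℂ))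

theorem hasTemperateGrowth_propagatorSymbol (ε q : ℝ) :
    (propagatorSymbol ε q : EuclideanSpace ℝ (Fin n) → ℂ).HasTemperateGrowth := by
  have h : Function.HasTemperateGrowth fun ξ : EuclideanSpace ℝ (Fin n) =>
      q * (16 * Real.pi ^ 4 * (‖ξ‖ ^ 2 * ‖ξ‖ ^ 2) + ε * (4 * Real.pi ^ 2) * ‖ξ‖ ^ 2) := by
    have h2  := Function.hasTemperateGrowth_norm_sq (H := EuclideanSpace ℝ (Fin n))
    exact (Function.HasTemperateGrowth.const q).mul
      (((Function.HasTemperateGrowth.const _).mul (h2.mul h2)).add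
        ((Function.HasTemperateGrowth.const _).mul h2))
  convert hasTemperateGrowth_cexp_I_mul.comp h using 1
  ext ξ
  simp only [propagatorSymbol, Function.comp, norm_smul, Real.norm_eq_abs,
    abs_of_pos Real.two_pi_pos]
  congr 3
  ring

theorem hasTemperateGrowth_coord (i : Fin n) :
    Function.HasTemperateGrowth fun ξ : EuclideanSpace ℝ (Fin n) => (ξ i : ℂ) :=
  (Complex.ofRealCLM.comp (EuclideanSpace.proj i : EuclideanSpace ℝ (Fin n) →L[ℝ] ℝ)).hasTemperateGrowth

theorem hasTemperateGrowth_partialSymbol (i : Fin n) :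
    (partialSymbol i).HasTemperateGrowth :=
  (Function.HasTemperateGrowth.const _).mul (hasTemperateGrowth_coord i)

/-- The symbol of `S(q) ∂_i³`. -/
def evolutionSymbol (i : Fin n) (ε q : ℝ) : EuclideanSpace ℝ (Fin n) → ℂ :=
  partialSymbol i * partialSymbol i * partialSymbol i * propagatorSymbol ε q

theorem hasTemperateGrowth_evolutionSymbol (i : Fin n) (ε q : ℝ) :
    (evolutionSymbol i ε q).HasTemperateGrowth :=
  (((hasTemperateGrowth_partialSymbol i).mul (hasTemperateGrowth_partialSymbol i)).mul
    (hasTemperateGrowth_partialSymbol i)).mul (hasTemperateGrowth_propagatorSymbol ε q)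

theorem lineDeriv_single_eq (i : Fin n) (v : 𝓢'(EuclideanSpace ℝ (Fin n), ℂ)) :
    ∂_{EuclideanSpace.single i (1 : ℝ)} v = fourierMultiplierCLM ℂ (partialSymbol i) v := by
  rw [lineDeriv_eq_fourierMultiplierCLM]
  have h := hasTemperateGrowth_coord i
  have h1 := fourierMultiplierCLM_smul (F := ℂ) h (2 * Real.pi * Complex.I)
  have h2 : partialSymbol i = (2 * Real.pi * Complex.I) • fun ξ : EuclideanSpace ℝ (Fin n) => (ξ i : ℂ) := by
    ext ξ; simp [partialSymbol]
  rw [h2, h1, _root_.smul_apply]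
  congr 3
  ext x
  simp [EuclideanSpace.inner_single_right]

theorem partialCubed_eq (i : Fin n) (v : 𝓢'(EuclideanSpace ℝ (Fin n), ℂ)) :
    partialCubed i v =
      fourierMultiplierCLM ℂ (partialSymbol i * partialSymbol i * partialSymbol i) v := by
  have h := hasTemperateGrowth_partialSymbol i
  rw [partialCubed, lineDeriv_single_eq, lineDeriv_single_eq, lineDeriv_single_eq,
    fourierMultiplierCLM_fourierMultiplierCLM_apply h h,
    fourierMultiplierCLM_fourierMultiplierCLM_apply h (h.mul h), mul_assoc]

theorem hasTemperateGrowth_box {σ : (Fin n → ℤ) → EuclideanSpace ℝ (Fin n) → ℝ}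
    (hσ : IsUniformDecomposition σ) (k : Fin n → ℤ) :
    Function.HasTemperateGrowth fun ξ => (σ k ((2 * Real.pi) • ξ) : ℂ) := by
  have hc : HasCompactSupport (σ k) :=
    (isCompact_closedBall _ _).of_isClosed_subset (isClosed_tsupport _) (hσ.support_subset k)
  have h1 : Function.HasTemperateGrowth (σ k) := hc.hasTemperateGrowth (hσ.smooth k)
  have h2 : Function.HasTemperateGrowth fun ξ : EuclideanSpace ℝ (Fin n) => (2 * Real.pi) • ξ :=
    ((2 * Real.pi) • ContinuousLinearMap.id ℝ (EuclideanSpace ℝ (Fin n))).hasTemperateGrowth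
  exact Complex.ofRealCLM.hasTemperateGrowth.comp (h1.comp h2)

/-- The multiplier `S(q) ∂_i³` on test functions, transposed. -/
def evolveTest (i : Fin n) (ε q : ℝ) (φ : 𝓢(EuclideanSpace ℝ (Fin n), ℂ)) :
    𝓢(EuclideanSpace ℝ (Fin n), ℂ) :=
  𝓕 (SchwartzMap.smulLeftCLM ℂ (evolutionSymbol i ε q) (𝓕⁻ φ))

/-- The weak time integral is applied to the test function on which the box and the derivatives
already act by transposition. Since multipliers commute, the box can then be returned to `f τ` under
the integral, which leaves the evolution and the derivatives on the test function. -/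
theorem boxOp_partialCubed_duhamel {σ : (Fin n → ℤ) → EuclideanSpace ℝ (Fin n) → ℝ}
    (hσ : IsUniformDecomposition σ) (k : Fin n → ℤ) (i : Fin n) {ε : ℝ}
    {f u : ℝ → 𝓢'(EuclideanSpace ℝ (Fin n), ℂ)} (hu : IsDuhamel ε f u) (t : ℝ)
    (φ : 𝓢(EuclideanSpace ℝ (Fin n), ℂ)) :
    boxOp σ k (partialCubed i (u t)) φ =
      ∫ τ in (0 : ℝ)..t, boxOp σ k (f τ) (evolveTest i ε (t - τ) φ) := by
  have hb := hasTemperateGrowth_box hσ k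
  have hp := hasTemperateGrowth_partialSymbol i
  have hc := (hp.mul hp).mul hp
  rw [partialCubed_eq, boxOp, freqMultiplier, fourierMultiplierCLM_fourierMultiplierCLM_apply hc hb,
    fourierMultiplierCLM_apply_apply, (hu t _).2]
  refine intervalIntegral.integral_congr fun τ _ => ?_
  simp only
  have hs := hasTemperateGrowth_propagatorSymbol (n := n) ε (t - τ)
  have he := hasTemperateGrowth_evolutionSymbol i ε (t - τ)
  rw [evolveTest, ← fourierMultiplierCLM_apply_apply, ← fourierMultiplierCLM_apply_apply,
    fourierMultiplierCLM_fourierMultiplierCLM_apply hb he]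
  change (fourierMultiplierCLM ℂ _) ((fourierMultiplierCLM ℂ (propagatorSymbol ε (t - τ))) (f τ)) φ = _
  rw [fourierMultiplierCLM_fourierMultiplierCLM_apply hs (hc.mul hb)]
  congr 3
  ext ξ
  simp only [evolutionSymbol, Pi.mul_apply]
  ring

end

/-! ### Separating the distinguished coordinate -/

noncomputable section
open FourierTransform Filter Topology

variable {n : ℕ}

/-- The space of the variables transverse to the `i`-th one. -/
abbrev Transverse (i : Fin n) := EuclideanSpace ℝ {j : Fin n // j ≠ i}

/-- The point with `i`-th coordinate `s` and transverse coordinates `e`. -/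
def glue (i : Fin n) (s : ℝ) (e : Transverse i) : EuclideanSpace ℝ (Fin n) := assemble i s e.ofLp

theorem glue_self (i : Fin n) (s : ℝ) (e : Transverse i) : glue i s e i = s := by
  simp [glue, assemble]

theorem glue_ne (i : Fin n) (s : ℝ) (e : Transverse i) (j : {j : Fin n // j ≠ i}) :
    glue i s e j = e j := by
  simp [glue, assemble, j.2]

theorem inner_glue (i : Fin n) (s r : ℝ) (e f : Transverse i) :
    inner ℝ (glue i s e) (glue i r f) = s * r + inner ℝ e f := by
  rw [PiLp.inner_apply, Fintype.sum_eq_add_sum_subtype_ne _ i, PiLp.inner_apply]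
  simp only [glue_self, glue_ne]
  congr 1
  simp [mul_comm]

theorem norm_glue_sq (i : Fin n) (s : ℝ) (e : Transverse i) :
    ‖glue i s e‖ ^ 2 = s ^ 2 + ‖e‖ ^ 2 := by
  rw [← real_inner_self_eq_norm_sq, inner_glue, real_inner_self_eq_norm_sq]
  ring

theorem continuous_glue (i : Fin n) : Continuous fun p : ℝ × Transverse i => glue i p.1 p.2 := by
  unfold glue assemble
  refine (PiLp.continuous_toLp 2 _).comp (continuous_pi fun j => ?_)
  by_cases h : j = i
  · simp only [h, dif_pos]; exact continuous_fst
  · simp only [h, dif_neg, not_false_eq_true]; fun_prop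

theorem measurable_glue (i : Fin n) {α : Type*} [MeasurableSpace α] {s : α → ℝ}
    {e : α → Transverse i} (hs : Measurable s) (he : Measurable e) :
    Measurable fun a => glue i (s a) (e a) := by
  have h := (continuous_glue i).measurable.comp (hs.prodMk he)
  exact h

/-- `glue` as a measurable equivalence. -/
def glueEquiv (i : Fin n) : ℝ × Transverse i ≃ᵐ EuclideanSpace ℝ (Fin n) :=
  ((MeasurableEquiv.prodCongr (MeasurableEquiv.funUnique {j : Fin n // j = i} ℝ).symm
    (MeasurableEquiv.toLp 2 ({j : Fin n // j ≠ i} → ℝ)).symm).trans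
    (MeasurableEquiv.piEquivPiSubtypeProd (fun _ : Fin n => ℝ) (· = i)).symm).trans
    (MeasurableEquiv.toLp 2 (Fin n → ℝ))

theorem glueEquiv_apply (i : Fin n) (p : ℝ × Transverse i) : glueEquiv i p = glue i p.1 p.2 := by
  ext j
  by_cases h : j = i
  · subst h
    simp [glueEquiv, glue, assemble, MeasurableEquiv.piEquivPiSubtypeProd, MeasurableEquiv.prodCongr,
      Equiv.piEquivPiSubtypeProd]
  · simp [glueEquiv, glue, assemble, h, MeasurableEquiv.piEquivPiSubtypeProd, MeasurableEquiv.prodCongr,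
      Equiv.piEquivPiSubtypeProd]

theorem measurePreserving_glueEquiv (i : Fin n) :
    MeasurePreserving (glueEquiv i) (volume : Measure (ℝ × Transverse i)) volume := by
  have h1 := (volume_preserving_funUnique {j : Fin n // j = i} ℝ).symm
  have h2 := EuclideanSpace.volume_preserving_symm_measurableEquiv_toLp {j : Fin n // j ≠ i}
  have hp : MeasurePreserving (MeasurableEquiv.prodCongr
      (MeasurableEquiv.funUnique {j : Fin n // j = i} ℝ).symm
      (MeasurableEquiv.toLp 2 ({j : Fin n // j ≠ i} → ℝ)).symm) volume volume := h1.prod h2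
  have h3 := (volume_preserving_piEquivPiSubtypeProd (fun _ : Fin n => ℝ) (· = i)).symm
  have h4 := PiLp.volume_preserving_toLp (Fin n)
  refine h4.comp (h3.comp ?_)
  convert hp
  all_goals rfl

theorem lintegral_glue (i : Fin n) (F : EuclideanSpace ℝ (Fin n) → ℝ≥0∞) :
    ∫⁻ x, F x = ∫⁻ p : ℝ × Transverse i, F (glue i p.1 p.2) := by
  rw [← (measurePreserving_glueEquiv i).lintegral_comp_emb (glueEquiv i).measurableEmbedding]
  simp_rw [glueEquiv_apply]

theorem integral_glue (i : Fin n) (F : EuclideanSpace ℝ (Fin n) → ℂ) :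
    ∫ x, F x = ∫ p : ℝ × Transverse i, F (glue i p.1 p.2) := by
  rw [← (measurePreserving_glueEquiv i).integral_comp (glueEquiv i).measurableEmbedding]
  simp_rw [glueEquiv_apply]

theorem integrable_glue (i : Fin n) {F : EuclideanSpace ℝ (Fin n) → ℂ} (hF : Integrable F) :
    Integrable fun p : ℝ × Transverse i => F (glue i p.1 p.2) := by
  have h := (measurePreserving_glueEquiv i).integrable_comp_of_integrable hF
  refine h.congr (ae_of_all _ fun p => ?_)
  simp [glueEquiv_apply]

/-- A function on `ℝⁿ` in the coordinates of `glue`. -/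
def profile (i : Fin n) (ψ : EuclideanSpace ℝ (Fin n) → ℂ) (ρ : ℝ) (η : Transverse i) : ℂ :=
  ψ (glue i ρ η)

theorem fourier_glue (i : Fin n) {ψ : EuclideanSpace ℝ (Fin n) → ℂ} (hψ : Integrable ψ) (s : ℝ)
    (e : Transverse i) :
    𝓕 ψ (glue i s e) = 𝓕 (fun η => 𝓕 (fun ρ => profile i ψ ρ η) s) e := by
  have h : Integrable fun p : ℝ × Transverse i =>
      Real.fourierChar (-inner ℝ (glue i p.1 p.2) (glue i s e)) • ψ (glue i p.1 p.2) := by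
    have h0 := integrable_glue i ((Real.fourierIntegral_convergent_iff (glue i s e)).2 hψ)
    exact h0
  rw [Real.fourier_eq, integral_glue i, Measure.volume_eq_prod, integral_prod_symm _ h,
    Real.fourier_eq]
  refine integral_congr_ae (ae_of_all _ fun η => ?_)
  simp only [Real.fourier_real_eq]
  rw [Circle.smul_def, ← integral_smul]
  refine integral_congr_ae (ae_of_all _ fun ρ => ?_)
  simp only [inner_glue, profile]
  rw [← Circle.smul_def, smul_smul, ← AddChar.map_add_eq_mul, neg_add, add_comm]

/-- The factor `-i` is `i³`, from the three derivatives; the rest is `|ξ|² = (2πρ)² + (2π|η|)²`. -/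
theorem evolutionSymbol_glue (i : Fin n) (ε q ρ : ℝ) (η : Transverse i)
    (ψ : EuclideanSpace ℝ (Fin n) → ℂ) :
    evolutionSymbol i ε q (glue i ρ η) * ψ (glue i ρ η) =
      -Complex.I * evolved ε q (profile i ψ) ρ η := by
  have h : ‖(2 * Real.pi) • glue i ρ η‖ ^ 2 = (2 * Real.pi) ^ 2 * (ρ ^ 2 + ‖η‖ ^ 2) := by
    rw [norm_smul, mul_pow, norm_glue_sq, Real.norm_eq_abs, sq_abs]
  have h4 : ‖(2 * Real.pi) • glue i ρ η‖ ^ 4 = ((2 * Real.pi) ^ 2 * (ρ ^ 2 + ‖η‖ ^ 2)) ^ 2 := by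
    rw [← h]; ring
  simp only [evolutionSymbol, Pi.mul_apply, partialSymbol, propagatorSymbol, glue_self, h, h4]
  have hI : Complex.I ^ 3 = -Complex.I := by rw [pow_succ, Complex.I_sq]; ring
  have hq : q * (((2 * Real.pi) ^ 2 * (ρ ^ 2 + ‖η‖ ^ 2)) ^ 2 +
      ε * ((2 * Real.pi) ^ 2 * (ρ ^ 2 + ‖η‖ ^ 2))) = q * phase ε ρ η := by unfold phase; ring
  rw [hq, evolved, profile, ← hI]
  ring

theorem evolveTest_glue (i : Fin n) (ε q : ℝ) (φ : 𝓢(EuclideanSpace ℝ (Fin n), ℂ)) (s : ℝ)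
    (e : Transverse i) :
    evolveTest i ε q φ (glue i s e) =
      -Complex.I * 𝓕 (slice ε q s (profile i (𝓕⁻ φ : 𝓢(EuclideanSpace ℝ (Fin n), ℂ)))) e := by
  rw [evolveTest, SchwartzMap.fourier_coe, fourier_glue i (SchwartzMap.integrable _)]
  rw [← fourier_const_mul]
  refine congrFun (congrArg _ (funext fun η => ?_)) e
  unfold slice
  rw [← fourier_const_mul]
  refine congrFun (congrArg _ (funext fun ρ => ?_)) s
  rw [profile, SchwartzMap.smulLeftCLM_apply_apply (hasTemperateGrowth_evolutionSymbol i ε q),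
    smul_eq_mul, evolutionSymbol_glue]

end

/-! ### Mixed norms in separated coordinates and the weight in the distinguished variable -/

noncomputable section
open FourierTransform Filter Topology

variable {n : ℕ}

theorem measurePreserving_sliceCoord (i : Fin n) :
    MeasurePreserving (fun p : ℝ × ({j : Fin n // j ≠ i} → ℝ) × ℝ => (p.2.2, assemble i p.1 p.2.1))
      volume volume := by
  have h1 : MeasurePreserving (MeasurableEquiv.prodAssoc.symm :
      ℝ × ({j : Fin n // j ≠ i} → ℝ) × ℝ ≃ᵐ (ℝ × ({j : Fin n // j ≠ i} → ℝ)) × ℝ) volume volume :=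
    (measurePreserving_prodAssoc volume volume volume).symm
  have h2 : MeasurePreserving (Prod.swap : (ℝ × ({j : Fin n // j ≠ i} → ℝ)) × ℝ → _) volume volume :=
    Measure.measurePreserving_swap
  have h3 : MeasurePreserving (Prod.map (id : ℝ → ℝ)
      (WithLp.toLp 2 : ({j : Fin n // j ≠ i} → ℝ) → Transverse i)) volume volume :=
    (MeasurePreserving.id volume).prod (PiLp.volume_preserving_toLp _)
  have h4 : MeasurePreserving (Prod.map (id : ℝ → ℝ) (glueEquiv i ∘ Prod.map (id : ℝ → ℝ)
      (WithLp.toLp 2 : ({j : Fin n // j ≠ i} → ℝ) → Transverse i))) volume volume :=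
    (MeasurePreserving.id volume).prod ((measurePreserving_glueEquiv i).comp h3)
  convert h4.comp (h2.comp h1) using 1
  ext1 p
  simp [glueEquiv_apply, glue, MeasurableEquiv.prodAssoc]

theorem mixedNorm_congr_ae (i : Fin n) (p q : ℝ≥0∞) {F G : ℝ → EuclideanSpace ℝ (Fin n) → ℂ}
    (h : (fun z : ℝ × EuclideanSpace ℝ (Fin n) => F z.1 z.2) =ᵐ[volume] fun z => G z.1 z.2) :
    mixedNorm i p q F = mixedNorm i p q G := by
  have h1 := (measurePreserving_sliceCoord i).quasiMeasurePreserving.ae_eq h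
  have h2 := Measure.ae_ae_of_ae_prod h1
  refine eLpNorm_congr_ae ?_
  filter_upwards [h2] with s hs
  exact eLpNorm_congr_ae hs

/-- Links the norm of the statement, with transverse variables in a plain function space, to the
iterated integral over time and a Euclidean space used in the Fourier analysis. -/
theorem eLpNorm_two_eq_sliceNorm (i : Fin n) {G : ℝ → EuclideanSpace ℝ (Fin n) → ℂ}
    (hG : Measurable fun z : ℝ × EuclideanSpace ℝ (Fin n) => G z.1 z.2) (s : ℝ) :
    eLpNorm (fun z : ({j : Fin n // j ≠ i} → ℝ) × ℝ => G z.2 (assemble i s z.1)) 2 volume =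
      sliceNorm fun t (e : Transverse i) => G t (glue i s e) := by
  have h1 : MeasurePreserving (fun z : ({j : Fin n // j ≠ i} → ℝ) × ℝ =>
      (z.2, (WithLp.toLp 2 z.1 : Transverse i))) volume volume :=
    ((MeasurePreserving.id volume).prod (PiLp.volume_preserving_toLp _)).comp
      Measure.measurePreserving_swap
  have hm : Measurable fun p : ℝ × Transverse i => G p.1 (glue i s p.2) := by
    have h := hG.comp (measurable_fst.prodMk (measurable_glue i measurable_const measurable_snd) :
      Measurable fun p : ℝ × Transverse i => (p.1, glue i s p.2))
    exact h
  have h2 := eLpNorm_comp_measurePreserving (p := 2) hm.aestronglyMeasurable h1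
  have h3 : (fun z : ({j : Fin n // j ≠ i} → ℝ) × ℝ => G z.2 (assemble i s z.1)) =
    (fun p : ℝ × Transverse i => G p.1 (glue i s p.2)) ∘ (fun z : ({j : Fin n // j ≠ i} → ℝ) × ℝ =>
      (z.2, (WithLp.toLp 2 z.1 : Transverse i))) := rfl
  have hm2 : Measurable fun p : ℝ × Transverse i => ‖G p.1 (glue i s p.2)‖ₑ ^ 2 := hm.enorm.pow_const 2
  rw [h3, h2, eLpNorm_eq_lintegral_rpow_enorm_toReal (by norm_num) (by norm_num), sliceNorm,
    ENNReal.toReal_ofNat]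
  simp only [ENNReal.rpow_ofNat]
  rw [Measure.volume_eq_prod, lintegral_prod _ hm2.aemeasurable]

theorem mixedNorm_one_two (i : Fin n) {G : ℝ → EuclideanSpace ℝ (Fin n) → ℂ}
    (hG : Measurable fun z : ℝ × EuclideanSpace ℝ (Fin n) => G z.1 z.2) :
    mixedNorm i 1 2 G = ∫⁻ s, sliceNorm fun t (e : Transverse i) => G t (glue i s e) := by
  rw [mixedNorm, eLpNorm_one_eq_lintegral_enorm]
  simp only [eLpNorm_two_eq_sliceNorm i hG, enorm_eq_self]

theorem mixedNorm_top_two_le (i : Fin n) {G : ℝ → EuclideanSpace ℝ (Fin n) → ℂ}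
    (hG : Measurable fun z : ℝ × EuclideanSpace ℝ (Fin n) => G z.1 z.2) {C : ℝ≥0∞}
    (h : ∀ᵐ s : ℝ, (sliceNorm fun t (e : Transverse i) => G t (glue i s e)) ≤ C) :
    mixedNorm i ⊤ 2 G ≤ C := by
  rw [mixedNorm, eLpNorm_exponent_top, eLpNormEssSup]
  simp only [eLpNorm_two_eq_sliceNorm i hG, enorm_eq_self]
  exact essSup_le_of_ae_le _ h

/-- The weight making `L²` embed into `L¹` in the `i`-th variable. -/
def weight (i : Fin n) (x : EuclideanSpace ℝ (Fin n)) : ℝ := 1 + x i ^ 2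

theorem weight_glue (i : Fin n) (s : ℝ) (e : Transverse i) : weight i (glue i s e) = 1 + s ^ 2 := by
  rw [weight, glue_self]

theorem weight_pos (i : Fin n) (x : EuclideanSpace ℝ (Fin n)) : 0 < weight i x := by
  unfold weight; positivity

theorem continuous_weight (i : Fin n) : Continuous (weight i) := by
  unfold weight; fun_prop

theorem lintegral_inv_one_add_sq_sq_lt_top :
    ∫⁻ s : ℝ, ENNReal.ofReal ((1 + s ^ 2)⁻¹) ^ 2 < ⊤ := by
  refine lt_of_le_of_lt (lintegral_mono fun s => ?_) integrable_inv_one_add_sq.lintegral_lt_top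
  rw [sq]
  refine mul_le_of_le_one_right' ?_
  rw [ENNReal.ofReal_le_one]
  exact inv_le_one_of_one_le₀ (by nlinarith [sq_nonneg s])

theorem sliceNorm_const_mul {α β : Type*} [MeasureSpace α] [MeasureSpace β] (c : ℂ)
    (F : α → β → ℂ) : (sliceNorm fun t y => c * F t y) = ‖c‖ₑ * sliceNorm F := by
  simp only [sliceNorm, enorm_mul, mul_pow]
  have hc : ‖c‖ₑ ^ 2 ≠ ⊤ := by simp
  simp_rw [lintegral_const_mul' _ _ hc]
  rw [ENNReal.mul_rpow_of_nonneg _ _ (by norm_num), ENNReal.sq_rpow_half]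

theorem measurable_comp_glue (i : Fin n) {β : Type*} [MeasurableSpace β]
    {F : ℝ → EuclideanSpace ℝ (Fin n) → β}
    (hF : Measurable fun z : ℝ × EuclideanSpace ℝ (Fin n) => F z.1 z.2) :
    Measurable fun p : ℝ × ℝ × Transverse i => F p.1 (glue i p.2.1 p.2.2) := by
  have h := hF.comp (measurable_fst.prodMk (measurable_glue i
    (measurable_fst.comp measurable_snd) (measurable_snd.comp measurable_snd)) :
    Measurable fun p : ℝ × ℝ × Transverse i => (p.1, glue i p.2.1 p.2.2))
  exact h

theorem lintegral_space_time (i : Fin n) {F : ℝ → EuclideanSpace ℝ (Fin n) → ℝ≥0∞}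
    (hF : Measurable fun z : ℝ × EuclideanSpace ℝ (Fin n) => F z.1 z.2) :
    ∫⁻ z : ℝ × EuclideanSpace ℝ (Fin n), F z.1 z.2 =
      ∫⁻ s, ∫⁻ t, ∫⁻ e : Transverse i, F t (glue i s e) := by
  have hm := measurable_comp_glue i hF
  have h3 := lintegral_triple (F := fun t s (e : Transverse i) => F t (glue i s e)) hm
  rw [← h3, Measure.volume_eq_prod, lintegral_prod _ hF.aemeasurable, Measure.volume_eq_prod,
    lintegral_prod _ hm.aemeasurable]
  simp only [lintegral_glue i]

theorem lintegral_sq_space_time (i : Fin n) {F : ℝ → EuclideanSpace ℝ (Fin n) → ℂ}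
    (hF : Measurable fun z : ℝ × EuclideanSpace ℝ (Fin n) => F z.1 z.2) :
    ∫⁻ z : ℝ × EuclideanSpace ℝ (Fin n), ‖F z.1 z.2‖ₑ ^ 2 =
      ∫⁻ s, (sliceNorm fun t (e : Transverse i) => F t (glue i s e)) ^ 2 := by
  simp only [sliceNorm_sq]
  exact lintegral_space_time i (F := fun t x => ‖F t x‖ₑ ^ 2) (hF.enorm.pow_const 2)

theorem measurable_sliceNorm_glue (i : Fin n) {F : ℝ → EuclideanSpace ℝ (Fin n) → ℂ}
    (hF : Measurable fun z : ℝ × EuclideanSpace ℝ (Fin n) => F z.1 z.2) :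
    Measurable fun s : ℝ => sliceNorm fun t (e : Transverse i) => F t (glue i s e) :=
  measurable_sliceNorm (g := fun t s (e : Transverse i) => F t (glue i s e))
    (measurable_comp_glue i hF)

theorem mixedNorm_one_two_add_le (i : Fin n) {F G : ℝ → EuclideanSpace ℝ (Fin n) → ℂ}
    (hF : Measurable fun z : ℝ × EuclideanSpace ℝ (Fin n) => F z.1 z.2)
    (hG : Measurable fun z : ℝ × EuclideanSpace ℝ (Fin n) => G z.1 z.2) :
    mixedNorm i 1 2 (fun t x => F t x + G t x) ≤ mixedNorm i 1 2 F + mixedNorm i 1 2 G := by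
  have hm : ∀ {F : ℝ → EuclideanSpace ℝ (Fin n) → ℂ},
      (Measurable fun z : ℝ × EuclideanSpace ℝ (Fin n) => F z.1 z.2) → ∀ s : ℝ,
      Measurable fun z : ({j : Fin n // j ≠ i} → ℝ) × ℝ => F z.2 (assemble i s z.1) := by
    intro F hF s
    have h := (hF.comp (measurePreserving_sliceCoord i).measurable).comp
      (measurable_prodMk_left (x := s))
    exact h
  have hs := measurable_sliceNorm_glue i hF
  rw [mixedNorm_one_two i hF, mixedNorm_one_two i hG, ← lintegral_add_left hs, mixedNorm,
    eLpNorm_one_eq_lintegral_enorm]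
  refine lintegral_mono fun s => ?_
  simp only [enorm_eq_self]
  rw [← eLpNorm_two_eq_sliceNorm i hF, ← eLpNorm_two_eq_sliceNorm i hG]
  exact eLpNorm_add_le (hm hF s).aestronglyMeasurable (hm hG s).aestronglyMeasurable (by norm_num)

/-- `L²` embeds into the mixed space after division by the weight. -/
theorem mixedNorm_div_weight_le (i : Fin n) {F : ℝ → EuclideanSpace ℝ (Fin n) → ℂ}
    (hF : Measurable fun z : ℝ × EuclideanSpace ℝ (Fin n) => F z.1 z.2) :
    mixedNorm i 1 2 (fun t x => (((weight i x)⁻¹ : ℝ) : ℂ) * F t x) ≤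
      (∫⁻ s : ℝ, ENNReal.ofReal ((1 + s ^ 2)⁻¹) ^ 2) ^ (1 / 2 : ℝ) *
        (∫⁻ z : ℝ × EuclideanSpace ℝ (Fin n), ‖F z.1 z.2‖ₑ ^ 2) ^ (1 / 2 : ℝ) := by
  have hw : Measurable fun z : ℝ × EuclideanSpace ℝ (Fin n) =>
      (((weight i z.2)⁻¹ : ℝ) : ℂ) * F z.1 z.2 :=
    (Complex.measurable_ofReal.comp ((continuous_weight i).measurable.comp measurable_snd).inv).mul hF
  have hs := measurable_sliceNorm_glue i hF
  rw [mixedNorm_one_two i hw]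
  simp only [weight_glue, sliceNorm_const_mul]
  have he : ∀ s : ℝ, ‖((((1 + s ^ 2)⁻¹ : ℝ)) : ℂ)‖ₑ = ENNReal.ofReal ((1 + s ^ 2)⁻¹) := by
    intro s
    rw [← ofReal_norm, Complex.norm_real, Real.norm_of_nonneg (by positivity)]
  simp only [he]
  rw [lintegral_sq_space_time i hF]
  exact lintegral_mul_le_sqrt_mul_sqrt volume (by fun_prop) hs.aemeasurable

end

/-! ### The distribution as a Duhamel pairing -/

noncomputable section
open FourierTransform Filter Topology

namespace RapidDecay

variable {E : Type*} [NormedAddCommGroup E] [InnerProductSpace ℝ E] [FiniteDimensional ℝ E]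
  [MeasurableSpace E] [BorelSpace E] {Ψ Ψ' : ℝ → ℝ → E → ℂ}

theorem add (h : RapidDecay Ψ) (h' : RapidDecay Ψ') :
    RapidDecay fun t ρ η => Ψ t ρ η + Ψ' t ρ η := by
  refine ⟨h.measurable.add h'.measurable, ?_⟩
  obtain ⟨C, hC, hb⟩ := h.bound
  obtain ⟨C', hC', hb'⟩ := h'.bound
  refine ⟨C + C', by positivity, fun t ρ η => (norm_add_le _ _).trans ?_⟩
  rw [add_mul]
  exact add_le_add (hb t ρ η) (hb' t ρ η)

theorem const_mul (h : RapidDecay Ψ) (c : ℂ) : RapidDecay fun t ρ η => c * Ψ t ρ η := by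
  refine ⟨h.measurable.const_mul c, ?_⟩
  obtain ⟨C, hC, hb⟩ := h.bound
  refine ⟨‖c‖ * C, by positivity, fun t ρ η => ?_⟩
  rw [norm_mul, mul_assoc]
  exact mul_le_mul_of_nonneg_left (hb t ρ η) (norm_nonneg c)

end RapidDecay

variable {n : ℕ}

theorem abs_le_norm_glue (i : Fin n) (s : ℝ) (e : Transverse i) :
    |s| ≤ ‖glue i s e‖ ∧ ‖e‖ ≤ ‖glue i s e‖ := by
  have h := norm_glue_sq i s e
  refine ⟨abs_le_of_sq_le_sq ?_ (norm_nonneg _), ?_⟩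
  · nlinarith [sq_nonneg ‖e‖]
  · exact le_of_sq_le_sq (by nlinarith [sq_nonneg s]) (norm_nonneg _)

theorem norm_profile_le (i : Fin n) (j l : ℕ) (φ : 𝓢(EuclideanSpace ℝ (Fin n), ℂ)) :
    ∃ C : ℝ, 0 ≤ C ∧ ∀ ρ η, ‖profile i φ ρ η‖ ≤ C * (decay j ρ * decay l η) := by
  set C := 2 ^ (j + l) * (Finset.Iic (j + l, 0)).sup (fun m => SchwartzMap.seminorm ℂ m.1 m.2) φ
  have hb : ∀ x, (1 + ‖x‖) ^ (j + l) * ‖φ x‖ ≤ C := fun x => by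
    simpa using SchwartzMap.one_add_le_sup_seminorm_apply (𝕜 := ℂ) (m := (j + l, 0)) (k := j + l)
      (n := 0) le_rfl le_rfl φ x
  refine ⟨C, le_trans (by positivity) (hb 0), fun ρ η => ?_⟩
  obtain ⟨h1, h2⟩ := abs_le_norm_glue i ρ η
  have h3 : (1 + ‖ρ‖) ^ j * (1 + ‖η‖) ^ l * ‖profile i φ ρ η‖ ≤ C := by
    refine le_trans ?_ (hb (glue i ρ η))
    rw [pow_add]
    unfold profile
    rw [Real.norm_eq_abs]
    gcongr
  rw [decay, decay, ← mul_inv, ← div_eq_mul_inv, le_div_iff₀ (by positivity)]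
  linarith

theorem measurable_profile (i : Fin n) (φ : 𝓢(EuclideanSpace ℝ (Fin n), ℂ)) :
    Measurable fun p : ℝ × Transverse i => profile i φ p.1 p.2 := by
  have h := φ.continuous.measurable.comp (measurable_glue i measurable_fst measurable_snd :
    Measurable fun p : ℝ × Transverse i => glue i p.1 p.2)
  exact h

theorem rapidDecay_smul_profile (i : Fin n) {χ : ℝ → ℂ} (hχ : Measurable χ) {C : ℝ} (hC : 0 ≤ C)
    (hb : ∀ t, ‖χ t‖ ≤ C * decay 3 t) (φ : 𝓢(EuclideanSpace ℝ (Fin n), ℂ)) :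
    RapidDecay fun t ρ η => χ t * profile i φ ρ η := by
  constructor
  · have h := (measurable_profile i φ).comp (measurable_snd : Measurable (Prod.snd : ℝ × ℝ × Transverse i → _))
    exact (hχ.comp measurable_fst).mul h
  · obtain ⟨K, hK, hp⟩ := norm_profile_le i 5 (Module.finrank ℝ (Transverse i) + 1) φ
    refine ⟨C * K, by positivity, fun t ρ η => ?_⟩
    rw [norm_mul]
    calc _ ≤ (C * decay 3 t) *
        (K * (decay 5 ρ * decay (Module.finrank ℝ (Transverse i) + 1) η)) :=
          mul_le_mul (hb t) (hp ρ η) (norm_nonneg _)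
            (mul_nonneg hC (decay_nonneg _ _))
      _ = _ := by ring

/-- The wave built from the inverse transform of a test function is that test function, so the
right-hand side of the dual estimate becomes its mixed norm. -/
theorem wave_profile (i : Fin n) (H : ℝ → 𝓢(EuclideanSpace ℝ (Fin n), ℂ)) (t r : ℝ)
    (y : Transverse i) :
    wave (fun t => profile i (𝓕⁻ (H t) : 𝓢(EuclideanSpace ℝ (Fin n), ℂ))) t r y =
      H t (glue i r y) := by
  unfold wave
  rw [← fourier_glue i (SchwartzMap.integrable _), ← SchwartzMap.fourier_coe, fourier_fourierInv_eq]

theorem Represents.congr {F G : ℝ → EuclideanSpace ℝ (Fin n) → ℂ}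
    {v : ℝ → 𝓢'(EuclideanSpace ℝ (Fin n), ℂ)} (h : Represents F v)
    (hG : AEStronglyMeasurable (fun z : ℝ × EuclideanSpace ℝ (Fin n) => G z.1 z.2) volume)
    (hFG : (fun z : ℝ × EuclideanSpace ℝ (Fin n) => F z.1 z.2) =ᵐ[volume] fun z => G z.1 z.2) :
    Represents G v := by
  refine ⟨hG, ?_⟩
  filter_upwards [h.2, Measure.ae_ae_of_ae_prod hFG] with t ht hx φ
  have he : (fun x => φ x * F t x) =ᵐ[volume] fun x => φ x * G t x := by
    filter_upwards [hx] with x hx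
    rw [hx]
  exact ⟨(ht φ).1.congr he, (ht φ).2.trans (integral_congr_ae he)⟩

/-- A function on space-time in the coordinates of `glue`. -/
def spaceTime (i : Fin n) (G : ℝ → EuclideanSpace ℝ (Fin n) → ℂ) (τ s : ℝ) (e : Transverse i) : ℂ :=
  G τ (glue i s e)

/-- The bounds above concern families indexed by time. A single profile at a single time is put in
that form by letting the family vanish at all other times; the constant is the inverse of the decay
factor at `t`. -/
theorem exists_rapidDecay_profile (i : Fin n) (t : ℝ) (φ : 𝓢(EuclideanSpace ℝ (Fin n), ℂ)) :
    ∃ Ψ : ℝ → ℝ → Transverse i → ℂ, RapidDecay Ψ ∧ Ψ t = profile i φ := by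
  have hd : 0 < decay 3 t := by unfold decay; positivity
  refine ⟨_, rapidDecay_smul_profile i (χ := ({t} : Set ℝ).indicator 1)
    (measurable_one.indicator (measurableSet_singleton t)) (inv_nonneg.2 hd.le) (fun r => ?_) φ, ?_⟩
  · by_cases h : r = t
    · subst h
      simp [hd.ne']
    · simp only [Set.indicator_of_notMem (Set.notMem_singleton_iff.2 h), norm_zero]
      exact mul_nonneg (inv_nonneg.2 hd.le) (decay_nonneg 3 r)
  · ext ρ η
    simp

theorem boxOp_partialCubed_eq_duhamelPairing
    {σ : (Fin n → ℤ) → EuclideanSpace ℝ (Fin n) → ℝ}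
    (hσ : IsUniformDecomposition σ) (k : Fin n → ℤ) (i : Fin n) {ε : ℝ}
    {f u : ℝ → 𝓢'(EuclideanSpace ℝ (Fin n), ℂ)} (hu : IsDuhamel ε f u)
    {G : ℝ → EuclideanSpace ℝ (Fin n) → ℂ} (hR : Represents G fun t => boxOp σ k (f t))
    (hG : Measurable fun z : ℝ × EuclideanSpace ℝ (Fin n) => G z.1 z.2)
    (hN : ∫⁻ s, sliceNorm (fun τ => spaceTime i G τ s) ≠ ⊤) (t : ℝ)
    (φ : 𝓢(EuclideanSpace ℝ (Fin n), ℂ)) :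
    boxOp σ k (partialCubed i (u t)) φ = -Complex.I * duhamelPairing ε (spaceTime i G) t
      (profile i (𝓕⁻ φ : 𝓢(EuclideanSpace ℝ (Fin n), ℂ))) := by
  obtain ⟨Ψ, hΨ, hΨt⟩ := exists_rapidDecay_profile i t (𝓕⁻ φ : 𝓢(EuclideanSpace ℝ (Fin n), ℂ))
  have h1 := hΨ.duhamelPairing_eq (measurable_comp_glue i hG) hN ε t
  rw [hΨt] at h1
  change duhamelPairing ε (spaceTime i G) t _ = _ at h1
  rw [h1, boxOp_partialCubed_duhamel hσ k i hu, ← intervalIntegral.integral_const_mul]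
  refine intervalIntegral.integral_congr_ae ?_
  -- The representing function is the distribution only for almost every `τ`, but then for all test
  -- functions at once, as needed here because the evolved test function varies with `τ`.
  filter_upwards [hR.2] with τ hτ _
  rw [(hτ _).2, integral_glue i, ← integral_const_mul]
  congr 1
  ext p
  rw [evolveTest_glue, spaceTime]
  ring

end

/-! ### A separable norm controlling the functionals -/

noncomputable section
open FourierTransform Filter Topology

variable {n : ℕ}

theorem hasTemperateGrowth_weight (i : Fin n) :
    Function.HasTemperateGrowth fun x : EuclideanSpace ℝ (Fin n) => (weight i x : ℂ) := by
  have h := (Function.HasTemperateGrowth.const (1 : ℂ)).add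
    ((hasTemperateGrowth_coord i).mul (hasTemperateGrowth_coord i))
  convert h using 1
  ext x
  simp [weight, sq]

theorem hasTemperateGrowth_weight_sq (i : Fin n) :
    Function.HasTemperateGrowth fun x : EuclideanSpace ℝ (Fin n) => (weight i x : ℂ) ^ 2 := by
  simp_rw [sq]
  exact (hasTemperateGrowth_weight i).mul (hasTemperateGrowth_weight i)

/-- The embedding `φ ↦ (ω φ, ω² 𝓕⁻¹ φ)` of the Schwartz space into `L² × L²`, where `ω` is the
weight of the `i`-th variable. -/
def weightedPair (i : Fin n) : 𝓢(EuclideanSpace ℝ (Fin n), ℂ) →ₗ[ℂ]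
    Lp ℂ 2 (volume : Measure (EuclideanSpace ℝ (Fin n))) ×
      Lp ℂ 2 (volume : Measure (EuclideanSpace ℝ (Fin n))) :=
  ((SchwartzMap.toLpCLM ℂ ℂ 2 volume).toLinearMap.comp
    (SchwartzMap.smulLeftCLM ℂ fun x => (weight i x : ℂ)).toLinearMap).prod
  ((SchwartzMap.toLpCLM ℂ ℂ 2 volume).toLinearMap.comp
    ((SchwartzMap.smulLeftCLM ℂ fun x => (weight i x : ℂ) ^ 2).toLinearMap.comp
      (FourierTransform.fourierInvCLM ℂ 𝓢(EuclideanSpace ℝ (Fin n), ℂ)).toLinearMap))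

theorem enorm_toLp_two (φ : 𝓢(EuclideanSpace ℝ (Fin n), ℂ)) :
    ‖(φ.toLp 2 volume : Lp ℂ 2 (volume : Measure (EuclideanSpace ℝ (Fin n))))‖ₑ =
      (∫⁻ x, ‖φ x‖ₑ ^ 2) ^ (1 / 2 : ℝ) := by
  rw [SchwartzMap.toLp, Lp.enorm_toLp, eLpNorm_eq_lintegral_rpow_enorm_toReal (by norm_num) (by norm_num)]
  simp

theorem lintegral_weight_mul_sq_le (i : Fin n) (φ : 𝓢(EuclideanSpace ℝ (Fin n), ℂ)) :
    (∫⁻ x, ‖(weight i x : ℂ) * φ x‖ₑ ^ 2) ^ (1 / 2 : ℝ) ≤ ‖weightedPair i φ‖ₑ := by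
  have h : ‖(weightedPair i φ).1‖ₑ ≤ ‖weightedPair i φ‖ₑ := by
    rw [← ofReal_norm, ← ofReal_norm]
    exact ENNReal.ofReal_le_ofReal (norm_fst_le _)
  refine le_trans (le_of_eq ?_) h
  change _ = ‖(SchwartzMap.smulLeftCLM ℂ (fun x => (weight i x : ℂ)) φ).toLp 2 volume‖ₑ
  rw [enorm_toLp_two]
  simp_rw [SchwartzMap.smulLeftCLM_apply_apply (hasTemperateGrowth_weight i), smul_eq_mul]

theorem lintegral_weight_sq_mul_sq_le (i : Fin n) (φ : 𝓢(EuclideanSpace ℝ (Fin n), ℂ)) :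
    (∫⁻ x, ‖(weight i x : ℂ) ^ 2 * (𝓕⁻ φ : 𝓢(EuclideanSpace ℝ (Fin n), ℂ)) x‖ₑ ^ 2) ^ (1 / 2 : ℝ) ≤
      ‖weightedPair i φ‖ₑ := by
  have h : ‖(weightedPair i φ).2‖ₑ ≤ ‖weightedPair i φ‖ₑ := by
    rw [← ofReal_norm, ← ofReal_norm]
    exact ENNReal.ofReal_le_ofReal (norm_snd_le _)
  refine le_trans (le_of_eq ?_) h
  change _ = ‖(SchwartzMap.smulLeftCLM ℂ (fun x => (weight i x : ℂ) ^ 2) (𝓕⁻ φ)).toLp 2 volume‖ₑ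
  rw [enorm_toLp_two]
  simp_rw [SchwartzMap.smulLeftCLM_apply_apply (hasTemperateGrowth_weight_sq i), smul_eq_mul]

/-- Cauchy–Schwarz in `ρ` with the weight `(1 + ρ²)²`: the square of `|ρ|³ / (1 + ρ²)²` is
integrable. This fixes the power `ω²` on the Fourier side of `weightedPair`. -/
theorem profileNorm_le (i : Fin n) : ∃ K : ℝ≥0∞, K ≠ ⊤ ∧ ∀ φ : 𝓢(EuclideanSpace ℝ (Fin n), ℂ),
    profileNorm (profile i (𝓕⁻ φ : 𝓢(EuclideanSpace ℝ (Fin n), ℂ))) ≤ K * ‖weightedPair i φ‖ₑ := by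
  set a : ℝ → ℝ≥0∞ := fun ρ => ENNReal.ofReal ((2 * Real.pi * |ρ|) ^ 3 / (1 + ρ ^ 2) ^ 2) with ha
  have hK : ∫⁻ ρ, a ρ ^ 2 < ⊤ := by
    refine lt_of_le_of_lt (lintegral_mono fun ρ => ?_)
      (integrable_inv_one_add_sq.const_mul ((2 * Real.pi) ^ 6)).lintegral_lt_top
    rw [ha, ← ENNReal.ofReal_pow (by positivity)]
    refine ENNReal.ofReal_le_ofReal ?_
    rw [div_pow, ← div_eq_mul_inv, div_le_div_iff₀ (by positivity) (by positivity)]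
    have h1 : ((2 * Real.pi * |ρ|) ^ 3) ^ 2 = (2 * Real.pi) ^ 6 * (ρ ^ 2) ^ 3 := by
      rw [← sq_abs ρ]; ring
    have h2 : (ρ ^ 2) ^ 3 ≤ (1 + ρ ^ 2) ^ 3 := by gcongr; linarith
    rw [h1, mul_assoc]
    refine mul_le_mul_of_nonneg_left ?_ (by positivity)
    calc _ ≤ (1 + ρ ^ 2) ^ 3 * (1 + ρ ^ 2) := by gcongr
      _ = _ := by ring
  refine ⟨(∫⁻ ρ, a ρ ^ 2) ^ (1 / 2 : ℝ), ENNReal.rpow_ne_top_of_nonneg (by norm_num) hK.ne,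
    fun φ => ?_⟩
  set ψ : 𝓢(EuclideanSpace ℝ (Fin n), ℂ) := 𝓕⁻ φ with hψ
  refine le_trans ?_ (mul_le_mul_right (lintegral_weight_sq_mul_sq_le i φ) _)
  rw [profileNorm, ← ENNReal.mul_rpow_of_nonneg _ _ (by norm_num)]
  refine ENNReal.rpow_le_rpow ?_ (by norm_num)
  set b : ℝ → Transverse i → ℝ≥0∞ := fun ρ η => ‖((1 + ρ ^ 2 : ℝ) : ℂ) ^ 2 * profile i ψ ρ η‖ₑ with hb
  have hbm : Measurable fun p : ℝ × Transverse i => b p.1 p.2 := by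
    refine Measurable.enorm (Measurable.mul ?_ (measurable_profile i ψ))
    fun_prop
  have he : ∀ ρ η, ‖evolved 0 0 (profile i ψ) ρ η‖ₑ = a ρ * b ρ η := by
    intro ρ η
    rw [← ofReal_norm, norm_evolved, ha, hb]
    simp only
    rw [← ofReal_norm, ← ENNReal.ofReal_mul (by positivity), norm_mul, norm_pow, Complex.norm_real,
      Real.norm_of_nonneg (by positivity)]
    congr 1
    field_simp
  have h3 : ∫⁻ x, ‖(weight i x : ℂ) ^ 2 * ψ x‖ₑ ^ 2 = ∫⁻ η, ∫⁻ ρ, b ρ η ^ 2 := by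
    rw [lintegral_glue i, Measure.volume_eq_prod, lintegral_prod_symm _ _]
    · simp only [weight_glue, hb, profile]
    · simp only [weight_glue]
      exact (hbm.pow_const 2).aemeasurable
  rw [h3, ← lintegral_const_mul' _ _ hK.ne]
  refine lintegral_mono fun η => ?_
  simp only [he]
  have hbη : Measurable fun ρ => b ρ η := by
    have h := hbm.comp (measurable_prodMk_right (y := η) : Measurable fun ρ : ℝ => (ρ, η))
    exact h
  calc _ ≤ ((∫⁻ ρ, a ρ ^ 2) ^ (1 / 2 : ℝ) * (∫⁻ ρ, b ρ η ^ 2) ^ (1 / 2 : ℝ)) ^ 2 := by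
        gcongr
        exact lintegral_mul_le_sqrt_mul_sqrt volume (by fun_prop) hbη.aemeasurable
    _ = _ := by rw [mul_pow, ENNReal.rpow_half_sq, ENNReal.rpow_half_sq]

/-- Any subset of a separable metric space is separable. A countable family of test functions,
chosen independently of time, thus suffices to identify functionals bounded in this norm, and only
countably many null sets of times are discarded. -/
theorem exists_countable_dense_weightedPair (i : Fin n) :
    ∃ D : Set 𝓢(EuclideanSpace ℝ (Fin n), ℂ), D.Countable ∧
      ∀ φ, weightedPair i φ ∈ closure (weightedPair i '' D) := by
  have : Fact ((2 : ℝ≥0∞) ≠ ⊤) := ⟨by norm_num⟩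
  have := Lp.SecondCountableTopology (E := ℂ) (p := 2)
    (μ := (volume : Measure (EuclideanSpace ℝ (Fin n))))
  obtain ⟨t, hts, htc, htd⟩ := (TopologicalSpace.IsSeparable.of_separableSpace
    (Set.range (weightedPair i))).exists_countable_dense_subset
  choose s hs using fun y : t => hts y.2
  have := htc.to_subtype
  refine ⟨Set.range s, Set.countable_range s, fun φ => ?_⟩
  refine closure_mono ?_ (htd ⟨φ, rfl⟩)
  exact fun y hy => ⟨s ⟨y, hy⟩, ⟨_, rfl⟩, hs ⟨y, hy⟩⟩

end

/-! ### From product tests to a density at almost every time -/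

noncomputable section
open FourierTransform Filter Topology

variable {n : ℕ}

theorem eq_zero_of_weightedPair_dense (i : Fin n) {D : Set 𝓢(EuclideanSpace ℝ (Fin n), ℂ)}
    (hD : ∀ φ, weightedPair i φ ∈ closure (weightedPair i '' D))
    {l : 𝓢(EuclideanSpace ℝ (Fin n), ℂ) →ₗ[ℂ] ℂ} {K : ℝ≥0∞} (hK : K ≠ ⊤)
    (hl : ∀ φ, ‖l φ‖ₑ ≤ K * ‖weightedPair i φ‖ₑ) (h0 : ∀ φ ∈ D, l φ = 0)
    (φ : 𝓢(EuclideanSpace ℝ (Fin n), ℂ)) : l φ = 0 := by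
  have hc : IsClosed {y | ‖l φ‖ₑ ≤ K * ‖weightedPair i φ - y‖ₑ} :=
    isClosed_le continuous_const ((ENNReal.continuous_const_mul hK).comp
      (continuous_enorm.comp (continuous_const.sub continuous_id)))
  have hs : weightedPair i '' D ⊆ {y | ‖l φ‖ₑ ≤ K * ‖weightedPair i φ - y‖ₑ} := by
    rintro _ ⟨d, hd, rfl⟩
    have h := hl (φ - d)
    rw [map_sub, map_sub, h0 d hd, sub_zero] at h
    exact h
  have h := closure_minimal hs hc (hD φ)
  simpa using h

variable {i : Fin n} {Γ : ℝ → EuclideanSpace ℝ (Fin n) → ℂ}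

theorem enorm_integral_weight_le {γ : EuclideanSpace ℝ (Fin n) → ℂ} (hγ : Measurable γ)
    (φ : 𝓢(EuclideanSpace ℝ (Fin n), ℂ)) :
    ∫⁻ x, ‖φ x * (weight i x * γ x)‖ₑ ≤
      (∫⁻ x, ‖γ x‖ₑ ^ 2) ^ (1 / 2 : ℝ) * ‖weightedPair i φ‖ₑ := by
  have hw : Measurable fun x => (weight i x : ℂ) * φ x :=
    (Complex.measurable_ofReal.comp (continuous_weight i).measurable).mul φ.continuous.measurable
  calc _ = ∫⁻ x, ‖γ x‖ₑ * ‖(weight i x : ℂ) * φ x‖ₑ := by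
        refine lintegral_congr fun x => ?_
        rw [← enorm_mul]
        congr 1
        ring
    _ ≤ _ := (lintegral_mul_le_sqrt_mul_sqrt volume hγ.enorm.aemeasurable hw.enorm.aemeasurable).trans
        (mul_le_mul_right (lintegral_weight_mul_sq_le i φ) _)

theorem measurable_weight_test (hΓ : Measurable fun z : ℝ × EuclideanSpace ℝ (Fin n) => Γ z.1 z.2)
    (φ : 𝓢(EuclideanSpace ℝ (Fin n), ℂ)) :
    Measurable fun z : ℝ × EuclideanSpace ℝ (Fin n) => φ z.2 * (weight i z.2 * Γ z.1 z.2) :=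
  (φ.continuous.measurable.comp measurable_snd).mul ((Complex.measurable_ofReal.comp
    ((continuous_weight i).measurable.comp measurable_snd)).mul hΓ)

/-- The time decay is square integrable, and so is the spatial norm of `Γ` as a function of time.
Cauchy–Schwarz in space and then in time concludes. -/
theorem integrable_decay_weight_test
    (hΓ : Measurable fun z : ℝ × EuclideanSpace ℝ (Fin n) => Γ z.1 z.2)
    (hΓ2 : ∫⁻ z : ℝ × EuclideanSpace ℝ (Fin n), ‖Γ z.1 z.2‖ₑ ^ 2 ≠ ⊤)
    (φ : 𝓢(EuclideanSpace ℝ (Fin n), ℂ)) :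
    Integrable (fun z : ℝ × EuclideanSpace ℝ (Fin n) =>
      (decay 3 z.1 : ℂ) * (φ z.2 * (weight i z.2 * Γ z.1 z.2))) (volume.prod volume) := by
  have hd : Measurable fun t : ℝ => (decay 3 t : ℂ) :=
    Complex.measurable_ofReal.comp (continuous_decay 3).measurable
  have hm : Measurable fun z : ℝ × EuclideanSpace ℝ (Fin n) =>
      (decay 3 z.1 : ℂ) * (φ z.2 * (weight i z.2 * Γ z.1 z.2)) :=
    (hd.comp measurable_fst).mul (measurable_weight_test hΓ φ)
  have hΓm : Measurable fun z : ℝ × EuclideanSpace ℝ (Fin n) => ‖Γ z.1 z.2‖ₑ ^ 2 :=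
    hΓ.enorm.pow_const 2
  have hd2 : ∫⁻ t : ℝ, ‖(decay 3 t : ℂ)‖ₑ ^ 2 < ⊤ := by
    have h := (integrable_bounded_of_decay (V := ℝ) (k := 3) (μ := volume) (by simp)
      (f := fun t : ℝ => (decay 3 t : ℂ)) hd (C := 1)
      (fun t => by simp [abs_of_nonneg (decay_nonneg 3 t)])).2
    have := h.2
    rw [eLpNorm_eq_lintegral_rpow_enorm_toReal (by norm_num) (by norm_num)] at this
    simpa [ENNReal.rpow_lt_top_iff_of_pos] using this
  have hnm : Measurable fun t : ℝ => (∫⁻ x, ‖Γ t x‖ₑ ^ 2) ^ (1 / 2 : ℝ) :=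
    (hΓm.lintegral_prod_right').pow_const _
  refine ⟨hm.aestronglyMeasurable, ?_⟩
  rw [hasFiniteIntegral_iff_enorm, lintegral_prod _ hm.enorm.aemeasurable]
  calc _ ≤ ∫⁻ t : ℝ, (‖(decay 3 t : ℂ)‖ₑ * (∫⁻ x, ‖Γ t x‖ₑ ^ 2) ^ (1 / 2 : ℝ)) *
        ‖weightedPair i φ‖ₑ := by
        refine lintegral_mono fun t => ?_
        simp only [enorm_mul (decay 3 t : ℂ)]
        rw [lintegral_const_mul' _ _ enorm_ne_top, mul_assoc]
        refine mul_le_mul_right ?_ _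
        exact enorm_integral_weight_le (hΓ.comp measurable_prodMk_left) φ
    _ = (∫⁻ t : ℝ, ‖(decay 3 t : ℂ)‖ₑ * (∫⁻ x, ‖Γ t x‖ₑ ^ 2) ^ (1 / 2 : ℝ)) *
        ‖weightedPair i φ‖ₑ := lintegral_mul_const' _ _ enorm_ne_top
    _ < ⊤ := by
        refine ENNReal.mul_lt_top ?_ enorm_lt_top
        refine (lintegral_mul_le_sqrt_mul_sqrt volume hd.enorm.aemeasurable
          hnm.aemeasurable).trans_lt ?_
        simp only [ENNReal.rpow_half_sq]
        rw [← lintegral_prod _ hΓm.aemeasurable]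
        exact ENNReal.mul_lt_top (ENNReal.rpow_lt_top_of_nonneg (by norm_num) hd2.ne)
          (ENNReal.rpow_lt_top_of_nonneg (by norm_num) hΓ2)

theorem ae_lintegral_sq_lt_top
    (hΓ : Measurable fun z : ℝ × EuclideanSpace ℝ (Fin n) => Γ z.1 z.2)
    (hΓ2 : ∫⁻ z : ℝ × EuclideanSpace ℝ (Fin n), ‖Γ z.1 z.2‖ₑ ^ 2 ≠ ⊤) :
    ∀ᵐ t : ℝ, ∫⁻ x, ‖Γ t x‖ₑ ^ 2 < ⊤ := by
  have hΓm : Measurable fun z : ℝ × EuclideanSpace ℝ (Fin n) => ‖Γ z.1 z.2‖ₑ ^ 2 :=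
    hΓ.enorm.pow_const 2
  rw [Measure.volume_eq_prod, lintegral_prod _ hΓm.aemeasurable] at hΓ2
  exact ae_lt_top hΓm.lintegral_prod_right' hΓ2

/-- A bounded family of functionals that agrees with a square integrable density when tested
against products is represented by that density. -/
theorem ae_forall_eq_integral
    (hΓ : Measurable fun z : ℝ × EuclideanSpace ℝ (Fin n) => Γ z.1 z.2)
    (hΓ2 : ∫⁻ z : ℝ × EuclideanSpace ℝ (Fin n), ‖Γ z.1 z.2‖ₑ ^ 2 ≠ ⊤)
    (w : ℝ → 𝓢(EuclideanSpace ℝ (Fin n), ℂ) →ₗ[ℂ] ℂ)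
    (hw : ∀ t, ∃ K : ℝ≥0∞, K ≠ ⊤ ∧ ∀ φ, ‖w t φ‖ₑ ≤ K * ‖weightedPair i φ‖ₑ)
    (hi : ∀ φ, Integrable fun t => (decay 3 t : ℂ) * w t φ)
    (h : ∀ A, MeasurableSet A → ∀ φ : 𝓢(EuclideanSpace ℝ (Fin n), ℂ),
      ∫ t in A, (decay 3 t : ℂ) * w t φ = ∫ z in A ×ˢ (Set.univ : Set (EuclideanSpace ℝ (Fin n))),
        (decay 3 z.1 : ℂ) * (φ z.2 * (weight i z.2 * Γ z.1 z.2)) ∂(volume.prod volume)) :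
    ∀ᵐ t : ℝ, ∀ φ : 𝓢(EuclideanSpace ℝ (Fin n), ℂ),
      Integrable (fun x => φ x * (weight i x * Γ t x)) ∧
        w t φ = ∫ x, φ x * (weight i x * Γ t x) := by
  obtain ⟨D, hDc, hD⟩ := exists_countable_dense_weightedPair i
  have hone : ∀ φ : 𝓢(EuclideanSpace ℝ (Fin n), ℂ), ∀ᵐ t : ℝ,
      w t φ = ∫ x, φ x * (weight i x * Γ t x) := by
    intro φ
    have hI := integrable_decay_weight_test (i := i) hΓ hΓ2 φ
    have heq := Integrable.ae_eq_of_forall_setIntegral_eq _ _ (hi φ) hI.integral_prod_left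
      -- Equal integrals over every measurable set of times give equality at almost every time; the
      -- strictly positive decay factor then cancels.
      (fun A hA _ => by
        rw [h A hA φ, setIntegral_prod _ hI.integrableOn]
        simp)
    filter_upwards [heq] with t ht
    rw [integral_const_mul] at ht
    have hd : (decay 3 t : ℂ) ≠ 0 := by
      have : decay 3 t ≠ 0 := by unfold decay; positivity
      exact_mod_cast this
    exact mul_left_cancel₀ hd ht
  filter_upwards [(ae_ball_iff hDc).2 fun φ _ => hone φ, ae_lintegral_sq_lt_top hΓ hΓ2] with t ht hft
  have hγ : Measurable (Γ t) := hΓ.comp measurable_prodMk_left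
  have hB : (∫⁻ x, ‖Γ t x‖ₑ ^ 2) ^ (1 / 2 : ℝ) ≠ ⊤ :=
    ENNReal.rpow_ne_top_of_nonneg (by norm_num) hft.ne
  have hint : ∀ φ : 𝓢(EuclideanSpace ℝ (Fin n), ℂ),
      Integrable fun x => φ x * (weight i x * Γ t x) := fun φ =>
    ⟨((measurable_weight_test hΓ φ).comp measurable_prodMk_left).aestronglyMeasurable,
      (enorm_integral_weight_le hγ φ).trans_lt (ENNReal.mul_lt_top hB.lt_top enorm_lt_top)⟩
  -- At a good time the difference of the two functionals is bounded in the norm of `weightedPair`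
  -- and vanishes on the dense family, hence everywhere.
  let l : 𝓢(EuclideanSpace ℝ (Fin n), ℂ) →ₗ[ℂ] ℂ := w t -
    { toFun := fun φ => ∫ x, φ x * (weight i x * Γ t x)
      map_add' := fun φ φ' => by
        rw [← integral_add (hint φ) (hint φ')]
        simp only [_root_.add_apply, add_mul]
      map_smul' := fun c φ => by
        simp only [_root_.smul_apply, smul_eq_mul, mul_assoc, RingHom.id_apply]
        rw [integral_const_mul] }
  have hl : ∀ φ, l φ = w t φ - ∫ x, φ x * (weight i x * Γ t x) := fun φ => rfl
  obtain ⟨K, hK, hwK⟩ := hw t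
  intro φ
  refine ⟨hint φ, sub_eq_zero.1 ((hl φ).symm.trans ?_)⟩
  refine eq_zero_of_weightedPair_dense i hD (ENNReal.add_ne_top.2 ⟨hK, hB⟩) (fun φ => ?_)
    (fun φ hφ => ?_) φ
  · rw [hl, add_mul]
    exact enorm_sub_le.trans (add_le_add (hwK φ)
      ((enorm_integral_le_lintegral_enorm _).trans (enorm_integral_weight_le hγ φ)))
  · rw [hl, ht φ hφ, sub_self]

end

/-! ### Space-time test functions and their density in weighted `L²` -/

noncomputable section
open FourierTransform Filter Topology

variable {n : ℕ}

theorem memLp_two_iff_lintegral {α : Type*} [MeasurableSpace α] {μ : Measure α} {f : α → ℂ}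
    (hf : AEStronglyMeasurable f μ) : MemLp f 2 μ ↔ ∫⁻ x, ‖f x‖ₑ ^ 2 ∂μ < ⊤ := by
  rw [MemLp, eLpNorm_lt_top_iff_lintegral_rpow_enorm_lt_top (by norm_num) (by norm_num)]
  simp [hf]

theorem memLp_two_mul_prod {α β : Type*} [MeasurableSpace α] [MeasurableSpace β] {μ : Measure α}
    {ν : Measure β} [SFinite μ] [SFinite ν] {f : α → ℂ} {g : β → ℂ} (hf : MemLp f 2 μ)
    (hg : MemLp g 2 ν) : MemLp (fun z : α × β => f z.1 * g z.2) 2 (μ.prod ν) := by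
  have hf2 := (memLp_two_iff_lintegral hf.1).1 hf
  have hg2 := (memLp_two_iff_lintegral hg.1).1 hg
  have hm : AEStronglyMeasurable (fun z : α × β => f z.1 * g z.2) (μ.prod ν) :=
    hf.1.comp_fst.mul hg.1.comp_snd
  rw [memLp_two_iff_lintegral hm]
  simp only [enorm_mul, mul_pow]
  rw [lintegral_prod_mul (hf.1.enorm.pow_const 2) (hg.1.enorm.pow_const 2)]
  exact ENNReal.mul_lt_top hf2 hg2

/-- Test functions of space-time: Schwartz in space with rapidly decaying frequency profiles, and
square integrable against the weight of the `i`-th variable. -/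
structure IsTest (i : Fin n) (H : ℝ → 𝓢(EuclideanSpace ℝ (Fin n), ℂ)) : Prop where
  rapidDecay : RapidDecay fun t => profile i (𝓕⁻ (H t) : 𝓢(EuclideanSpace ℝ (Fin n), ℂ))
  measurable : Measurable fun z : ℝ × EuclideanSpace ℝ (Fin n) => H z.1 z.2
  memLp : MemLp (fun z : ℝ × EuclideanSpace ℝ (Fin n) => (weight i z.2 : ℂ) * H z.1 z.2) 2 volume

/-- The space of test functions. -/
def testSpace (i : Fin n) : Submodule ℂ (ℝ → 𝓢(EuclideanSpace ℝ (Fin n), ℂ)) where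
  carrier := {H | IsTest i H}
  add_mem' {H H'} h h' := by
    refine ⟨?_, h.measurable.add h'.measurable, ?_⟩
    · convert h.rapidDecay.add h'.rapidDecay using 4 with t ρ η
      rw [Pi.add_apply, fourierInv_add]
      rfl
    · convert h.memLp.add h'.memLp using 1
      ext z
      simp [mul_add]
  zero_mem' := by
    refine ⟨?_, measurable_const, ?_⟩
    · have h0 : ∀ t : ℝ, profile i (𝓕⁻ ((0 : ℝ → 𝓢(EuclideanSpace ℝ (Fin n), ℂ)) t) :
          𝓢(EuclideanSpace ℝ (Fin n), ℂ)) = 0 := fun t => by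
        have := map_zero (fourierInvCLM ℂ 𝓢(EuclideanSpace ℝ (Fin n), ℂ))
        rw [fourierInvCLM_apply] at this
        rw [Pi.zero_apply, this]
        rfl
      simp_rw [h0]
      exact ⟨measurable_const, 0, le_rfl, by simp⟩
    · simp
  smul_mem' c H h := by
    refine ⟨?_, h.measurable.const_mul c, ?_⟩
    · convert h.rapidDecay.const_mul c using 4 with t ρ η
      rw [Pi.smul_apply, fourierInv_smul]
      rfl
    · convert h.memLp.const_mul c using 1
      ext z
      simp [mul_left_comm]

/-- Multiplication by the weight, from the test space to `L²`. -/
def weightMap (i : Fin n) :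
    testSpace i →ₗ[ℂ] Lp ℂ 2 (volume : Measure (ℝ × EuclideanSpace ℝ (Fin n))) where
  toFun H := H.2.memLp.toLp
  map_add' H H' := by
    rw [← MemLp.toLp_add]
    refine MemLp.toLp_congr _ _ (ae_of_all _ fun z => ?_)
    simp [mul_add]
  map_smul' c H := by
    rw [RingHom.id_apply, ← MemLp.toLp_const_smul]
    refine MemLp.toLp_congr _ _ (ae_of_all _ fun z => ?_)
    simp [mul_left_comm]

theorem coeFn_weightMap {i : Fin n} (H : testSpace i) :
    weightMap i H =ᵐ[volume] fun z => (weight i z.2 : ℂ) * H.1 z.1 z.2 :=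
  H.2.memLp.coeFn_toLp

/-- The time cutoff `1_A(t) (1 + |t|)⁻³`. -/
def cutoff (A : Set ℝ) (t : ℝ) : ℂ := A.indicator (fun t => (decay 3 t : ℂ)) t

theorem measurable_cutoff {A : Set ℝ} (hA : MeasurableSet A) : Measurable (cutoff A) :=
  (Complex.measurable_ofReal.comp (continuous_decay 3).measurable).indicator hA

theorem norm_cutoff_le (A : Set ℝ) (t : ℝ) : ‖cutoff A t‖ ≤ decay 3 t := by
  unfold cutoff
  by_cases h : t ∈ A
  · simp [h, abs_of_nonneg (decay_nonneg 3 t)]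
  · simp [h, decay_nonneg 3 t]

theorem isTest_cutoff (i : Fin n) {A : Set ℝ} (hA : MeasurableSet A)
    (φ : 𝓢(EuclideanSpace ℝ (Fin n), ℂ)) : IsTest i fun t => cutoff A t • φ := by
  have hm := measurable_cutoff hA
  refine ⟨?_, ?_, ?_⟩
  · have h := rapidDecay_smul_profile i hm zero_le_one
      (fun t => by simpa using norm_cutoff_le A t) (𝓕⁻ φ)
    convert h using 4 with t ρ η
    rw [fourierInv_smul]
    rfl
  · exact (hm.comp measurable_fst).mul (φ.continuous.measurable.comp measurable_snd)
  · have h1 : MemLp (cutoff A) 2 volume :=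
      (integrable_bounded_of_decay (V := ℝ) (k := 3) (μ := volume) (by simp) hm (C := 1)
        fun t => by simpa using norm_cutoff_le A t).2
    have h2 : MemLp (fun x => (weight i x : ℂ) * φ x) 2 volume := by
      have h := (SchwartzMap.smulLeftCLM ℂ (fun x => (weight i x : ℂ)) φ).memLp 2 volume
      refine h.ae_eq (ae_of_all _ fun x => ?_)
      rw [SchwartzMap.smulLeftCLM_apply_apply (hasTemperateGrowth_weight i), smul_eq_mul]
    have h3 := memLp_two_mul_prod h1 h2
    refine h3.ae_eq (ae_of_all _ fun z => ?_)
    simp [mul_left_comm]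

/-- A product test function. -/
def productTest (i : Fin n) {A : Set ℝ} (hA : MeasurableSet A)
    (φ : 𝓢(EuclideanSpace ℝ (Fin n), ℂ)) : testSpace i :=
  ⟨fun t => cutoff A t • φ, isTest_cutoff i hA φ⟩

theorem inner_weightMap_productTest {i : Fin n} {A : Set ℝ} (hA : MeasurableSet A)
    (φ : 𝓢(EuclideanSpace ℝ (Fin n), ℂ))
    (γ : Lp ℂ 2 (volume : Measure (ℝ × EuclideanSpace ℝ (Fin n)))) :
    inner ℂ γ (weightMap i (productTest i hA φ)) =
      ∫ z in A ×ˢ (Set.univ : Set (EuclideanSpace ℝ (Fin n))),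
        (decay 3 z.1 : ℂ) * (φ z.2 * (weight i z.2 * starRingEnd ℂ (γ z))) ∂(volume.prod volume) := by
  rw [L2.inner_def, ← integral_indicator (hA.prod MeasurableSet.univ), ← Measure.volume_eq_prod]
  refine integral_congr_ae ?_
  filter_upwards [coeFn_weightMap (productTest i hA φ)] with z hz
  rw [hz, RCLike.inner_apply]
  by_cases h : z.1 ∈ A
  · simp [productTest, cutoff, h]
    ring
  · simp [productTest, cutoff, h]

theorem measurable_conj_Lp (γ : Lp ℂ 2 (volume : Measure (ℝ × EuclideanSpace ℝ (Fin n)))) :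
    Measurable fun z : ℝ × EuclideanSpace ℝ (Fin n) => starRingEnd ℂ (γ (z.1, z.2)) :=
  Complex.continuous_conj.measurable.comp (Lp.stronglyMeasurable γ).measurable

theorem lintegral_sq_Lp {α : Type*} [MeasurableSpace α] {μ : Measure α} (γ : Lp ℂ 2 μ) :
    (∫⁻ z, ‖γ z‖ₑ ^ 2 ∂μ) ^ (1 / 2 : ℝ) = ‖γ‖ₑ := by
  rw [Lp.enorm_def, eLpNorm_eq_lintegral_rpow_enorm_toReal (by norm_num) (by norm_num)]
  simp

theorem lintegral_conj_Lp_ne_top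
    (γ : Lp ℂ 2 (volume : Measure (ℝ × EuclideanSpace ℝ (Fin n)))) :
    ∫⁻ z : ℝ × EuclideanSpace ℝ (Fin n), ‖starRingEnd ℂ (γ (z.1, z.2))‖ₑ ^ 2 ≠ ⊤ := by
  have h := lintegral_sq_Lp γ
  have he : ∀ z : ℂ, ‖starRingEnd ℂ z‖ₑ = ‖z‖ₑ := fun z => by
    rw [← ofReal_norm, RCLike.norm_conj, ofReal_norm]
  simp only [he, Prod.mk.eta]
  rw [← ENNReal.rpow_half_sq (∫⁻ z, ‖γ z‖ₑ ^ 2), h]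
  simp

theorem ae_eq_zero_of_integral_weight {i : Fin n} {γ : EuclideanSpace ℝ (Fin n) → ℂ}
    (hγ : LocallyIntegrable γ volume)
    (h : ∀ φ : 𝓢(EuclideanSpace ℝ (Fin n), ℂ), ∫ x, φ x * (weight i x * γ x) = 0) :
    ∀ᵐ x, γ x = 0 := by
  refine ae_eq_zero_of_integral_contDiff_smul_eq_zero hγ fun g hg hgc => ?_
  have hw : ContDiff ℝ ∞ (weight i) := by unfold weight; fun_prop
  have hq : ContDiff ℝ ∞ fun x => ((g x / weight i x : ℝ) : ℂ) :=
    Complex.ofRealCLM.contDiff.comp (hg.div hw fun x => (weight_pos i x).ne')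
  have hqc : HasCompactSupport fun x => ((g x / weight i x : ℝ) : ℂ) := by
    refine hgc.mono fun x hx => ?_
    contrapose! hx
    simp only [Function.mem_support, not_not] at hx ⊢
    simp [hx]
  -- The test function is `g / ω`, smooth because the weight never vanishes; the factor `ω` in the
  -- hypothesis cancels it.
  rw [← h (hqc.toSchwartzMap hq)]
  congr 1
  ext x
  have := (weight_pos i x).ne'
  rw [HasCompactSupport.toSchwartzMap_toFun, Complex.real_smul]
  push_cast
  have hc : (weight i x : ℂ) ≠ 0 := by exact_mod_cast this
  field_simp

/-- An element orthogonal to the range is orthogonal to all product tests, so its conjugate times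
the weight is a density for the zero functional. At almost every time it vanishes as a distribution,
hence almost everywhere as a function. -/
theorem denseRange_weightMap (i : Fin n) : DenseRange (weightMap i) := by
  have h : (LinearMap.range (weightMap i)).topologicalClosure = ⊤ := by
    rw [Submodule.topologicalClosure_eq_top_iff, Submodule.eq_bot_iff]
    intro γ hγ
    have h0 : ∀ H, inner ℂ γ (weightMap i H) = 0 := fun H =>
      inner_eq_zero_symm.1 ((Submodule.mem_orthogonal _ _).1 hγ _ ⟨H, rfl⟩)
    have h2 : ∀ A, MeasurableSet A → ∀ φ : 𝓢(EuclideanSpace ℝ (Fin n), ℂ),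
        ∫ t in A, (decay 3 t : ℂ) * (0 : 𝓢(EuclideanSpace ℝ (Fin n), ℂ) →ₗ[ℂ] ℂ) φ =
          ∫ z in A ×ˢ (Set.univ : Set (EuclideanSpace ℝ (Fin n))), (decay 3 z.1 : ℂ) *
            (φ z.2 * (weight i z.2 * starRingEnd ℂ (γ (z.1, z.2)))) ∂(volume.prod volume) := by
      intro A hA φ
      have h3 := inner_weightMap_productTest (i := i) hA φ γ
      rw [h0] at h3
      simp only [LinearMap.zero_apply, mul_zero, integral_zero]
      exact h3
    have h1 := ae_forall_eq_integral (i := i) (Γ := fun t x => starRingEnd ℂ (γ (t, x)))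
      (measurable_conj_Lp γ) (lintegral_conj_Lp_ne_top γ)
      (fun _ => 0) (fun t => ⟨0, by simp, by simp⟩) (by simp) h2
    have hmem : ∀ᵐ t : ℝ, MemLp (fun x => starRingEnd ℂ (γ (t, x))) 2 volume := by
      have hΓ := measurable_conj_Lp γ
      filter_upwards [ae_lintegral_sq_lt_top (Γ := fun t x => starRingEnd ℂ (γ (t, x))) hΓ
        (lintegral_conj_Lp_ne_top γ)] with t ht
      have hm : Measurable fun x => starRingEnd ℂ (γ (t, x)) := hΓ.comp measurable_prodMk_left
      exact (memLp_two_iff_lintegral hm.aestronglyMeasurable).2 ht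
    have hz : ∀ᵐ t : ℝ, ∀ᵐ x, γ (t, x) = 0 := by
      filter_upwards [h1, hmem] with t ht hm
      have := ae_eq_zero_of_integral_weight (hm.locallyIntegrable (by norm_num))
        (fun φ => ((ht φ).2).symm)
      filter_upwards [this] with x hx
      simpa using hx
    refine Lp.ext ?_
    have hms : MeasurableSet {z : ℝ × EuclideanSpace ℝ (Fin n) | γ z = 0} :=
      (Lp.stronglyMeasurable γ).measurable (measurableSet_singleton 0)
    have := (Measure.ae_prod_iff_ae_ae hms).2 hz
    filter_upwards [this, Lp.coeFn_zero ℂ 2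
      (volume : Measure (ℝ × EuclideanSpace ℝ (Fin n)))] with z hz h0
    rw [h0, Pi.zero_apply]
    exact hz
  have h2 := Submodule.dense_iff_topologicalClosure_eq_top.2 h
  exact h2

end

/-! ### Riesz density and the duality of the mixed norms -/

noncomputable section
open FourierTransform Filter Topology

variable {n : ℕ}

/-- The norm of `ω⁻¹ F` in the mixed space, where `ω` is the weight of the `i`-th variable. -/
def dividedNorm (i : Fin n) (F : Lp ℂ 2 (volume : Measure (ℝ × EuclideanSpace ℝ (Fin n)))) : ℝ≥0∞ :=
  mixedNorm i 1 2 fun t x => (((weight i x)⁻¹ : ℝ) : ℂ) * F (t, x)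

theorem measurable_inv_weight_mul (i : Fin n) {F : ℝ → EuclideanSpace ℝ (Fin n) → ℂ}
    (hF : Measurable fun z : ℝ × EuclideanSpace ℝ (Fin n) => F z.1 z.2) :
    Measurable fun z : ℝ × EuclideanSpace ℝ (Fin n) => (((weight i z.2)⁻¹ : ℝ) : ℂ) * F z.1 z.2 :=
  (Complex.measurable_ofReal.comp ((continuous_weight i).measurable.comp measurable_snd).inv).mul hF

theorem measurable_coeFn_Lp (F : Lp ℂ 2 (volume : Measure (ℝ × EuclideanSpace ℝ (Fin n)))) :
    Measurable fun z : ℝ × EuclideanSpace ℝ (Fin n) => F (z.1, z.2) :=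
  (Lp.stronglyMeasurable F).measurable

theorem dividedNorm_le (i : Fin n) : ∃ K : ℝ≥0∞, K ≠ ⊤ ∧
    ∀ F : Lp ℂ 2 (volume : Measure (ℝ × EuclideanSpace ℝ (Fin n))), dividedNorm i F ≤ K * ‖F‖ₑ :=
  ⟨(∫⁻ s : ℝ, ENNReal.ofReal ((1 + s ^ 2)⁻¹) ^ 2) ^ (1 / 2 : ℝ),
    ENNReal.rpow_ne_top_of_nonneg (by norm_num) lintegral_inv_one_add_sq_sq_lt_top.ne, fun F => by
    rw [← lintegral_sq_Lp F]
    exact mixedNorm_div_weight_le i (measurable_coeFn_Lp F)⟩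

theorem dividedNorm_add_le (i : Fin n)
    (F G : Lp ℂ 2 (volume : Measure (ℝ × EuclideanSpace ℝ (Fin n)))) :
    dividedNorm i (F + G) ≤ dividedNorm i F + dividedNorm i G := by
  have h := mixedNorm_one_two_add_le i
    (F := fun t x => (((weight i x)⁻¹ : ℝ) : ℂ) * F (t, x))
    (G := fun t x => (((weight i x)⁻¹ : ℝ) : ℂ) * G (t, x)) (measurable_inv_weight_mul i (F := fun t x => F (t, x)) (measurable_coeFn_Lp F))
    (measurable_inv_weight_mul i (F := fun t x => G (t, x)) (measurable_coeFn_Lp G))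
  refine le_trans (le_of_eq (mixedNorm_congr_ae i 1 2 ?_)) h
  filter_upwards [Lp.coeFn_add F G] with z hz
  simp only [Prod.mk.eta]
  rw [hz, Pi.add_apply, mul_add]

theorem dividedNorm_weightMap (i : Fin n) (H : testSpace i) :
    dividedNorm i (weightMap i H) = mixedNorm i 1 2 fun t x => H.1 t x := by
  refine mixedNorm_congr_ae i 1 2 ?_
  filter_upwards [coeFn_weightMap H] with z hz
  simp only [Prod.mk.eta]
  have h : (weight i z.2 : ℂ) ≠ 0 := by exact_mod_cast (weight_pos i z.2).ne'
  rw [hz, Complex.ofReal_inv, inv_mul_cancel_left₀ h]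

/-- A functional on test functions bounded in the mixed norm is given by a square integrable
density, and the bound extends to all of `L²`. -/
theorem exists_riesz_of_bound (i : Fin n) (Λ : testSpace i →ₗ[ℂ] ℂ) {C : ℝ≥0∞} (hC : C ≠ ⊤)
    (hΛ : ∀ H : testSpace i, ‖Λ H‖ₑ ≤ C * mixedNorm i 1 2 fun t x => H.1 t x) :
    ∃ γ : Lp ℂ 2 (volume : Measure (ℝ × EuclideanSpace ℝ (Fin n))),
      (∀ H, Λ H = inner ℂ γ (weightMap i H)) ∧ ∀ F, ‖inner ℂ γ F‖ₑ ≤ C * dividedNorm i F := by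
  obtain ⟨K, hK, hKF⟩ := dividedNorm_le i
  have hb : ∀ H, ‖Λ H‖ ≤ (C * K).toReal * ‖weightMap i H‖ := by
    intro H
    have h : ‖Λ H‖ₑ ≤ C * K * ‖weightMap i H‖ₑ := by
      refine (hΛ H).trans ?_
      rw [← dividedNorm_weightMap, mul_assoc]
      exact mul_le_mul_right (hKF _) _
    have h2 := ENNReal.toReal_mono
      (ENNReal.mul_ne_top (ENNReal.mul_ne_top hC hK) enorm_ne_top) h
    rwa [ENNReal.toReal_mul, toReal_enorm, toReal_enorm] at h2
  -- The mixed norm is dominated by the `L²` norm of the weighted test function, so the functional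
  -- extends continuously from a dense range to `L²`, where it is an inner product.
  set L := Λ.extendOfNorm (weightMap i) with hL
  set γ := (InnerProductSpace.toDual ℂ _).symm L with hγ
  have h1 : ∀ H, Λ H = inner ℂ γ (weightMap i H) := fun H => by
    rw [hγ, InnerProductSpace.toDual_symm_apply, hL,
      LinearMap.extendOfNorm_eq (denseRange_weightMap i) ⟨_, hb⟩]
  refine ⟨γ, h1, fun F => ?_⟩
  -- When `F` is replaced by a nearby element of the range, the inner product changes by at most
  -- `‖γ‖` times the distance and `C * dividedNorm` by at most `C K` times it.
  set M := ‖γ‖ₑ + C * K with hM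
  have hMt : M ≠ ⊤ := ENNReal.add_ne_top.2 ⟨enorm_ne_top, ENNReal.mul_ne_top hC hK⟩
  have hc : IsClosed {G | ‖inner ℂ γ F‖ₑ ≤ C * dividedNorm i F + M * ‖G - F‖ₑ} :=
    isClosed_le continuous_const (continuous_const.add ((ENNReal.continuous_const_mul hMt).comp
      (continuous_enorm.comp (continuous_id.sub continuous_const))))
  have hs : Set.range (weightMap i) ⊆
      {G | ‖inner ℂ γ F‖ₑ ≤ C * dividedNorm i F + M * ‖G - F‖ₑ} := by
    rintro _ ⟨H, rfl⟩
    set G := weightMap i H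
    have h2 : inner ℂ γ F = inner ℂ γ G - inner ℂ γ (G - F) := by rw [inner_sub_right]; ring
    have h3 : dividedNorm i G ≤ dividedNorm i F + K * ‖G - F‖ₑ := by
      have := dividedNorm_add_le i F (G - F)
      rw [add_sub_cancel] at this
      exact this.trans (add_le_add le_rfl (hKF _))
    have h4 : ‖inner ℂ γ (G - F)‖ₑ ≤ ‖γ‖ₑ * ‖G - F‖ₑ := by
      rw [← ofReal_norm, ← ofReal_norm, ← ofReal_norm, ← ENNReal.ofReal_mul (norm_nonneg _)]
      exact ENNReal.ofReal_le_ofReal (norm_inner_le_norm _ _)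
    have h5 : ‖inner ℂ γ G‖ₑ ≤ C * dividedNorm i G := by
      rw [← h1 H, dividedNorm_weightMap]
      exact hΛ H
    calc ‖inner ℂ γ F‖ₑ ≤ ‖inner ℂ γ G‖ₑ + ‖inner ℂ γ (G - F)‖ₑ := by
          rw [h2]; exact enorm_sub_le
      _ ≤ C * (dividedNorm i F + K * ‖G - F‖ₑ) + ‖γ‖ₑ * ‖G - F‖ₑ :=
          add_le_add (h5.trans (mul_le_mul_right h3 _)) h4
      _ = C * dividedNorm i F + M * ‖G - F‖ₑ := by rw [hM]; ring
  have h := closure_minimal hs hc (denseRange_weightMap i F)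
  simpa using h

/-- On the part of a bounded interval where `N > C` one has `N² > C N` wherever `N` is finite. The
integral inequality, with both sides finite, contradicts this unless the set is null. -/
theorem ae_le_of_setLIntegral_sq_le {N : ℝ → ℝ≥0∞} (hN : Measurable N) {C : ℝ≥0∞}
    (h : ∀ (m : ℕ) (A : Set ℝ), MeasurableSet A → (∀ s ∈ A, |s| ≤ m) →
      ∫⁻ s in A, N s ^ 2 ≠ ⊤ ∧ ∫⁻ s in A, N s ^ 2 ≤ C * ∫⁻ s in A, N s) :
    ∀ᵐ s, N s ≤ C := by
  have hkey : ∀ m : ℕ, ∀ᵐ s : ℝ, |s| ≤ m → N s ≤ C := by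
    intro m
    set A : Set ℝ := {s | |s| ≤ m ∧ C < N s} with hA
    have hAm : MeasurableSet A :=
      (measurableSet_le (f := fun s : ℝ => |s|) (by fun_prop) measurable_const).inter
        (measurableSet_lt measurable_const hN)
    obtain ⟨hfin, hle⟩ := h m A hAm fun s hs => hs.1
    rw [← lintegral_const_mul _ hN] at hle
    have hCN : ∀ᵐ s ∂(volume.restrict A), C * N s ≤ N s ^ 2 := by
      filter_upwards [ae_restrict_mem hAm] with s hs
      rw [sq]
      exact mul_le_mul_left hs.2.le _
    have heq := ae_eq_of_ae_le_of_lintegral_le hCN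
      (ne_top_of_le_ne_top hfin (lintegral_mono_ae hCN)) (hN.pow_const 2).aemeasurable hle
    have hNt := ae_lt_top (hN.pow_const 2) hfin
    have hfalse : ∀ᵐ s ∂(volume.restrict A), False := by
      filter_upwards [heq, hNt, ae_restrict_mem hAm] with s h1 h2 hs
      have h3 : N s ≠ ⊤ := by
        intro h3; simp [h3] at h2
      rw [sq] at h1
      exact hs.2.ne ((ENNReal.mul_left_inj (ne_bot_of_gt hs.2) h3).1 h1)
    rw [ae_restrict_iff' hAm] at hfalse
    filter_upwards [hfalse] with s hs hsm
    by_contra hcon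
    exact hs ⟨hsm, not_le.1 hcon⟩
  filter_upwards [ae_all_iff.2 hkey] with s hs
  obtain ⟨m, hm⟩ := exists_nat_ge |s|
  exact hs m hm

/-- The weight `ω²` restricted to the slices `x_i ∈ A`. -/
def slabWeight (A : Set ℝ) (s : ℝ) : ℝ := A.indicator (fun s => (1 + s ^ 2) ^ 2) s

theorem measurable_slabWeight {A : Set ℝ} (hA : MeasurableSet A) : Measurable (slabWeight A) :=
  Measurable.indicator (by fun_prop) hA

theorem slabWeight_nonneg (A : Set ℝ) (s : ℝ) : 0 ≤ slabWeight A s :=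
  Set.indicator_nonneg (fun _ _ => by positivity) s

theorem slabWeight_le {A : Set ℝ} {m : ℕ} (hA : ∀ s ∈ A, |s| ≤ m) (s : ℝ) :
    slabWeight A s ≤ (1 + (m : ℝ) ^ 2) ^ 2 := by
  by_cases hs : s ∈ A
  · rw [slabWeight, Set.indicator_of_mem hs]
    have := sq_le_sq' (by linarith [abs_le.1 (hA s hs)]) (abs_le.1 (hA s hs)).2
    gcongr
  · rw [slabWeight, Set.indicator_of_notMem hs]
    positivity

theorem enorm_one_add_sq (s : ℝ) : ‖((1 + s ^ 2 : ℝ) : ℂ)‖ₑ = ENNReal.ofReal (1 + s ^ 2) := by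
  rw [← ofReal_norm, Complex.norm_real, Real.norm_of_nonneg (by positivity)]

theorem enorm_conj (z : ℂ) : ‖starRingEnd ℂ z‖ₑ = ‖z‖ₑ := by
  rw [← ofReal_norm, RCLike.norm_conj, ofReal_norm]

section Slab

variable {i : Fin n} {γ : ℝ → EuclideanSpace ℝ (Fin n) → ℂ} {A : Set ℝ}

/-- `slabWeight` carries `ω²`, so one division by `ω` leaves a factor `ω`. It is the factor by which
the represented function `ω γ̄` exceeds `γ`. -/
theorem mixedNorm_slab (hγ : Measurable fun z : ℝ × EuclideanSpace ℝ (Fin n) => γ z.1 z.2)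
    (hA : MeasurableSet A) :
    mixedNorm i 1 2 (fun t x => (((weight i x)⁻¹ : ℝ) : ℂ) * ((slabWeight A (x i) : ℂ) * γ t x)) =
      ∫⁻ s in A, ENNReal.ofReal (1 + s ^ 2) * sliceNorm fun t (e : Transverse i) => γ t (glue i s e) := by
  have hm : Measurable fun z : ℝ × EuclideanSpace ℝ (Fin n) => (slabWeight A (z.2 i) : ℂ) * γ z.1 z.2 :=
    (Complex.measurable_ofReal.comp ((measurable_slabWeight hA).comp (by fun_prop))).mul hγ
  rw [mixedNorm_one_two i (measurable_inv_weight_mul i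
    (F := fun t x => (slabWeight A (x i) : ℂ) * γ t x) hm), ← lintegral_indicator hA]
  refine lintegral_congr fun s => ?_
  simp only [weight_glue, glue_self, ← mul_assoc]
  rw [sliceNorm_const_mul]
  by_cases hs : s ∈ A
  · rw [Set.indicator_of_mem hs, slabWeight, Set.indicator_of_mem hs, ← enorm_one_add_sq]
    congr 2
    have : (1 + s ^ 2 : ℝ) ≠ 0 := by positivity
    rw [← Complex.ofReal_mul]
    congr 1
    field_simp
  · rw [Set.indicator_of_notMem hs, slabWeight, Set.indicator_of_notMem hs]
    simp

theorem lintegral_slab (hγ : Measurable fun z : ℝ × EuclideanSpace ℝ (Fin n) => γ z.1 z.2)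
    (hA : MeasurableSet A) :
    ∫⁻ z : ℝ × EuclideanSpace ℝ (Fin n), ENNReal.ofReal (slabWeight A (z.2 i)) * ‖γ z.1 z.2‖ₑ ^ 2 =
      ∫⁻ s in A, (ENNReal.ofReal (1 + s ^ 2) *
        sliceNorm fun t (e : Transverse i) => γ t (glue i s e)) ^ 2 := by
  have hm : Measurable fun z : ℝ × EuclideanSpace ℝ (Fin n) =>
      ENNReal.ofReal (slabWeight A (z.2 i)) * ‖γ z.1 z.2‖ₑ ^ 2 :=
    (ENNReal.measurable_ofReal.comp ((measurable_slabWeight hA).comp (by fun_prop))).mul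
      (hγ.enorm.pow_const 2)
  rw [lintegral_space_time i
    (F := fun t x => ENNReal.ofReal (slabWeight A (x i)) * ‖γ t x‖ₑ ^ 2) hm, ← lintegral_indicator hA]
  refine lintegral_congr fun s => ?_
  simp only [glue_self]
  simp_rw [lintegral_const_mul' _ _ ENNReal.ofReal_ne_top]
  by_cases hs : s ∈ A
  · rw [Set.indicator_of_mem hs, slabWeight, Set.indicator_of_mem hs, mul_pow, sliceNorm_sq,
      ENNReal.ofReal_pow (by positivity)]
  · rw [Set.indicator_of_notMem hs, slabWeight, Set.indicator_of_notMem hs]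
    simp

end Slab

/-- The duality between `L¹L²` and `L^∞L²` in the `i`-th variable. -/
theorem mixedNorm_top_le_of_inner_le (i : Fin n)
    (γ : Lp ℂ 2 (volume : Measure (ℝ × EuclideanSpace ℝ (Fin n)))) {C : ℝ≥0∞}
    (h : ∀ F, ‖inner ℂ γ F‖ₑ ≤ C * dividedNorm i F) :
    mixedNorm i ⊤ 2 (fun t x => (weight i x : ℂ) * starRingEnd ℂ (γ (t, x))) ≤ C := by
  have hγm := measurable_coeFn_Lp γ
  have hwm : Measurable fun z : ℝ × EuclideanSpace ℝ (Fin n) => (weight i z.2 : ℂ) :=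
    Complex.measurable_ofReal.comp ((continuous_weight i).measurable.comp measurable_snd)
  have hNm : Measurable fun s : ℝ => ENNReal.ofReal (1 + s ^ 2) *
      sliceNorm fun t (e : Transverse i) => γ (t, glue i s e) :=
    Measurable.mul (by fun_prop) (measurable_sliceNorm_glue i (F := fun t x => γ (t, x)) hγm)
  refine mixedNorm_top_two_le i (hwm.mul (measurable_conj_Lp γ)) ?_
  have hsl : ∀ s : ℝ, (sliceNorm fun t (e : Transverse i) =>
      (weight i (glue i s e) : ℂ) * starRingEnd ℂ (γ (t, glue i s e))) =
      ENNReal.ofReal (1 + s ^ 2) * sliceNorm fun t (e : Transverse i) => γ (t, glue i s e) := by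
    intro s
    simp only [weight_glue]
    rw [sliceNorm_const_mul, enorm_one_add_sq]
    simp only [sliceNorm, enorm_conj]
  simp only [hsl]
  refine ae_le_of_setLIntegral_sq_le hNm fun m A hA hAb => ?_
  have hac : Measurable fun z : ℝ × EuclideanSpace ℝ (Fin n) => (slabWeight A (z.2 i) : ℂ) :=
    Complex.measurable_ofReal.comp ((measurable_slabWeight hA).comp (by fun_prop))
  -- The extremal test element is `1_A ω² γ`. Pairing it with `γ` gives `∫_A N²` and its divided
  -- norm is `∫_A N`, where `N` is the slice norm of `ω γ`. Boundedness of `A` keeps the element in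
  -- `L²`.
  have hFmem : MemLp (fun z : ℝ × EuclideanSpace ℝ (Fin n) => (slabWeight A (z.2 i) : ℂ) * γ z) 2
      volume := by
    refine (Lp.memLp γ).of_le_mul (c := (1 + (m : ℝ) ^ 2) ^ 2)
      (hac.mul hγm).aestronglyMeasurable (ae_of_all _ fun z => ?_)
    rw [norm_mul, Complex.norm_real, Real.norm_of_nonneg (slabWeight_nonneg _ _)]
    exact mul_le_mul_of_nonneg_right (slabWeight_le hAb _) (norm_nonneg _)
  have hFc := hFmem.coeFn_toLp
  have hF1 : dividedNorm i hFmem.toLp = ∫⁻ s in A, ENNReal.ofReal (1 + s ^ 2) *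
      sliceNorm fun t (e : Transverse i) => γ (t, glue i s e) := by
    rw [← mixedNorm_slab (γ := fun t x => γ (t, x)) hγm hA]
    refine mixedNorm_congr_ae i 1 2 ?_
    filter_upwards [hFc] with z hz
    simp only [Prod.mk.eta]
    rw [hz]
  have hF2 : ‖inner ℂ γ hFmem.toLp‖ₑ = ∫⁻ s in A, (ENNReal.ofReal (1 + s ^ 2) *
      sliceNorm fun t (e : Transverse i) => γ (t, glue i s e)) ^ 2 := by
    rw [← lintegral_slab (γ := fun t x => γ (t, x)) hγm hA, L2.inner_def]
    have h1 : (fun z => inner ℂ (γ z) ((hFmem.toLp : Lp ℂ 2 _) z)) =ᵐ[volume]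
        fun z => ((slabWeight A (z.2 i) * ‖γ z‖ ^ 2 : ℝ) : ℂ) := by
      filter_upwards [hFc] with z hz
      rw [hz, RCLike.inner_apply, mul_assoc, RCLike.mul_conj]
      push_cast
      rfl
    have h2 : Integrable fun z : ℝ × EuclideanSpace ℝ (Fin n) => slabWeight A (z.2 i) * ‖γ z‖ ^ 2 := by
      have := ((L2.integrable_inner (𝕜 := ℂ) γ hFmem.toLp).congr h1).re
      exact this.congr (ae_of_all _ fun z => RCLike.ofReal_re _)
    have h3 : ∀ z : ℝ × EuclideanSpace ℝ (Fin n), 0 ≤ slabWeight A (z.2 i) * ‖γ z‖ ^ 2 :=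
      fun z => mul_nonneg (slabWeight_nonneg _ _) (sq_nonneg _)
    rw [integral_congr_ae h1, integral_complex_ofReal, ← ofReal_norm, Complex.norm_real,
      Real.norm_of_nonneg (integral_nonneg h3),
      ofReal_integral_eq_lintegral_ofReal h2 (ae_of_all _ h3)]
    refine lintegral_congr fun z => ?_
    rw [ENNReal.ofReal_mul (slabWeight_nonneg _ _), ENNReal.ofReal_pow (norm_nonneg _), ofReal_norm]
  rw [← hF1, ← hF2]
  exact ⟨enorm_ne_top, h _⟩

end

/-! ### Conclusion -/

noncomputable section
open FourierTransform Filter Topology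

variable {n : ℕ} {σ : (Fin n → ℤ) → EuclideanSpace ℝ (Fin n) → ℝ} {ε : ℝ}
  {f u : ℝ → 𝓢'(EuclideanSpace ℝ (Fin n), ℂ)} {G : ℝ → EuclideanSpace ℝ (Fin n) → ℂ}

/-- The dual estimate makes time integration against test functions a bounded functional. Its Riesz
density, conjugated and multiplied by the weight, represents the distribution, so it is admissible
in the infimum defining the norm. -/
theorem anisoNorm_duhamel_le_of_measurable (hε : 0 ≤ ε) (hσ : IsUniformDecomposition σ)
    (k : Fin n → ℤ) (i : Fin n) (hu : IsDuhamel ε f u) (hR : Represents G fun t => boxOp σ k (f t))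
    (hG : Measurable fun z : ℝ × EuclideanSpace ℝ (Fin n) => G z.1 z.2)
    (hfin : mixedNorm i 1 2 G ≠ ⊤) :
    anisoNorm i ⊤ 2 (fun t => boxOp σ k (partialCubed i (u t))) ≤ 26 * mixedNorm i 1 2 G := by
  have hg : Measurable fun z : ℝ × ℝ × Transverse i => spaceTime i G z.1 z.2.1 z.2.2 :=
    measurable_comp_glue i hG
  have hmix : mixedNorm i 1 2 G = ∫⁻ s, sliceNorm (fun τ => spaceTime i G τ s) :=
    mixedNorm_one_two i hG
  have hI : ‖-Complex.I‖ₑ = 1 := by simp [← ofReal_norm]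
  have hN := hfin
  rw [hmix] at hN
  set v : ℝ → 𝓢'(EuclideanSpace ℝ (Fin n), ℂ) := fun t => boxOp σ k (partialCubed i (u t)) with hv
  have hvd : ∀ t φ, v t φ = -Complex.I * duhamelPairing ε (spaceTime i G) t
      (profile i (𝓕⁻ φ : 𝓢(EuclideanSpace ℝ (Fin n), ℂ))) := fun t φ =>
    boxOp_partialCubed_eq_duhamelPairing hσ k i hu hR hG hN t φ
  have hint : ∀ H : testSpace i, Integrable fun t => v t (H.1 t) := fun H => by
    simp_rw [hvd]
    exact (H.2.rapidDecay.integrable_duhamelPairing hg hN ε).const_mul _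
  let w : ℝ → 𝓢(EuclideanSpace ℝ (Fin n), ℂ) →ₗ[ℂ] ℂ := fun t =>
    { toFun := fun φ => v t φ
      map_add' := map_add (v t)
      map_smul' := map_smul (v t) }
  let Λ : testSpace i →ₗ[ℂ] ℂ :=
    { toFun := fun H => ∫ t, v t (H.1 t)
      map_add' := fun H H' => by
        rw [← integral_add (hint H) (hint H')]
        simp
      map_smul' := fun c H => by
        rw [RingHom.id_apply, smul_eq_mul, ← integral_const_mul]
        simp }
  have hΛ : ∀ H : testSpace i, ‖Λ H‖ₑ ≤ 26 * mixedNorm i 1 2 G *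
      mixedNorm i 1 2 fun t x => H.1 t x := by
    intro H
    have h1 := H.2.rapidDecay.enorm_integral_duhamelPairing_le hg hN hε
    have h2 : Λ H = -Complex.I * ∫ t, duhamelPairing ε (spaceTime i G) t
        (profile i (𝓕⁻ (H.1 t) : 𝓢(EuclideanSpace ℝ (Fin n), ℂ))) := by
      rw [← integral_const_mul]
      exact integral_congr_ae (ae_of_all _ fun t => hvd t _)
    rw [h2, enorm_mul, mixedNorm_one_two i (G := fun t x => H.1 t x) H.2.measurable, hmix]
    have h3 : ∀ r, (fun t => wave (fun t => profile i
        (𝓕⁻ (H.1 t) : 𝓢(EuclideanSpace ℝ (Fin n), ℂ))) t r) = fun t e => H.1 t (glue i r e) :=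
      fun r => funext fun t => funext fun y => wave_profile i H.1 t r y
    simp only [h3] at h1
    rwa [hI, one_mul]
  obtain ⟨γ, hγ, hγb⟩ := exists_riesz_of_bound i Λ (ENNReal.mul_ne_top (by norm_num) hfin) hΛ
  have hΓ := measurable_conj_Lp γ
  have hrep := ae_forall_eq_integral (i := i) (Γ := fun t x => starRingEnd ℂ (γ (t, x))) hΓ
    (lintegral_conj_Lp_ne_top γ) w
    -- At a fixed time only some finite bound is required, so the crude estimate with its factor
    -- `|t|^{1/2}` is enough.
    (fun t => by
      obtain ⟨K, hK, hKφ⟩ := profileNorm_le i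
      refine ⟨mixedNorm i 1 2 G * (ENNReal.ofReal |t| ^ (1 / 2 : ℝ) * K), ENNReal.mul_ne_top hfin
        (ENNReal.mul_ne_top (ENNReal.rpow_ne_top_of_nonneg (by norm_num) ENNReal.ofReal_ne_top) hK),
        fun φ => ?_⟩
      obtain ⟨Ψ, hΨ, hΨt⟩ := exists_rapidDecay_profile i t
        (𝓕⁻ φ : 𝓢(EuclideanSpace ℝ (Fin n), ℂ))
      have h1 := hΨ.enorm_duhamelPairing_le hg ε t
      rw [hΨt] at h1
      change ‖v t φ‖ₑ ≤ _
      rw [hvd, enorm_mul, hmix, mul_assoc, mul_assoc]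
      rw [hI, one_mul]
      refine h1.trans ?_
      gcongr
      exact hKφ φ)
    (fun φ => by
      refine (hint (productTest i MeasurableSet.univ φ)).congr (ae_of_all _ fun t => ?_)
      refine ((w t).map_smul (cutoff Set.univ t) φ).trans ?_
      simp [cutoff])
    (fun A hA φ => by
      rw [← inner_weightMap_productTest hA φ γ, ← hγ, ← integral_indicator hA]
      refine integral_congr_ae (ae_of_all _ fun t => ?_)
      refine Eq.trans ?_ ((w t).map_smul (cutoff A t) φ).symm
      by_cases ht : t ∈ A <;> simp [cutoff, ht])
  have hrepr : Represents (fun t x => (weight i x : ℂ) * starRingEnd ℂ (γ (t, x))) v := by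
    refine ⟨?_, hrep⟩
    exact ((Complex.measurable_ofReal.comp ((continuous_weight i).measurable.comp
      measurable_snd)).mul hΓ).aestronglyMeasurable
  exact (iInf₂_le (fun t x => (weight i x : ℂ) * starRingEnd ℂ (γ (t, x))) hrepr).trans (mixedNorm_top_le_of_inner_le i γ hγb)

/-- The inhomogeneous local smoothing estimate. -/
theorem anisoNorm_duhamel_le (hε : 0 ≤ ε) (hσ : IsUniformDecomposition σ)
    (k : Fin n → ℤ) (i : Fin n) (hu : IsDuhamel ε f u)
    (hR : Represents G fun t => boxOp σ k (f t)) :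
    anisoNorm i ⊤ 2 (fun t => boxOp σ k (partialCubed i (u t))) ≤ 26 * mixedNorm i 1 2 G := by
  set G' : ℝ × EuclideanSpace ℝ (Fin n) → ℂ := hR.1.mk _ with hG'
  have hm : Measurable G' := hR.1.stronglyMeasurable_mk.measurable
  have he : (fun z : ℝ × EuclideanSpace ℝ (Fin n) => G z.1 z.2) =ᵐ[volume]
      fun z => (fun t x => G' (t, x)) z.1 z.2 := hR.1.ae_eq_mk
  have hR' := hR.congr (G := fun t x => G' (t, x)) hm.aestronglyMeasurable he
  rw [mixedNorm_congr_ae i 1 2 (G := fun t x => G' (t, x)) he]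
  -- An infinite right-hand side leaves nothing to prove; otherwise finiteness provides the absolute
  -- convergence.
  by_cases hfin : mixedNorm i 1 2 (fun t x => G' (t, x)) = ⊤
  · rw [hfin, ENNReal.mul_top (by norm_num)]
    exact le_top
  · exact anisoNorm_duhamel_le_of_measurable hε hσ k i hu hR' hm hfin

end

theorem proposition2p1 :
    ∃ C : ℝ≥0, ∀ (n : ℕ) (ε : ℝ), (ε = 0 ∨ ε = 1) →
      ∀ σ : (Fin n → ℤ) → EuclideanSpace ℝ (Fin n) → ℝ, IsUniformDecomposition σ →
      ∀ (k : Fin n → ℤ) (i : Fin n), (k i).natAbs = kMax k →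
      ∀ f u : ℝ → 𝓢'(EuclideanSpace ℝ (Fin n), ℂ), IsDuhamel ε f u →
        anisoNorm i ∞ 2 (fun t => boxOp σ k (partialCubed i (u t))) ≤
          C * anisoNorm i 1 2 (fun t => boxOp σ k (f t)) := by
  refine ⟨26, fun n ε hε σ hσ k i _ f u hu => ?_⟩
  have h0 : 0 ≤ ε := by rcases hε with rfl | rfl <;> norm_num
  have hC0 : ((26 : ℝ≥0) : ℝ≥0∞) ≠ 0 := by norm_num
  have hC : ((26 : ℝ≥0) : ℝ≥0∞) ≠ ⊤ := ENNReal.coe_ne_top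
  -- A nonzero finite constant passes through the infimum over representing functions, which is
  -- infinite when there are none, so it is enough to treat each of them.
  rw [anisoNorm.eq_1 i 1, ENNReal.mul_iInf_of_ne hC0 hC]
  refine le_iInf fun G => ?_
  rw [ENNReal.mul_iInf_of_ne hC0 hC]
  exact le_iInf fun hG => anisoNorm_duhamel_le h0 hσ k i hu hG
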